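/- **Definitions.** A submonoid $P\subseteq\mathbb Z^k$ is *weakly toric* if it is finitely generated and saturated in the group $P^{\rm gp}$ it generates; $\operatorname{rank}P=\operatorname{rank}P^{\rm gp}$. A *face* of $P$ is a submonoid $F\subseteq P$ such that $p,q\in P$, $p+q\in F$ imply $p,q\in F$. Let $X_P$ be the set of monoid morphisms $x:P\to([0,\infty),\cdot)$, with the weakest topology making all $\lambda_p:x\mapsto x(p)$ $(p\in P)$ continuous. For $x\in X_P$ put $\operatorname{supp}x=\{p\in P:x(p)\ne0\}$ (a face of $P$) and $\operatorname{depth}x=\operatorname{rank}P-\operatorname{rank}(\operatorname{supp}x)$. Let $U\subseteq X_P$ be open. A function $h:U\to\mathbb R$ is *smooth* if $h=g\circ(\lambda_{r_1},\dots,\lambda_{r_n})$ on $U$ for some $r_1,\dots,r_n\in P$ and some smooth $g$ on an open subset of $\mathbb R^n$ containing the image of $U$. A function $f:U\to[0,\infty)$ is *smooth* if locally on $U$ either $f=\lambda_p\cdot h$ with $p\in P$ and $h$ smooth with values in $(0,\infty)$, or $f=0$. A continuous map $f$ from $U$ to an open subset of $X_Q$ is *smooth* if $\lambda_q\circ f:U\to[0,\infty)$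 is smooth for all $q\in Q$. An $n$-dimensional *manifold with g-corners* is a second countable Hausdorff space $X$ with a maximal atlas of charts $(P,U,\phi)$, where $P$ is weakly toric of rank $n$, $U\subseteq X_P$ is open and $\phi$ is a homeomorphism from $U$ onto an open subset of $X$, any two charts being related by transition maps that are smooth in both directions. If charts of different dimensions are allowed, one speaks of *mixed dimension*. Smoothness of continuous maps between such spaces is defined in charts. The depth of points is defined through charts; $S^k(X)$ is the set of points of depth $k$, a manifold without boundary, and $X^\circ=S^0(X)$. A smooth map $f:X\to Y$ (or a smooth function to $[0,\infty)$, whose interior is $(0,\infty)$) is *interior* if $f(X^\circ)\subseteq Y^\circ$. For $x\in X$ let $\mathcal I_x(X)$ be the multiplicative monoid of germs at $x$ of interior functions to $[0,\infty)$, and let $\tilde M_xX$ be the monoid of morphisms $\alpha:\mathcal I_x(X)\to(\mathbb N,+)$ with $\alpha([c])=0$ whenever $c(x)>0$. An interior map $f$ induces $\tilde M_xf:\tilde M_xX\to\tilde M_{f(x)}Y$, $\alpha\mapsto\alpha\circ f^*$. An interior map $f:X\to Y$ of manifolds with g-corners, possibly of mixed dimension, is an *interior immersion* if for all $x\in S^k(X)$,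 with $y=f(x)\in S^l(Y)$: (i) ${\rm d}(f|_{S^k(X)})|_x:T_xS^k(X)\to T_yS^l(Y)$ is injective; (ii) $\tilde M_xf$ is injective; and (iii) the quotient monoid $\tilde M_yY/(\tilde M_xf)[\tilde M_xX]$ has torsion-free group completion (here $p\sim p'$ in the quotient if $p+q=p'+q'$ for some $q,q'$ in the submonoid). A *local $k$-corner component* $\gamma$ of $X$ at $x$ is a choice, for all sufficiently small open neighbourhoods $V$ of $x$, of a connected component $\gamma(V)$ of $V\cap S^k(X)$ with $x\in\overline{\gamma(V)}$, such that $x\in\overline{\gamma(V)\cap\gamma(V')}$ for all $V,V'$. The *corners* $C(X)$ is the set of all pairs $(x,\gamma)$ with $x\in X$ and $\gamma$ a local $k$-corner component of $X$ at $x$, $k\ge0$. It is a manifold with g-corners of mixed dimension, with charts $(F,U_F,\phi_F)$ for all charts $(P,U,\phi)$ of $X$ and all faces $F$ of $P$: here $U_F\subseteq X_F$ is the set of those $y$ whose extension by zero $\bar y\in X_P$ lies in $U$, and $\phi_F(y)=(\phi(\bar y),\gamma)$ with $\gamma$ the local corner component given by the stratum $\{\operatorname{supp}=F\}$. A smooth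 map $f:X\to Y$ induces $C(f):C(X)\to C(Y)$, $(x,\gamma)\mapsto(f(x),f_*\gamma)$, where $f_*\gamma$ is the unique local corner component of $Y$ at $f(x)$ such that $(f_*\gamma)(V')$ meets $f(\gamma(V))$ for all sufficiently small $V,V'$; the map $C(f)$ is interior. A smooth map $f:X\to Y$ of manifolds with g-corners is an *immersion* if $C(f):C(X)\to C(Y)$ is an interior immersion, and an *embedding* if it is moreover a homeomorphism onto its image. **Corollary.** Let $W,X,Y$ be manifolds with g-corners, let $i:X\to Y$ be an embedding, and let $f:W\to Y$ be a smooth map with $f(W)\subseteq i(X)$. Then there is a unique smooth map $g:W\to X$ with $f=i\circ g$. If also $f$ is an embedding, then $g$ is an embedding. -/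

import Mathlib

open scoped NNReal Topology ContDiff

universe u v w

namespace GCorners

/-! ### Monoids -/

/-- A submonoid `P ⊆ ℤᵏ` is weakly toric if it is finitely generated and saturated in the group
`Pᵍᵖ` that it generates. (It is automatically integral and torsion-free.) -/
structure IsWeaklyToric {k : ℕ} (P : AddSubmonoid (Fin k → ℤ)) : Prop where
  fg : P.FG
  saturated : ∀ p ∈ AddSubgroup.closure (P : Set (Fin k → ℤ)), ∀ n : ℕ, 1 ≤ n → n • p ∈ P → p ∈ P

/-- The rank of `P`, that is, the rank of the free abelian group `Pᵍᵖ`. -/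
noncomputable def rank {k : ℕ} (P : AddSubmonoid (Fin k → ℤ)) : ℕ :=
  Module.finrank ℤ (AddSubgroup.closure (P : Set (Fin k → ℤ)))

/-- A face `F` of `P`: a submonoid such that `p + q ∈ F` with `p, q ∈ P` forces `p, q ∈ F`. -/
structure IsFace {k : ℕ} (F P : AddSubmonoid (Fin k → ℤ)) : Prop where
  le : F ≤ P
  mem_of_add_mem : ∀ p ∈ P, ∀ q ∈ P, p + q ∈ F → p ∈ F ∧ q ∈ F

/-- The congruence on a commutative monoid `M` whose quotient is the quotient monoid `M / N`:
`p ∼ p'` if `p + q = p' + q'` for some `q, q' ∈ N`. -/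
def quotientCon {M : Type u} [AddCommMonoid M] (N : AddSubmonoid M) : AddCon M where
  r p p' := ∃ q ∈ N, ∃ q' ∈ N, p + q = p' + q'
  iseqv :=
    { refl := fun p => ⟨0, N.zero_mem, 0, N.zero_mem, rfl⟩
      symm := fun ⟨q, hq, q', hq', h⟩ => ⟨q', hq', q, hq, h.symm⟩
      trans := by
        rintro a b c ⟨q, hq, q', hq', h⟩ ⟨r, hr, r', hr', h'⟩
        refine ⟨q + r, N.add_mem hq hr, q' + r', N.add_mem hq' hr', ?_⟩
        rw [← add_assoc, h, add_right_comm, h', add_assoc, add_comm r' q'] }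
  add' := by
    rintro a b c d ⟨q, hq, q', hq', h⟩ ⟨r, hr, r', hr', h'⟩
    refine ⟨q + r, N.add_mem hq hr, q' + r', N.add_mem hq' hr', ?_⟩
    rw [add_add_add_comm, h, h', add_add_add_comm]

/-- A commutative monoid `M` is torsion-free if the group `Mᵍᵖ` is torsion-free. -/
def IsTorsionFreeMonoid (M : Type u) [AddCommMonoid M] : Prop :=
  IsAddTorsionFree (Algebra.GrothendieckAddGroup M)

/-! ### The model spaces `X_P` -/

/-- The model space `X_P`: the monoid morphisms `x : P → ([0,∞), ·)`, with the weakest topology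
making all the evaluations `λ_p : x ↦ x(p)` continuous. -/
abbrev Model {k : ℕ} (P : AddSubmonoid (Fin k → ℤ)) : Type :=
  {x : P → ℝ≥0 // x 0 = 1 ∧ ∀ p q : P, x (p + q) = x p * x q}

namespace Model

variable {k : ℕ} {P : AddSubmonoid (Fin k → ℤ)}

/-- The support `{p ∈ P : x(p) ≠ 0}` of `x ∈ X_P`; it is a face of `P`. -/
def supp (x : Model P) : AddSubmonoid (Fin k → ℤ) where
  carrier := {p | ∃ h : p ∈ P, x.1 ⟨p, h⟩ ≠ 0}
  zero_mem' := ⟨P.zero_mem, by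
    have h : x.1 ⟨0, P.zero_mem⟩ = 1 := x.2.1
    rw [h]; exact one_ne_zero⟩
  add_mem' := by
    rintro p q ⟨hp, hp'⟩ ⟨hq, hq'⟩
    refine ⟨P.add_mem hp hq, ?_⟩
    have h : x.1 ⟨p + q, P.add_mem hp hq⟩ = x.1 ⟨p, hp⟩ * x.1 ⟨q, hq⟩ := x.2.2 ⟨p, hp⟩ ⟨q, hq⟩
    rw [h]; exact mul_ne_zero hp' hq'

/-- The depth of `x ∈ X_P`: the codimension `rank P - rank (supp x)` of the face `supp x`. -/
noncomputable def depth (x : Model P) : ℕ := rank P - rank x.supp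

/-- Restriction of a morphism `P → [0,∞)` to a submonoid `F ⊆ P`. -/
def restrict {F : AddSubmonoid (Fin k → ℤ)} (h : F ≤ P) (x : Model P) : Model F :=
  ⟨fun p => x.1 ⟨p, h p.2⟩, x.2.1, fun p q => x.2.2 ⟨p, h p.2⟩ ⟨q, h q.2⟩⟩

open Classical in
/-- For `F = supp x` the stratum of `X_P` through `x` is `{y : supp y = F}`, which `y ↦ log y|_F`
identifies with an affine space over `Hom(F, ℝ)`. This is the point `p ↦ x(p) · exp(t v(p))`
of that stratum, at time `t` on the line through `x` in the direction `v ∈ Hom(F, ℝ)`. -/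
noncomputable def shift (x : Model P) (v : x.supp →+ ℝ) (t : ℝ) : Model P :=
  ⟨fun p => if h : (p : Fin k → ℤ) ∈ x.supp then
      x.1 p * (Real.exp (t * v ⟨p, h⟩)).toNNReal else 0, by
    beta_reduce
    have h0 : ((0 : P) : Fin k → ℤ) ∈ x.supp := x.supp.zero_mem
    have hv : v ⟨((0 : P) : Fin k → ℤ), h0⟩ = 0 := v.map_zero
    rw [dif_pos h0, hv, x.2.1]
    simp, by
    intro p q
    beta_reduce
    have hmul := x.2.2 p q
    by_cases hp : (p : Fin k → ℤ) ∈ x.supp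
    · by_cases hq : (q : Fin k → ℤ) ∈ x.supp
      · have hpq : ((p + q : P) : Fin k → ℤ) ∈ x.supp := x.supp.add_mem hp hq
        have hv : v ⟨((p + q : P) : Fin k → ℤ), hpq⟩ = v ⟨p, hp⟩ + v ⟨q, hq⟩ :=
          v.map_add ⟨p, hp⟩ ⟨q, hq⟩
        rw [dif_pos hp, dif_pos hq, dif_pos hpq, hv, hmul, mul_add, Real.exp_add,
          Real.toNNReal_mul (Real.exp_pos _).le, mul_mul_mul_comm]
      · have hpq : ((p + q : P) : Fin k → ℤ) ∉ x.supp := by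
          rintro ⟨h, h'⟩
          exact hq ⟨q.2, fun h0 => h' (hmul.trans (by rw [show x.1 q = 0 from h0, mul_zero]))⟩
        rw [dif_neg hq, dif_neg hpq, mul_zero]
    · have hpq : ((p + q : P) : Fin k → ℤ) ∉ x.supp := by
        rintro ⟨h, h'⟩
        exact hp ⟨p.2, fun h0 => h' (hmul.trans (by rw [show x.1 p = 0 from h0, zero_mul]))⟩
      rw [dif_neg hp, dif_neg hpq, zero_mul]⟩

end Model

section Smooth

variable {k : ℕ} {P : AddSubmonoid (Fin k → ℤ)}

/-- `h` is smooth as a map `U → ℝ`, for `U ⊆ X_P` open: `h = g ∘ (λ_{r₁}, …, λ_{rₙ})` on `U` for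
some `r₁, …, rₙ ∈ P` and `g` smooth on an open neighbourhood of the image of `U`.
(A function on an open subset of `[0,∞)ⁿ` is smooth up to the boundary exactly if it extends to a
smooth function on an open subset of `ℝⁿ`.) -/
def SmoothReal (U : Set (Model P)) (h : Model P → ℝ) : Prop :=
  ∃ (n : ℕ) (r : Fin n → P) (O : Set (Fin n → ℝ)) (g : (Fin n → ℝ) → ℝ),
    IsOpen O ∧ ContDiffOn ℝ ∞ g O ∧
      ∀ x ∈ U, (fun i => (x.1 (r i) : ℝ)) ∈ O ∧ h x = g (fun i => (x.1 (r i) : ℝ))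

/-- `f` is smooth as a map `U → [0,∞)`, for `U ⊆ X_P` open: locally on `U`, either `f = λ_p · h`
with `p ∈ P` and `h` smooth with values in `(0,∞)`, or `f = 0`. -/
def SmoothNonneg (U : Set (Model P)) (f : Model P → ℝ≥0) : Prop :=
  ∀ x ∈ U, ∃ V : Set (Model P), IsOpen V ∧ x ∈ V ∧
    ((∃ (p : P) (h : Model P → ℝ), SmoothReal (U ∩ V) h ∧
        ∀ z ∈ U ∩ V, 0 < h z ∧ (f z : ℝ) = z.1 p * h z) ∨
      ∀ z ∈ U ∩ V, f z = 0)

theorem SmoothReal.mono {U U' : Set (Model P)} {h : Model P → ℝ} (hh : SmoothReal U h)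
    (hU : U' ⊆ U) : SmoothReal U' h := by
  obtain ⟨n, r, O, g, hO, hg, H⟩ := hh
  exact ⟨n, r, O, g, hO, hg, fun x hx => H x (hU hx)⟩

theorem SmoothReal.mul {U : Set (Model P)} {h h' : Model P → ℝ} (hh : SmoothReal U h)
    (hh' : SmoothReal U h') : SmoothReal U (fun z => h z * h' z) := by
  obtain ⟨n, r, O, g, hO, hg, H⟩ := hh
  obtain ⟨n', r', O', g', hO', hg', H'⟩ := hh'
  let a : (Fin (n + n') → ℝ) → (Fin n → ℝ) := fun y i => y (Fin.castAdd n' i)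
  let b : (Fin (n + n') → ℝ) → (Fin n' → ℝ) := fun y i => y (Fin.natAdd n i)
  have ha : ContDiff ℝ ∞ a := contDiff_pi.2 fun i => contDiff_apply ℝ ℝ _
  have hb : ContDiff ℝ ∞ b := contDiff_pi.2 fun i => contDiff_apply ℝ ℝ _
  refine ⟨n + n', Fin.append r r', a ⁻¹' O ∩ b ⁻¹' O', fun y => g (a y) * g' (b y),
    (hO.preimage ha.continuous).inter (hO'.preimage hb.continuous), ?_, ?_⟩
  · exact (hg.comp ha.contDiffOn fun y hy => hy.1).mul (hg'.comp hb.contDiffOn fun y hy => hy.2)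
  · intro x hx
    have e : a (fun i => (x.1 (Fin.append r r' i) : ℝ)) = fun i => (x.1 (r i) : ℝ) := by
      funext i; simp [a]
    have e' : b (fun i => (x.1 (Fin.append r r' i) : ℝ)) = fun i => (x.1 (r' i) : ℝ) := by
      funext i; simp [b]
    refine ⟨⟨?_, ?_⟩, ?_⟩
    · rw [Set.mem_preimage, e]; exact (H x hx).1
    · rw [Set.mem_preimage, e']; exact (H' x hx).1
    · simp only [e, e', (H x hx).2, (H' x hx).2]

theorem SmoothNonneg.mono {U U' : Set (Model P)} {f : Model P → ℝ≥0} (hf : SmoothNonneg U f)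
    (hU : U' ⊆ U) : SmoothNonneg U' f := by
  intro x hx
  obtain ⟨V, hV, hxV, H⟩ := hf x (hU hx)
  have hs : U' ∩ V ⊆ U ∩ V := Set.inter_subset_inter_left V hU
  refine ⟨V, hV, hxV, H.imp ?_ fun H z hz => H z (hs hz)⟩
  rintro ⟨p, h, hh, H⟩
  exact ⟨p, h, hh.mono hs, fun z hz => H z (hs hz)⟩

theorem SmoothNonneg.mul {U : Set (Model P)} {f f' : Model P → ℝ≥0} (hf : SmoothNonneg U f)
    (hf' : SmoothNonneg U f') : SmoothNonneg U (fun z => f z * f' z) := by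
  intro x hx
  obtain ⟨V, hV, hxV, H⟩ := hf x hx
  obtain ⟨V', hV', hxV', H'⟩ := hf' x hx
  have hs : U ∩ (V ∩ V') ⊆ U ∩ V := fun z hz => ⟨hz.1, hz.2.1⟩
  have hs' : U ∩ (V ∩ V') ⊆ U ∩ V' := fun z hz => ⟨hz.1, hz.2.2⟩
  refine ⟨V ∩ V', hV.inter hV', ⟨hxV, hxV'⟩, ?_⟩
  rcases H with ⟨p, h, hh, H⟩ | H
  · rcases H' with ⟨p', h', hh', H'⟩ | H'
    · refine Or.inl ⟨p + p', fun z => h z * h' z, (hh.mono hs).mul (hh'.mono hs'), ?_⟩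
      intro z hz
      refine ⟨mul_pos (H z (hs hz)).1 (H' z (hs' hz)).1, ?_⟩
      rw [z.2.2, NNReal.coe_mul, NNReal.coe_mul, (H z (hs hz)).2, (H' z (hs' hz)).2]
      ring
    · exact Or.inr fun z hz => by simp [H' z (hs' hz)]
  · exact Or.inr fun z hz => by simp [H z (hs hz)]

theorem SmoothNonneg.one (U : Set (Model P)) : SmoothNonneg U (fun _ => 1) := by
  intro x _
  refine ⟨Set.univ, isOpen_univ, trivial, Or.inl ⟨0, fun _ => 1, ?_, ?_⟩⟩
  · exact ⟨0, Fin.elim0, Set.univ, fun _ => 1, isOpen_univ, contDiffOn_const,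
      fun _ _ => ⟨trivial, rfl⟩⟩
  · intro z _
    rw [z.2.1]
    simp

end Smooth

/-! ### Generalized charts -/

/-- The data of a g-chart on `X`: a submonoid `P ⊆ ℤᵏ` and an `X_P`-valued coordinate map `coord`
on the set `dom ⊆ X` (the values of `coord` off `dom` are irrelevant). The usual triple
`(P, U, φ)` is given by `U = coord(dom)` and `φ = (coord|_dom)⁻¹`. -/
structure GChart (X : Type u) where
  k : ℕ
  P : AddSubmonoid (Fin k → ℤ)
  dom : Set X
  coord : X → Model P

namespace GChart

variable {X : Type u}

/-- `c` is a g-chart on the topological space `X`: `P` is weakly toric, and `coord` is a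
homeomorphism from the open set `dom ⊆ X` onto an open subset of `X_P`. -/
structure IsChart [TopologicalSpace X] (c : GChart X) : Prop where
  weaklyToric : IsWeaklyToric c.P
  isOpen_dom : IsOpen c.dom
  injOn : Set.InjOn c.coord c.dom
  continuousOn : ContinuousOn c.coord c.dom
  isOpen_image : ∀ O : Set X, IsOpen O → O ⊆ c.dom → IsOpen (c.coord '' O)

/-- `f : X → [0,∞)` is smooth on the open set `D ⊆ c.dom` when read in the chart `c`, that is,
`f ∘ φ` is smooth on `φ⁻¹(D) ⊆ X_P`. -/
def SmoothNonnegOn (c : GChart X) (D : Set X) (f : X → ℝ≥0) : Prop :=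
  ∃ G : Model c.P → ℝ≥0, SmoothNonneg (c.coord '' D) G ∧ ∀ x ∈ D, f x = G (c.coord x)

/-- Two g-charts are compatible: the change of coordinates and its inverse are smooth, that is,
their compositions with all the functions `λ_p` are smooth maps to `[0,∞)`. -/
def Compatible (c d : GChart X) : Prop :=
  (∀ q : d.P, c.SmoothNonnegOn (c.dom ∩ d.dom) fun x => (d.coord x).1 q) ∧
    ∀ p : c.P, d.SmoothNonnegOn (c.dom ∩ d.dom) fun x => (c.coord x).1 p

theorem SmoothNonnegOn.mono {c : GChart X} {D D' : Set X} {f : X → ℝ≥0}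
    (hf : c.SmoothNonnegOn D f) (hD : D' ⊆ D) : c.SmoothNonnegOn D' f := by
  obtain ⟨G, hG, H⟩ := hf
  exact ⟨G, hG.mono (Set.image_mono hD), fun x hx => H x (hD hx)⟩

theorem SmoothNonnegOn.mul {c : GChart X} {D : Set X} {f f' : X → ℝ≥0}
    (hf : c.SmoothNonnegOn D f) (hf' : c.SmoothNonnegOn D f') :
    c.SmoothNonnegOn D (fun x => f x * f' x) := by
  obtain ⟨G, hG, H⟩ := hf
  obtain ⟨G', hG', H'⟩ := hf'
  exact ⟨_, hG.mul hG', fun x hx => congrArg₂ (· * ·) (H x hx) (H' x hx)⟩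

end GChart

/-- A topological space with a family of g-charts, possibly of different dimensions. No condition
is imposed: this is the common carrier of the notions below, which are used for manifolds with
g-corners `X`, and for their corners `C(X)`, which are manifolds with g-corners of mixed
dimension. -/
structure GSpace : Type (u + 1) where
  carrier : Type u
  top : TopologicalSpace carrier
  atlas : Set (GChart carrier)

instance : CoeSort GSpace.{u} (Type u) := ⟨GSpace.carrier⟩

instance (X : GSpace.{u}) : TopologicalSpace X := X.top

/-- A manifold with g-corners: a second countable Hausdorff space with a maximal atlas of pairwise
compatible g-charts `(P, U, φ)`, all of the same dimension `rank P = dim`. -/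
structure Manifold : Type (u + 1) extends GSpace.{u} where
  dim : ℕ
  t2 : T2Space carrier
  secondCountable : SecondCountableTopology carrier
  isChart : ∀ c ∈ atlas, c.IsChart
  rank_eq : ∀ c ∈ atlas, rank c.P = dim
  cover : ∀ x : carrier, ∃ c ∈ atlas, x ∈ c.dom
  compatible : ∀ c ∈ atlas, ∀ d ∈ atlas, c.Compatible d
  maximal : ∀ c : GChart carrier, c.IsChart → rank c.P = dim →
    (∀ d ∈ atlas, c.Compatible d) → c ∈ atlas

/-! ### Depth, smooth maps and interior maps -/

namespace GSpace

/-- The depth of a point, read in the charts around it. (On a manifold with g-corners all these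
charts give the same value.) -/
noncomputable def depth (X : GSpace.{u}) (x : X) : ℕ :=
  sInf {d | ∃ c ∈ X.atlas, x ∈ c.dom ∧ d = (c.coord x).depth}

/-- The depth `k` stratum `Sᵏ(X)`. In particular `S⁰(X)` is the interior of `X`. -/
def stratum (X : GSpace.{u}) (k : ℕ) : Set X := {x | X.depth x = k}

/-- `c : V → [0,∞)` is an interior map on the open set `V ⊆ X`: it is smooth in all charts, and
positive at interior points. -/
def InteriorOn (X : GSpace.{u}) (V : Set X) (c : X → ℝ≥0) : Prop :=
  (∀ a ∈ X.atlas, a.SmoothNonnegOn (V ∩ a.dom) c) ∧ ∀ z ∈ V ∩ X.stratum 0, 0 < c z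

end GSpace

/-- Smooth maps: `f` is continuous, and for all charts `(P, U, φ)`, `(Q, V, ψ)` and all `q ∈ Q`
the map `λ_q ∘ ψ⁻¹ ∘ f ∘ φ` is a smooth map to `[0,∞)` where it is defined. -/
def IsSmooth {X : GSpace.{u}} {Y : GSpace.{v}} (f : X → Y) : Prop :=
  Continuous f ∧ ∀ a ∈ X.atlas, ∀ b ∈ Y.atlas, ∀ q : b.P,
    a.SmoothNonnegOn (a.dom ∩ f ⁻¹' b.dom) fun x => (b.coord (f x)).1 q

/-- Interior maps: smooth maps taking interior points to interior points. -/
def IsInterior {X : GSpace.{u}} {Y : GSpace.{v}} (f : X → Y) : Prop :=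
  IsSmooth f ∧ ∀ x ∈ X.stratum 0, f x ∈ Y.stratum 0

/-! ### Germs of interior functions, and the monoids `M̃_x X` -/

namespace GSpace

/-- The monoid `𝓘_x(X)` of germs at `x` of interior functions `X → [0,∞)`, under
multiplication. -/
def interiorGerms (X : GSpace.{u}) (x : X) : Submonoid (Filter.Germ (𝓝 x) ℝ≥0) where
  carrier := {b | ∃ (V : Set X) (c : X → ℝ≥0), IsOpen V ∧ x ∈ V ∧ X.InteriorOn V c ∧
    b = (c : Filter.Germ (𝓝 x) ℝ≥0)}
  one_mem' := ⟨Set.univ, fun _ => 1, isOpen_univ, trivial,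
    ⟨fun _ _ => ⟨fun _ => 1, SmoothNonneg.one _, fun _ _ => rfl⟩, fun _ _ => one_pos⟩, rfl⟩
  mul_mem' := by
    rintro _ _ ⟨V, c, hV, hxV, hc, rfl⟩ ⟨V', c', hV', hxV', hc', rfl⟩
    refine ⟨V ∩ V', fun z => c z * c' z, hV.inter hV', ⟨hxV, hxV'⟩, ⟨fun a ha => ?_, ?_⟩, rfl⟩
    · exact ((hc.1 a ha).mono fun z hz => ⟨hz.1.1, hz.2⟩).mul
        ((hc'.1 a ha).mono fun z hz => ⟨hz.1.2, hz.2⟩)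
    · exact fun z hz => mul_pos (hc.2 z ⟨hz.1.1, hz.2⟩) (hc'.2 z ⟨hz.1.2, hz.2⟩)

/-- `M̃_x X`: the monoid of monoid morphisms `α : (𝓘_x(X), ·) → (ℕ, +)` with `α([c]) = 0` for all
germs `[c]` with `c(x) > 0`. -/
def MTilde (X : GSpace.{u}) (x : X) : AddSubmonoid (Additive (X.interiorGerms x) →+ ℕ) where
  carrier := {α | ∀ b : X.interiorGerms x, 0 < b.1.value → α (Additive.ofMul b) = 0}
  zero_mem' := fun _ _ => rfl
  add_mem' := fun {α β} hα hβ b hb => by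
    rw [AddMonoidHom.add_apply, hα b hb, hβ b hb]

end GSpace

/-- Composition with `f` defines a map `𝓘_{f(x)}(Y) → 𝓘_x(X)`. This holds if `f` is an interior
map. -/
def PullsBack {X : GSpace.{u}} {Y : GSpace.{v}} (f : X → Y) (x : X) : Prop :=
  ∃ hf : Filter.Tendsto f (𝓝 x) (𝓝 (f x)), ∀ b ∈ Y.interiorGerms (f x),
    b.compTendsto f hf ∈ X.interiorGerms x

/-- The monoid morphism `f* : 𝓘_{f(x)}(Y) → 𝓘_x(X)`, `[c] ↦ [c ∘ f]`. -/
def pullback {X : GSpace.{u}} {Y : GSpace.{v}} {f : X → Y} {x : X} (h : PullsBack f x) :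
    Y.interiorGerms (f x) →* X.interiorGerms x where
  toFun b := ⟨b.1.compTendsto f h.1, h.2 b.1 b.2⟩
  map_one' := rfl
  map_mul' := by
    rintro ⟨⟨b⟩, hb⟩ ⟨⟨b'⟩, hb'⟩
    rfl

open Classical in
/-- The monoid morphism `M̃_x f : M̃_x X → M̃_{f(x)} Y`, `α ↦ α ∘ f*`, for an interior map `f`.
(If `f*` is not defined, so that `f` is not interior, the value is irrelevant.) -/
noncomputable def mTildeMap {X : GSpace.{u}} {Y : GSpace.{v}} (f : X → Y) (x : X) :
    X.MTilde x →+ Y.MTilde (f x) :=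
  if h : PullsBack f x then
    { toFun := fun α => ⟨α.1.comp (MonoidHom.toAdditive (pullback h)), by
        rintro ⟨⟨b⟩, hb⟩ hpos
        exact α.2 (pullback h ⟨_, hb⟩) hpos⟩
      map_zero' := rfl
      map_add' := fun _ _ => rfl }
  else 0

/-! ### Derivatives along strata -/

/-- The derivative of `f|_{Sᵏ(X)}` at `x`, read in charts `a` around `x` and `b` around `f(x)`.
With `F = supp (a.coord x)`, the stratum `Sᵏ(X)` is near `x` a manifold with tangent space
`Hom(F, ℝ)`, through the coordinates `log λ_p`, `p ∈ F`; and similarly for the stratum of `f(x)`,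
with coordinates `log λ_q` for `q` in the support of `b.coord (f x)`. The tangent vector `v` is
mapped to the derivatives at `t = 0` of the latter along the image under `f` of the line in
direction `v`. -/
noncomputable def stratumDeriv {X : GSpace.{u}} {Y : GSpace.{v}} (f : X → Y) (x : X)
    (a : GChart X) (b : GChart Y) (v : (a.coord x).supp →+ ℝ) (q : (b.coord (f x)).supp) : ℝ :=
  haveI : Nonempty X := ⟨x⟩
  deriv (fun t : ℝ => Real.log ((b.coord (f (Function.invFunOn a.coord a.dom
    ((a.coord x).shift v t)))).1 ⟨q.1, q.2.1⟩)) 0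

/-- Interior immersions: interior maps `f` such that for every `x ∈ Sᵏ(X)` with
`y = f(x) ∈ Sˡ(Y)`
(i) `d(f|_{Sᵏ(X)})|_x : T_x Sᵏ(X) → T_y Sˡ(Y)` is injective,
(ii) `M̃_x f : M̃_x X → M̃_y Y` is injective, and
(iii) the quotient monoid `M̃_y Y / (M̃_x f)[M̃_x X]` is torsion-free. -/
structure IsInteriorImmersion {X : GSpace.{u}} {Y : GSpace.{v}} (f : X → Y) : Prop where
  isInterior : IsInterior f
  deriv_injective : ∀ x : X, ∀ a ∈ X.atlas, x ∈ a.dom → ∀ b ∈ Y.atlas, f x ∈ b.dom →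
    Function.Injective (stratumDeriv f x a b)
  mTildeMap_injective : ∀ x : X, Function.Injective (mTildeMap f x)
  torsionFree : ∀ x : X,
    IsTorsionFreeMonoid (quotientCon (AddMonoidHom.mrange (mTildeMap f x))).Quotient

/-! ### Corners -/

/-- A local `k`-corner component of `X` at `x`: a choice, for all open neighbourhoods `V` of `x`, of
a connected component `W` of `V ∩ Sᵏ(X)` with `x ∈ closure W`, such that any two choices `W, W'`
satisfy `x ∈ closure (W ∩ W')`. (Such a choice for all sufficiently small `V` extends uniquely to
all `V`.) -/
structure LocalCorner (X : GSpace.{u}) (x : X) where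
  k : ℕ
  comp : TopologicalSpace.OpenNhdsOf x → Set X
  isComponent : ∀ V : TopologicalSpace.OpenNhdsOf x, ∃ z ∈ (V : Set X) ∩ X.stratum k,
    comp V = connectedComponentIn ((V : Set X) ∩ X.stratum k) z
  mem_closure : ∀ V : TopologicalSpace.OpenNhdsOf x, x ∈ closure (comp V)
  mem_closure_inter : ∀ V V' : TopologicalSpace.OpenNhdsOf x, x ∈ closure (comp V ∩ comp V')

/-- The local corner component given by the stratum on which `x` itself lies. -/
noncomputable def LocalCorner.self (X : GSpace.{u}) (x : X) : LocalCorner X x where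
  k := X.depth x
  comp V := connectedComponentIn ((V : Set X) ∩ X.stratum (X.depth x)) x
  isComponent V := ⟨x, ⟨V.mem, rfl⟩, rfl⟩
  mem_closure V := subset_closure (mem_connectedComponentIn ⟨V.mem, rfl⟩)
  mem_closure_inter V V' := subset_closure
    ⟨mem_connectedComponentIn ⟨V.mem, rfl⟩, mem_connectedComponentIn ⟨V'.mem, rfl⟩⟩

/-- The set of pairs `(x, γ)` with `γ` a local `k`-corner component of `X` at `x`, `k ≥ 0`. -/
abbrev CornerPoint (X : GSpace.{u}) : Type u := Σ x : X, LocalCorner X x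

/-- In the chart `a` around `x`, the local corner component `γ` is the one given by the face `F` of
`a.P`, that is, by the set of points whose coordinates have support `F`. -/
def LocalCorner.CorrespondsTo {X : GSpace.{u}} {x : X} (γ : LocalCorner X x) (a : GChart X)
    (F : AddSubmonoid (Fin a.k → ℤ)) : Prop :=
  ∀ V : TopologicalSpace.OpenNhdsOf x, (γ.comp V ∩ {z ∈ a.dom | (a.coord z).supp = F}).Nonempty

/-- The chart on `C(X)` induced by a chart `(P, U, φ)` of `X` and a face `F` of `P`. It is defined
at the `(x, γ)` with `x ∈ φ(U)` and `γ` corresponding to `F`, and its value there is the point of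
`X_F` whose extension by zero to `P` is `φ⁻¹(x)`. -/
def cornerChart {X : GSpace.{u}} (a : GChart X) {F : AddSubmonoid (Fin a.k → ℤ)}
    (hF : IsFace F a.P) : GChart (CornerPoint X) where
  k := a.k
  P := F
  dom := {z | z.1 ∈ a.dom ∧ z.2.CorrespondsTo a F}
  coord z := (a.coord z.1).restrict hF.le

/-- The family of all the charts on `C(X)` induced by charts of `X`. -/
def cornerAtlas (X : GSpace.{u}) : Set (GChart (CornerPoint X)) :=
  {c | ∃ a ∈ X.atlas, ∃ (F : AddSubmonoid (Fin a.k → ℤ)) (hF : IsFace F a.P),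
    c = cornerChart a hF}

/-- The corners `C(X) = ∐ₖ Cₖ(X)`, with the topology for which the induced charts are
homeomorphisms between open sets. -/
def corners (X : GSpace.{u}) : GSpace.{u} where
  carrier := CornerPoint X
  top := TopologicalSpace.generateFrom
    {S | ∃ c ∈ cornerAtlas X, ∃ O : Set (Model c.P), IsOpen O ∧ S = c.dom ∩ c.coord ⁻¹' O}
  atlas := cornerAtlas X

/-- `δ = f_*(γ)`: for all (small) open neighbourhoods `V` of `x` and `V'` of `f(x)` the component of
`V' ∩ Sˡ(Y)` given by `δ` meets the image of the component of `V ∩ Sᵏ(X)` given by `γ`. -/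
def IsPushforward {X : GSpace.{u}} {Y : GSpace.{v}} (f : X → Y) {x : X} (γ : LocalCorner X x)
    (δ : LocalCorner Y (f x)) : Prop :=
  ∀ (V : TopologicalSpace.OpenNhdsOf x) (V' : TopologicalSpace.OpenNhdsOf (f x)),
    (δ.comp V' ∩ f '' γ.comp V).Nonempty

open Classical in
/-- The local corner component `f_*(γ)`. For a smooth map `f` of manifolds with g-corners it exists
and is unique; otherwise the value is irrelevant. -/
noncomputable def pushforward {X : GSpace.{u}} {Y : GSpace.{v}} (f : X → Y) {x : X}
    (γ : LocalCorner X x) : LocalCorner Y (f x) :=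
  if h : ∃ δ, IsPushforward f γ δ then h.choose else LocalCorner.self Y (f x)

/-- The map `C(f) : C(X) → C(Y)`, `(x, γ) ↦ (f(x), f_*(γ))`. -/
noncomputable def cornerMap {X : GSpace.{u}} {Y : GSpace.{v}} (f : X → Y) :
    corners X → corners Y :=
  fun z => ⟨f z.1, pushforward f z.2⟩

/-! ### Immersions and embeddings -/

/-- Immersions: smooth maps `f : X → Y` such that `C(f) : C(X) → C(Y)` is an interior immersion. -/
def IsImmersion {X : GSpace.{u}} {Y : GSpace.{v}} (f : X → Y) : Prop :=
  IsSmooth f ∧ IsInteriorImmersion (cornerMap f)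

/-- Embeddings: immersions that are homeomorphisms onto their images. -/
def IsEmbedding {X : GSpace.{u}} {Y : GSpace.{v}} (f : X → Y) : Prop :=
  IsImmersion f ∧ Topology.IsEmbedding f

end GCorners

namespace GCorners

/-! ### Linear inequalities over the integers -/

/-! Since `i` is a homeomorphism onto its image, the only candidate `g = i⁻¹ ∘ f` exists, is unique
and is continuous. What has to be proved is that it is smooth near each point `x`. Take charts `c`
at `x`, `a` at `g x` and `b` at `i (g x)`, and let `F₀` be the support of `g x`, a face of `a.P`.
Each `λ_q ∘ f = (λ_q ∘ i) ∘ g` is zero near `x` or `λ_r` times a positive smooth function, and the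
same has to be deduced for each `λ_p ∘ g`.

Lattice part. Call `p` an exponent of `i` if some `λ_q ∘ i` equals `λ_p` times a positive smooth
function near `g x`; let `E` be the monoid of exponents. At a corner given by a face `F ⊇ F₀`, the
monoid `M̃` consists of the `ℕ`-valued functionals on `F` that vanish on `F₀`. Conditions (ii) and
(iii) for `C(i)` say that pulling functionals back along the exponents is injective with
torsion-free cokernel. Dually, `F₀` and `E ∩ F` generate the group `Fᵍᵖ`
(`IsInteriorImmersion.mem_closure`, `IsImmersion.mem_closure_exponents`). Applied to all faces at
once, this gives by convexity that every `p` in `a.P` has a positive multiple in `E` modulo `F₀ᵍᵖ`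
(`exists_nsmul_add_eq`).

Consequences for `g`. Because a multiple of `p` is an exponent modulo `F₀ᵍᵖ`, `λ_p ∘ g` either
vanishes near `x` or is positive at interior points near `x`; the `p` of the second kind form a face
`F`. For `p ∈ F` the group statement writes `λ_p ∘ g`, up to positive factors, as a quotient `λ_{r₁}
/ λ_{r₂}`, and the multiple of `p` shows that `n (r₁ - r₂)` lies in `c.P` modulo the support of `x`.
Saturation of `c.P` removes the `n`. Hence `(λ_p ∘ g) · (H ∘ g) = λ_r · K` with `H` and `K` positive
and smooth (`IsImmersion.exists_smooth_factor`).

Calculus part. It remains to see that `H ∘ g` is smooth. Generators of `a.P` are coordinates with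
values in `ℝᴺ`; let `ξ` be their composition with `g`. Several functions on open sets of `ℝᴺ` have
smooth composition with `ξ`: the products of a coordinate with an extension of `H`, the coordinates
vanishing along `g`, the logarithmic relations between the generators of `F₀`, and the extensions of
the `λ_q ∘ i`. The first two kinds force a common zero `t` of their differentials to have no
component transverse to the stratum, the relations make `t` tangent to it, and the last kind makes
`t` zero by condition (i). So `N` of these functions form a local diffeomorphism of `ℝᴺ`, and `ξ` is
smooth (`GChart.realAt_of_forall_fderiv`, `IsImmersion.mapAt_lift`).

If `f` is an embedding, then `C(f) = C(i) ∘ C(g)` is an interior immersion. So is `C(g)`; the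
injectivity of `M̃` of `C(i)` is what transfers torsion-freeness to it
(`IsInteriorImmersion.of_comp`). -/

/-- **Farkas' lemma** over `ℤ`. -/
theorem exists_smul_mem_closure_or_exists_neg {k : ℕ} (l : List (Fin k → ℤ)) (p : Fin k → ℤ) :
    (∃ n : ℕ, 1 ≤ n ∧ n • p ∈ AddSubmonoid.closure {x | x ∈ l}) ∨
      ∃ v : (Fin k → ℤ) →+ ℤ, (∀ a ∈ l, 0 ≤ v a) ∧ v p < 0 := by
  generalize hm : l.length = m
  induction m generalizing l p with
  | zero =>
    obtain rfl : l = [] := List.eq_nil_of_length_eq_zero hm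
    by_cases hp : p = 0
    · exact Or.inl ⟨1, le_rfl, by simp [hp]⟩
    · obtain ⟨j, hj⟩ := Function.ne_iff.1 hp
      refine Or.inr ⟨(-(p j)) • Pi.evalAddMonoidHom (fun _ : Fin k => ℤ) j, by simp, ?_⟩
      have : 0 < p j * p j := mul_self_pos.2 (by simpa using hj)
      simpa using this
  | succ m ih =>
    obtain ⟨b, l, rfl⟩ : ∃ b l', l = b :: l' := by
      cases l with
      | nil => simp at hm
      | cons b l' => exact ⟨b, l', rfl⟩
    have hl : l.length = m := by simpa using hm
    rcases ih l p hl with ⟨n, hn, h⟩ | ⟨v, hv, hvp⟩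
    · exact Or.inl ⟨n, hn, AddSubmonoid.closure_mono (fun x hx => List.mem_cons_of_mem _ hx) h⟩
    by_cases hb : 0 ≤ v b
    · refine Or.inr ⟨v, fun a ha => ?_, hvp⟩
      rcases List.mem_cons.1 ha with rfl | ha
      exacts [hb, hv a ha]
    push Not at hb
    -- project along `b` onto the kernel of `v`
    let T : (Fin k → ℤ) →+ (Fin k → ℤ) :=
      (-(v b)) • AddMonoidHom.id _ + ((zmultiplesHom _ b).comp v)
    have hT : ∀ x, T x = (-(v b)) • x + v x • b := fun x => rfl
    rcases ih (l.map T) (T p) (by simpa using hl) with ⟨n, hn, h⟩ | ⟨w, hw, hwp⟩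
    · left
      have hmem : ∀ x ∈ AddSubmonoid.closure {x | x ∈ l.map T},
          x ∈ AddSubmonoid.closure {x | x ∈ b :: l} := by
        have : AddSubmonoid.closure {x | x ∈ l.map T} ≤ AddSubmonoid.closure {x | x ∈ b :: l} := by
          rw [AddSubmonoid.closure_le]
          intro x hx
          obtain ⟨a, ha, rfl⟩ := List.mem_map.1 hx
          rw [hT]
          have h1 : (-(v b)) • a = (-(v b)).toNat • a := by
            rw [← natCast_zsmul, Int.toNat_of_nonneg (by omega)]
          have h2 : v a • b = (v a).toNat • b := by
            rw [← natCast_zsmul, Int.toNat_of_nonneg (hv a ha)]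
          rw [h1, h2]
          exact AddSubmonoid.add_mem _
            (AddSubmonoid.nsmul_mem _ (AddSubmonoid.subset_closure (s := {x | x ∈ b :: l})
              (List.mem_cons_of_mem _ ha)) _)
            (AddSubmonoid.nsmul_mem _ (AddSubmonoid.subset_closure (s := {x | x ∈ b :: l})
            List.mem_cons_self) _)
        exact this
      refine ⟨n * (-(v b)).toNat, Nat.one_le_iff_ne_zero.2 (Nat.mul_ne_zero (by omega) (by omega)),
        ?_⟩
      -- Solving the definition of `T p` for `p` produces the coefficients `-(v b)` and `-(v p)`,
      -- both positive here, so no subtraction of `b` is needed.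
      have e : (n * (-(v b)).toNat) • p = n • T p + (n * (-(v p)).toNat) • b := by
        rw [hT, ← natCast_zsmul, ← natCast_zsmul, ← natCast_zsmul]
        push_cast
        rw [Int.toNat_of_nonneg (by omega), Int.toNat_of_nonneg (by omega)]
        module
      rw [e]
      exact AddSubmonoid.add_mem _ (hmem _ h)
        (AddSubmonoid.nsmul_mem _ (AddSubmonoid.subset_closure (s := {x | x ∈ b :: l})
            List.mem_cons_self) _)
    · refine Or.inr ⟨w.comp T, fun a ha => ?_, hwp⟩
      rcases List.mem_cons.1 ha with rfl | ha
      · have : T a = 0 := by rw [hT]; module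
        simp [this]
      · exact hw _ (List.mem_map_of_mem ha)

/-! ### Faces of weakly toric monoids -/

theorem mem_closure_iff_exists_sub {k : ℕ} {P : AddSubmonoid (Fin k → ℤ)} {r : Fin k → ℤ} :
    r ∈ AddSubgroup.closure (P : Set (Fin k → ℤ)) ↔ ∃ p ∈ P, ∃ q ∈ P, r = p - q := by
  constructor
  · intro h
    induction h using AddSubgroup.closure_induction with
    | mem x hx => exact ⟨x, hx, 0, P.zero_mem, by simp⟩
    | zero => exact ⟨0, P.zero_mem, 0, P.zero_mem, by simp⟩
    | add x y _ _ hx hy =>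
      obtain ⟨p, hp, q, hq, rfl⟩ := hx
      obtain ⟨p', hp', q', hq', rfl⟩ := hy
      exact ⟨_, P.add_mem hp hp', _, P.add_mem hq hq', by abel⟩
    | neg x _ hx =>
      obtain ⟨p, hp, q, hq, rfl⟩ := hx
      exact ⟨q, hq, p, hp, by abel⟩
  · rintro ⟨p, hp, q, hq, rfl⟩
    exact sub_mem (AddSubgroup.subset_closure hp) (AddSubgroup.subset_closure hq)

theorem exists_list_closure_eq {k : ℕ} {P : AddSubmonoid (Fin k → ℤ)} (h : P.FG) :
    ∃ l : List (Fin k → ℤ), AddSubmonoid.closure {x | x ∈ l} = P := by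
  obtain ⟨S, hS⟩ := h
  exact ⟨S.toList, by simpa using hS⟩

namespace IsFace

variable {k : ℕ} {F F' P : AddSubmonoid (Fin k → ℤ)}

theorem refl (P : AddSubmonoid (Fin k → ℤ)) : IsFace P P :=
  ⟨le_rfl, fun _ hp _ hq _ => ⟨hp, hq⟩⟩

theorem of_le (h : IsFace F P) (h' : IsFace F' P) (hle : F ≤ F') : IsFace F F' :=
  ⟨hle, fun p hp q hq hpq => h.mem_of_add_mem p (h'.le hp) q (h'.le hq) hpq⟩

theorem mem_of_nsmul_mem (h : IsFace F P) {p : Fin k → ℤ} (hp : p ∈ P) {n : ℕ} (hn : 1 ≤ n)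
    (hnp : n • p ∈ F) : p ∈ F := by
  obtain ⟨m, rfl⟩ := Nat.exists_eq_add_of_le hn
  rw [add_nsmul, one_nsmul] at hnp
  exact (h.mem_of_add_mem p hp _ (P.nsmul_mem hp m) hnp).1

/-- A sum of generators lies in a face only if every summand does. Finite generation therefore
passes from `P` to its faces. -/
theorem eq_closure_inter (h : IsFace F P) {S : Set (Fin k → ℤ)} (hS : AddSubmonoid.closure S = P) :
    F = AddSubmonoid.closure (S ∩ F) := by
  apply le_antisymm
  · have : ∀ p ∈ AddSubmonoid.closure S, p ∈ F → p ∈ AddSubmonoid.closure (S ∩ F) := by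
      intro p hp
      induction hp using AddSubmonoid.closure_induction with
      | mem x hx => exact fun hxF => AddSubmonoid.subset_closure ⟨hx, hxF⟩
      | zero => exact fun _ => zero_mem _
      | add x y hx hy ihx ihy =>
        intro hxy
        obtain ⟨h1, h2⟩ := h.mem_of_add_mem x (hS ▸ hx) y (hS ▸ hy) hxy
        exact add_mem (ihx h1) (ihy h2)
    exact fun p hp => this p (hS ▸ h.le hp) hp
  · rw [AddSubmonoid.closure_le]
    exact Set.inter_subset_right

theorem fg (h : IsFace F P) (hP : P.FG) : F.FG := by
  obtain ⟨S, hS⟩ := hP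
  classical
  refine ⟨S.filter (· ∈ F), ?_⟩
  rw [h.eq_closure_inter hS]
  congr 1
  ext x
  simp only [Finset.coe_filter, Set.mem_ofPred_eq, Set.mem_inter_iff, SetLike.mem_coe,
    and_congr_right_iff]
  intro hx
  rw [← h.eq_closure_inter hS]

theorem weaklyToric (h : IsFace F P) (hP : IsWeaklyToric P) : IsWeaklyToric F :=
  ⟨h.fg hP.fg, fun p hp n hn hnp => by
    have h1 : p ∈ P := hP.saturated p (AddSubgroup.closure_mono h.le hp) n hn (h.le hnp)
    exact h.mem_of_nsmul_mem h1 hn hnp⟩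

/-- A face is cut out by a supporting hyperplane. -/
theorem exists_functional (h : IsFace F P) (hP : P.FG) :
    ∃ u : (Fin k → ℤ) →+ ℤ, (∀ p ∈ P, 0 ≤ u p) ∧ ∀ p ∈ P, u p = 0 ↔ p ∈ F := by
  obtain ⟨l, hl⟩ := exists_list_closure_eq hP
  obtain ⟨lF, hlF⟩ := exists_list_closure_eq (h.fg hP)
  -- Farkas is applied to `-a` and the cone `P - F`. If a multiple of `-a` were in that cone, then
  -- `n • a + p ∈ F` for some `p ∈ P`, which forces `a ∈ F`. Adding up the functionals obtained for
  -- the generators of `P` outside `F` gives the supporting functional.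
  have key : ∀ a ∈ P, a ∉ F → ∃ v : (Fin k → ℤ) →+ ℤ, (∀ p ∈ P, 0 ≤ v p) ∧ (∀ p ∈ F, v p = 0) ∧
      0 < v a := by
    intro a ha haF
    rcases exists_smul_mem_closure_or_exists_neg (l ++ lF.map (fun x => -x)) (-a) with
      ⟨n, hn, hna⟩ | ⟨v, hv, hva⟩
    · exfalso
      have : ∀ x ∈ AddSubmonoid.closure {x | x ∈ l ++ lF.map (fun x => -x)},
          ∃ p ∈ P, ∃ f ∈ F, x = p - f := by
        intro x hx
        induction hx using AddSubmonoid.closure_induction with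
        | mem x hx =>
          rcases List.mem_append.1 hx with hx | hx
          · exact ⟨x, hl ▸ AddSubmonoid.subset_closure hx, 0, F.zero_mem, by simp⟩
          · obtain ⟨y, hy, rfl⟩ := List.mem_map.1 hx
            exact ⟨0, P.zero_mem, y, hlF ▸ AddSubmonoid.subset_closure hy, by simp⟩
        | zero => exact ⟨0, P.zero_mem, 0, F.zero_mem, by simp⟩
        | add x y _ _ hx hy =>
          obtain ⟨p, hp, q, hq, rfl⟩ := hx
          obtain ⟨p', hp', q', hq', rfl⟩ := hy
          exact ⟨_, P.add_mem hp hp', _, F.add_mem hq hq', by abel⟩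
      obtain ⟨p, hp, f, hf, e⟩ := this _ hna
      have e' : n • a + p = f := by
        have : n • a = f - p := by rw [← neg_sub, ← e]; simp
        rw [this]; abel
      have := (h.mem_of_add_mem _ (P.nsmul_mem ha n) p hp (e' ▸ hf)).1
      exact haF (h.mem_of_nsmul_mem ha hn this)
    · have hvP : ∀ p ∈ P, 0 ≤ v p := by
        intro p hp
        rw [← hl] at hp
        induction hp using AddSubmonoid.closure_induction with
        | mem x hx => exact hv x (List.mem_append_left _ hx)
        | zero => simp
        | add x y _ _ hx hy => rw [map_add]; exact add_nonneg hx hy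
      refine ⟨v, hvP, fun p hp => ?_, by simpa using hva⟩
      have h0 : 0 ≤ v (-p) := by
        rw [← hlF] at hp
        induction hp using AddSubmonoid.closure_induction with
        | mem x hx => exact hv _ (List.mem_append_right _ (List.mem_map_of_mem hx))
        | zero => simp
        | add x y _ _ hx hy => rw [neg_add, map_add]; exact add_nonneg hx hy
      have h1 := hvP p (h.le hp)
      rw [map_neg] at h0
      omega
  have key2 : ∀ m : List (Fin k → ℤ), (∀ a ∈ m, a ∈ P) → ∃ v : (Fin k → ℤ) →+ ℤ,
      (∀ p ∈ P, 0 ≤ v p) ∧ (∀ p ∈ F, v p = 0) ∧ ∀ a ∈ m, a ∉ F → 0 < v a := by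
    intro m
    induction m with
    | nil => exact fun _ => ⟨0, by simp⟩
    | cons b m ih =>
      intro hm
      obtain ⟨v, h1, h2, h3⟩ := ih fun a ha => hm a (List.mem_cons_of_mem _ ha)
      by_cases hb : b ∈ F
      · refine ⟨v, h1, h2, fun a ha haF => ?_⟩
        rcases List.mem_cons.1 ha with rfl | ha
        exacts [absurd hb haF, h3 a ha haF]
      · obtain ⟨v', h1', h2', h3'⟩ := key b (hm b List.mem_cons_self) hb
        refine ⟨v + v', fun p hp => add_nonneg (h1 p hp) (h1' p hp),
          fun p hp => by simp [h2 p hp, h2' p hp], fun a ha haF => ?_⟩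
        rcases List.mem_cons.1 ha with rfl | ha
        · exact add_pos_of_nonneg_of_pos (h1 _ (hm _ List.mem_cons_self)) h3'
        · exact add_pos_of_pos_of_nonneg (h3 a ha haF) (h1' a (hm a (List.mem_cons_of_mem _ ha)))
  have hlP : ∀ a ∈ l, a ∈ P := fun a ha => hl ▸ AddSubmonoid.subset_closure ha
  obtain ⟨u, h1, h2, h3⟩ := key2 l hlP
  refine ⟨u, h1, fun p hp => ⟨fun hu => ?_, h2 p⟩⟩
  rw [← hl] at hp
  induction hp using AddSubmonoid.closure_induction with
  | mem x hx => by_contra hxF; exact (h3 x hx hxF).ne' hu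
  | zero => exact F.zero_mem
  | add x y hx hy ihx ihy =>
    rw [map_add] at hu
    have hx0 := h1 x (hl ▸ hx)
    have hy0 := h1 y (hl ▸ hy)
    exact F.add_mem (ihx (by omega)) (ihy (by omega))

/-- Two elements of `Pᵍᵖ` which no functional vanishing on the face `F` tells apart differ by an
element of `Fᵍᵖ`. -/
theorem mem_closure_of_forall_eq_zero (h : IsFace F P) (hP : IsWeaklyToric P) {r : Fin k → ℤ}
    (hr : r ∈ AddSubgroup.closure (P : Set (Fin k → ℤ)))
    (hv : ∀ v : (Fin k → ℤ) →+ ℤ, (∀ f ∈ F, v f = 0) → v r = 0) :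
    r ∈ AddSubgroup.closure (F : Set (Fin k → ℤ)) := by
  obtain ⟨lF, hlF⟩ := exists_list_closure_eq (h.fg hP.fg)
  rcases exists_smul_mem_closure_or_exists_neg (lF ++ lF.map (fun x => -x)) r with
    ⟨n, hn, hna⟩ | ⟨v, hv', hva⟩
  · have hmem : n • r ∈ AddSubgroup.closure (F : Set (Fin k → ℤ)) := by
      have : AddSubmonoid.closure {x | x ∈ lF ++ lF.map (fun x => -x)} ≤
          (AddSubgroup.closure (F : Set (Fin k → ℤ))).toAddSubmonoid := by
        rw [AddSubmonoid.closure_le]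
        intro x hx
        rcases List.mem_append.1 hx with hx | hx
        · exact AddSubgroup.subset_closure (hlF ▸ AddSubmonoid.subset_closure hx)
        · obtain ⟨y, hy, rfl⟩ := List.mem_map.1 hx
          exact neg_mem (S := AddSubgroup (Fin k → ℤ))
            (AddSubgroup.subset_closure (hlF ▸ AddSubmonoid.subset_closure hy))
      exact this hna
    obtain ⟨f, hf, f', hf', e⟩ := mem_closure_iff_exists_sub.1 hmem
    -- From `n • r = f - f'`, the translate `r + f'` has a multiple in `F`, so saturation puts it in
    -- `P` and the face property puts it in `F`.
    have h1 : n • (r + f') = f + (n - 1) • f' := by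
      have : (n : ℕ) = (n - 1) + 1 := by omega
      rw [nsmul_add, e]
      nth_rewrite 1 [this]
      rw [add_nsmul, one_nsmul]
      abel
    have h2 : n • (r + f') ∈ F := h1 ▸ F.add_mem hf (F.nsmul_mem hf' _)
    have h3 : r + f' ∈ P := hP.saturated _
      (add_mem hr (AddSubgroup.subset_closure (h.le hf'))) n hn (h.le h2)
    exact mem_closure_iff_exists_sub.2 ⟨r + f', h.mem_of_nsmul_mem h3 hn h2, f', hf', by abel⟩
  · refine absurd (hv v ?_) hva.ne
    intro p hp
    have h1 : 0 ≤ v p ∧ 0 ≤ v (-p) := by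
      rw [← hlF] at hp
      induction hp using AddSubmonoid.closure_induction with
      | mem x hx => exact ⟨hv' _ (List.mem_append_left _ hx),
          hv' _ (List.mem_append_right _ (List.mem_map_of_mem hx))⟩
      | zero => simp
      | add x y _ _ hx hy =>
        rw [neg_add, map_add, map_add]; exact ⟨add_nonneg hx.1 hy.1, add_nonneg hx.2 hy.2⟩
    rw [map_neg] at h1
    omega

end IsFace

/-! ### Real functionals and ranks -/

theorem exists_add_of_eq_of {M : Type*} [AddCommMonoid M] (x : Algebra.GrothendieckAddGroup M) :
    ∃ a b : M, x + Algebra.GrothendieckAddGroup.of b = Algebra.GrothendieckAddGroup.of a := by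
  obtain ⟨⟨a, b⟩, h⟩ := (AddLocalization.addMonoidOf (⊤ : AddSubmonoid M)).surj x
  exact ⟨a, b, h⟩

theorem lift_of {M G : Type*} [AddCommMonoid M] [AddCommGroup G] (f : M →+ G) (a : M) :
    Algebra.GrothendieckAddGroup.lift f (Algebra.GrothendieckAddGroup.of a) = f a :=
  DFunLike.congr_fun (Algebra.GrothendieckAddGroup.lift.symm_apply_apply f) a

/-- A morphism `P → ℝ` extends to `ℤᵏ`. -/
theorem exists_extend {k : ℕ} (P : AddSubmonoid (Fin k → ℤ)) (v : P →+ ℝ) :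
    ∃ w : (Fin k → ℤ) →+ ℝ, ∀ p : P, w p = v p := by
  have hinj : Function.Injective (Algebra.GrothendieckAddGroup.lift P.subtype) := by
    rw [injective_iff_map_eq_zero]
    intro x hx
    obtain ⟨a, b, h⟩ := exists_add_of_eq_of x
    have h' := congrArg (Algebra.GrothendieckAddGroup.lift P.subtype) h
    rw [map_add, hx, zero_add, lift_of, lift_of] at h'
    obtain rfl : b = a := Subtype.ext h'
    simpa using h
  -- `ℝ` is divisible, hence injective as an abelian group, and `Pᵍᵖ` embeds in `ℤᵏ`.
  obtain ⟨w, hw⟩ := (Module.Baer.of_divisible ℝ).extension_property_addMonoidHom _ hinj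
    (Algebra.GrothendieckAddGroup.lift v)
  refine ⟨w, fun p => ?_⟩
  have := DFunLike.congr_fun hw (Algebra.GrothendieckAddGroup.of p)
  rw [AddMonoidHom.comp_apply, lift_of, lift_of] at this
  exact this

/-- The inclusion of `P` into `Pᵍᵖ`. -/
def toSpan {k : ℕ} (P : AddSubmonoid (Fin k → ℤ)) :
    P →+ (AddSubgroup.closure (P : Set (Fin k → ℤ))).toIntSubmodule where
  toFun p := ⟨p, AddSubgroup.subset_closure p.2⟩
  map_zero' := rfl
  map_add' _ _ := rfl

/-- The real vector space of morphisms `P → ℝ` has dimension `rank P`. -/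
theorem finrank_hom {k : ℕ} (P : AddSubmonoid (Fin k → ℤ)) :
    FiniteDimensional ℝ (P →+ ℝ) ∧ Module.finrank ℝ (P →+ ℝ) = rank P := by
  let A := (AddSubgroup.closure (P : Set (Fin k → ℤ))).toIntSubmodule
  have : Module.finrank ℤ A = rank P := rfl
  let b := Module.finBasis ℤ A
  let e₁ := b.constr (M' := ℝ) ℝ
  let i : P →+ A := toSpan P
  let r : (A →ₗ[ℤ] ℝ) →ₗ[ℝ] (P →+ ℝ) :=
    { toFun := fun f => f.toAddMonoidHom.comp i
      map_add' := fun _ _ => rfl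
      map_smul' := fun _ _ => rfl }
  have hr : Function.Bijective r := by
    constructor
    · rw [← LinearMap.ker_eq_bot, LinearMap.ker_eq_bot']
      intro f hf
      ext ⟨x, hx⟩
      obtain ⟨p, hp, q, hq, rfl⟩ := mem_closure_iff_exists_sub.1 hx
      have h1 : f (i ⟨p, hp⟩) = 0 := DFunLike.congr_fun hf ⟨p, hp⟩
      have h2 : f (i ⟨q, hq⟩) = 0 := DFunLike.congr_fun hf ⟨q, hq⟩
      have : (⟨p - q, hx⟩ : A) = i ⟨p, hp⟩ - i ⟨q, hq⟩ := rfl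
      rw [this, map_sub, h1, h2]
      simp
    · intro v
      obtain ⟨w, hw⟩ := exists_extend P v
      refine ⟨(w.comp A.subtype.toAddMonoidHom).toIntLinearMap, ?_⟩
      ext p
      exact hw p
  let e := e₁.trans (LinearEquiv.ofBijective r hr)
  refine ⟨LinearEquiv.finiteDimensional e, ?_⟩
  rw [← e.finrank_eq]
  simp [this]

/-- The morphisms `P → ℝ` which vanish on `F`. -/
def homVanishing {k : ℕ} (P F : AddSubmonoid (Fin k → ℤ)) : Submodule ℝ (P →+ ℝ) where
  carrier := {v | ∀ p : P, (p : Fin k → ℤ) ∈ F → v p = 0}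
  zero_mem' := fun _ _ => rfl
  add_mem' := fun hv hw p hp => by rw [AddMonoidHom.add_apply, hv p hp, hw p hp, add_zero]
  smul_mem' := fun c v hv p hp => by
    change c * v p = 0
    rw [hv p hp, mul_zero]

/-- Rank–nullity for the restriction from `P` to `F`, which is surjective because morphisms to `ℝ`
extend. It turns statements about ranks and depths into linear algebra. -/
theorem finrank_homVanishing {k : ℕ} {P F : AddSubmonoid (Fin k → ℤ)} (h : F ≤ P) :
    Module.finrank ℝ (homVanishing P F) + rank F = rank P := by
  obtain ⟨h1, h2⟩ := finrank_hom P
  let r : (P →+ ℝ) →ₗ[ℝ] (F →+ ℝ) :=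
    { toFun := fun f => f.comp (AddSubmonoid.inclusion h)
      map_add' := fun _ _ => rfl
      map_smul' := fun _ _ => rfl }
  have hr : LinearMap.range r = ⊤ := by
    rw [LinearMap.range_eq_top]
    intro v
    obtain ⟨w, hw⟩ := exists_extend F v
    refine ⟨w.comp P.subtype, ?_⟩
    ext p
    exact hw p
  have hk : LinearMap.ker r = homVanishing P F := by
    ext f
    rw [LinearMap.mem_ker]
    constructor
    · intro hf p hp
      exact DFunLike.congr_fun hf ⟨p, hp⟩
    · intro hf
      ext p
      exact hf _ p.2
  have := r.finrank_range_add_finrank_ker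
  rw [hr, hk, finrank_top, (finrank_hom F).2, h2] at this
  omega

/-- The supporting functional of a proper face is a nonzero element of `homVanishing P F`, whose
dimension is the difference of the ranks. -/
theorem IsFace.eq_of_rank_le {k : ℕ} {P F : AddSubmonoid (Fin k → ℤ)} (h : IsFace F P) (hP : P.FG)
    (hr : rank P ≤ rank F) : F = P := by
  refine le_antisymm h.le fun p hp => ?_
  obtain ⟨u, hu0, hu⟩ := h.exists_functional hP
  have hz : homVanishing P F = ⊥ := by
    have := (finrank_hom P).1
    rw [← Submodule.finrank_eq_zero (R := ℝ)]
    have := finrank_homVanishing h.le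
    omega
  let w : P →+ ℝ := ((Int.castAddHom ℝ).comp u).comp P.subtype
  have hw : w ∈ homVanishing P F := by
    intro q hq
    simp [w, (hu q q.2).2 hq]
  rw [hz, Submodule.mem_bot] at hw
  have := DFunLike.congr_fun hw ⟨p, hp⟩
  exact (hu p hp).1 (by simpa [w] using this)

theorem rank_mono {k : ℕ} {P F : AddSubmonoid (Fin k → ℤ)} (h : F ≤ P) : rank F ≤ rank P :=
  Nat.le.intro (by rw [add_comm]; exact finrank_homVanishing h)

/-! ### Functionals modulo an integer -/

/-- In Smith normal form `H` is spanned by multiples of some vectors of a basis of `B`. If `H` is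
proper, some basis vector either does not occur or occurs only with a nonunit factor; its coordinate
is `v`, and `l` is the absolute value of the factor, or `2` if the vector is missing or the factor
is zero. -/
theorem exists_hom_dvd_of_ne_top {B : Type*} [AddCommGroup B] [Module.Finite ℤ B]
    [Module.Free ℤ B] (H : Submodule ℤ B) (hH : H ≠ ⊤) :
    ∃ (l : ℕ) (v : B →+ ℤ), 2 ≤ l ∧ (∀ h ∈ H, (l : ℤ) ∣ v h) ∧ ∃ b, v b = 1 := by
  obtain ⟨n, S⟩ := Submodule.smithNormalForm (Module.Free.chooseBasis ℤ B) H
  have hdvd : ∀ (j : Module.Free.ChooseBasisIndex ℤ B) (l : ℤ),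
      (∀ i, S.f i = j → l ∣ S.a i) → ∀ h ∈ H, l ∣ S.bM.coord j h := by
    intro j l hl h hh
    have := S.bN.sum_repr ⟨h, hh⟩
    have h2 := congrArg (fun x : H => (x : B)) this
    simp only [AddSubmonoidClass.coe_finsetSum, Submodule.coe_smul, S.snf] at h2
    rw [← h2, map_sum]
    refine Finset.dvd_sum fun i _ => ?_
    rw [map_smul, map_smul, Module.Basis.coord_apply, Module.Basis.repr_self]
    by_cases hij : S.f i = j
    · simp only [smul_eq_mul]
      exact dvd_mul_of_dvd_right (dvd_mul_of_dvd_left (hl i hij) _) _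
    · simp [Finsupp.single_eq_of_ne (Ne.symm hij)]
  have hex : ∃ (j : Module.Free.ChooseBasisIndex ℤ B) (l : ℕ), 2 ≤ l ∧
      ∀ i, S.f i = j → (l : ℤ) ∣ S.a i := by
    by_contra hcon
    push Not at hcon
    apply hH
    rw [eq_top_iff, ← S.bM.span_eq, Submodule.span_le]
    rintro _ ⟨j, rfl⟩
    obtain ⟨i, hi, -⟩ := hcon j 2 le_rfl
    have hu : IsUnit (S.a i) := by
      by_contra hnu
      rw [Int.isUnit_iff_natAbs_eq] at hnu
      have h0 : (S.a i) ≠ 0 ∨ S.a i = 0 := by tauto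
      rcases h0 with h0 | h0
      · obtain ⟨i', hi', h'⟩ := hcon j (S.a i).natAbs (by omega)
        obtain rfl : i' = i := S.f.injective (hi'.trans hi.symm)
        exact h' (by simp)
      · obtain ⟨i', hi', h'⟩ := hcon j 2 le_rfl
        obtain rfl : i' = i := S.f.injective (hi'.trans hi.symm)
        exact h' (by simp [h0])
    have h1 : S.a i • S.bM j ∈ H := by
      rw [← hi, ← S.snf]; exact (S.bN i).2
    have h2 := H.smul_mem (S.a i) h1
    rwa [smul_smul, Int.isUnit_mul_self hu, one_smul] at h2
  obtain ⟨j, l, hl, hj⟩ := hex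
  exact ⟨l, (S.bM.coord j).toAddMonoidHom, hl, fun h hh => hdvd j l hj h hh, S.bM j, by simp⟩

/-- A subgroup containing the face `F` but not `P` is detected by a functional on `P` modulo some
`l ≥ 2`, vanishing on `F`. -/
theorem IsFace.exists_hom_dvd {k : ℕ} {P F : AddSubmonoid (Fin k → ℤ)} (h : IsFace F P)
    (hP : IsWeaklyToric P) (H : AddSubgroup (Fin k → ℤ)) (hF : ∀ f ∈ F, f ∈ H)
    (hH : ∃ p ∈ P, p ∉ H) :
    ∃ (l : ℕ) (v : P →+ ℤ), 2 ≤ l ∧ (∀ p : P, (p : Fin k → ℤ) ∈ F → v p = 0) ∧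
      (∀ p : P, (p : Fin k → ℤ) ∈ H → (l : ℤ) ∣ v p) ∧ ∃ p, ¬ (l : ℤ) ∣ v p := by
  let A := (AddSubgroup.closure (P : Set (Fin k → ℤ))).toIntSubmodule
  let N : Submodule ℤ A :=
    (AddSubgroup.closure (F : Set (Fin k → ℤ))).toIntSubmodule.comap A.subtype
  -- `Pᵍᵖ / Fᵍᵖ` is torsion-free because `P` is saturated and `F` is a face. Being free, it carries
  -- the functional to be found, which then vanishes on `F` automatically.
  have htf : Module.IsTorsionFree ℤ (A ⧸ N) := by
    rw [Module.isTorsionFree_int_iff_isAddTorsionFree]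
    refine ⟨fun n hn x y hxy => ?_⟩
    obtain ⟨⟨r, hr⟩, hz⟩ := N.mkQ_surjective (x - y)
    have h1 : N.mkQ (n • ⟨r, hr⟩) = 0 := by
      rw [map_nsmul, hz, nsmul_sub, sub_eq_zero]
      exact hxy
    rw [Submodule.mkQ_apply, Submodule.Quotient.mk_eq_zero] at h1
    have h2 : r ∈ AddSubgroup.closure (F : Set (Fin k → ℤ)) := by
      refine h.mem_closure_of_forall_eq_zero hP hr fun v hv => ?_
      have h3 : v (n • r) = 0 := by
        obtain ⟨f, hf, f', hf', e⟩ := mem_closure_iff_exists_sub.1 h1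
        have e' : n • r = f - f' := e
        rw [e', map_sub, hv f hf, hv f' hf', sub_zero]
      rw [map_nsmul, smul_eq_zero] at h3
      exact h3.resolve_left hn
    rw [← sub_eq_zero, ← hz, Submodule.mkQ_apply, Submodule.Quotient.mk_eq_zero]
    exact h2
  have : Module.Free ℤ (A ⧸ N) := Module.free_of_finite_type_torsion_free'
  let H' : Submodule ℤ (A ⧸ N) := (H.toIntSubmodule.comap A.subtype).map N.mkQ
  have hNH : N ≤ H.toIntSubmodule.comap A.subtype := by
    intro x hx
    have : AddSubgroup.closure (F : Set (Fin k → ℤ)) ≤ H := (AddSubgroup.closure_le _).2 hF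
    exact this hx
  have hH' : H' ≠ ⊤ := by
    obtain ⟨p, hp, hpH⟩ := hH
    intro htop
    have h1 : N.mkQ ⟨p, AddSubgroup.subset_closure hp⟩ ∈ H' := htop ▸ Submodule.mem_top
    obtain ⟨q, hq, e⟩ := h1
    rw [← sub_eq_zero, ← map_sub, Submodule.mkQ_apply, Submodule.Quotient.mk_eq_zero] at e
    have h2 := (H.toIntSubmodule.comap A.subtype).sub_mem hq (hNH e)
    rw [sub_sub_cancel] at h2
    exact hpH h2
  obtain ⟨l, v, hl, hv, b, hb⟩ := exists_hom_dvd_of_ne_top H' hH'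
  let i : P →+ A := toSpan P
  let w : P →+ ℤ := (v.comp N.mkQ.toAddMonoidHom).comp i
  refine ⟨l, w, hl, fun p hp => ?_, fun p hp => ?_, ?_⟩
  · have : N.mkQ (i p) = 0 := by
      rw [Submodule.mkQ_apply, Submodule.Quotient.mk_eq_zero]
      exact AddSubgroup.subset_closure hp
    change v (N.mkQ (i p)) = 0
    rw [this, map_zero]
  · exact hv _ ⟨i p, hp, rfl⟩
  -- If `l` divided all values on `P`, it would divide all values on the differences, that is on
  -- `Pᵍᵖ`, where the value `1` is taken.
  · by_contra hcon
    push Not at hcon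
    obtain ⟨⟨x, hx⟩, rfl⟩ := N.mkQ_surjective b
    obtain ⟨p, hp, q, hq, rfl⟩ := mem_closure_iff_exists_sub.1 hx
    have e : (⟨p - q, hx⟩ : A) = i ⟨p, hp⟩ - i ⟨q, hq⟩ := rfl
    have := dvd_sub (hcon ⟨p, hp⟩) (hcon ⟨q, hq⟩)
    change (l : ℤ) ∣ v (N.mkQ (i ⟨p, hp⟩)) - v (N.mkQ (i ⟨q, hq⟩)) at this
    rw [← map_sub, ← map_sub, ← e, hb] at this
    have := Int.le_of_dvd one_pos this
    omega

/-! ### Points of the model spaces -/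

namespace Model

variable {k : ℕ} {P F : AddSubmonoid (Fin k → ℤ)}

theorem apply_zero (x : Model P) : x.1 0 = 1 := x.2.1

theorem apply_add (x : Model P) (p q : P) : x.1 (p + q) = x.1 p * x.1 q := x.2.2 p q

theorem mem_supp {x : Model P} {p : Fin k → ℤ} (hp : p ∈ P) : p ∈ x.supp ↔ x.1 ⟨p, hp⟩ ≠ 0 :=
  ⟨fun ⟨_, h⟩ => h, fun h => ⟨hp, h⟩⟩

theorem pos_iff_mem_supp {x : Model P} {p : P} : 0 < x.1 p ↔ (p : Fin k → ℤ) ∈ x.supp := by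
  rw [mem_supp p.2, pos_iff_ne_zero]

theorem eq_zero_iff_notMem_supp {x : Model P} {p : P} :
    x.1 p = 0 ↔ (p : Fin k → ℤ) ∉ x.supp := by
  rw [mem_supp p.2, not_not]

theorem isFace_supp (x : Model P) : IsFace x.supp P where
  le := fun _ ⟨h, _⟩ => h
  mem_of_add_mem := by
    rintro p hp q hq ⟨h, h'⟩
    have e : x.1 ⟨p + q, h⟩ = x.1 ⟨p, hp⟩ * x.1 ⟨q, hq⟩ := x.apply_add ⟨p, hp⟩ ⟨q, hq⟩
    rw [e] at h'
    exact ⟨⟨hp, left_ne_zero_of_mul h'⟩, ⟨hq, right_ne_zero_of_mul h'⟩⟩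

theorem coe_nsmul (x : Model P) (n : ℕ) (p : P) : x.1 (n • p) = x.1 p ^ n := by
  induction n with
  | zero => rw [zero_nsmul, pow_zero, apply_zero]
  | succ n ih => rw [succ_nsmul, apply_add, ih, pow_succ]

open Classical in
/-- The point of the stratum `{supp = F}` with logarithmic coordinates `ℓ`. -/
noncomputable def point (hF : IsFace F P) (ℓ : (Fin k → ℤ) →+ ℝ) : Model P :=
  ⟨fun p => if (p : Fin k → ℤ) ∈ F then (Real.exp (ℓ p)).toNNReal else 0, by
    beta_reduce
    rw [if_pos (show ((0 : P) : Fin k → ℤ) ∈ F from F.zero_mem)]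
    simp, by
    intro p q
    beta_reduce
    by_cases h : ((p + q : P) : Fin k → ℤ) ∈ F
    · obtain ⟨hp, hq⟩ := hF.mem_of_add_mem p p.2 q q.2 h
      rw [if_pos h, if_pos hp, if_pos hq, ← Real.toNNReal_mul (Real.exp_pos _).le, ← Real.exp_add,
        ← map_add]
      rfl
    · rw [if_neg h]
      by_cases hp : (p : Fin k → ℤ) ∈ F
      · have hq : (q : Fin k → ℤ) ∉ F := fun hq => h (F.add_mem hp hq)
        rw [if_neg hq, mul_zero]
      · rw [if_neg hp, zero_mul]⟩

theorem point_apply (hF : IsFace F P) (ℓ : (Fin k → ℤ) →+ ℝ) {p : P}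
    (hp : (p : Fin k → ℤ) ∈ F) : ((point hF ℓ).1 p : ℝ) = Real.exp (ℓ p) := by
  classical
  change ((if (p : Fin k → ℤ) ∈ F then (Real.exp (ℓ p)).toNNReal else 0 : ℝ≥0) : ℝ) = _
  rw [if_pos hp, Real.coe_toNNReal _ (Real.exp_pos _).le]

theorem point_apply_of_notMem (hF : IsFace F P) (ℓ : (Fin k → ℤ) →+ ℝ) {p : P}
    (hp : (p : Fin k → ℤ) ∉ F) : (point hF ℓ).1 p = 0 :=
  if_neg hp

theorem supp_point (hF : IsFace F P) (ℓ : (Fin k → ℤ) →+ ℝ) : (point hF ℓ).supp = F := by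
  ext p
  constructor
  · rintro ⟨hp, h⟩
    by_contra hpF
    exact h (point_apply_of_notMem hF ℓ hpF)
  · intro h
    refine ⟨hF.le h, fun h0 => ?_⟩
    have := point_apply hF ℓ (p := ⟨p, hF.le h⟩) h
    rw [h0] at this
    exact (Real.exp_pos _).ne this

theorem ext_of_supp {x y : Model P} (h : x.supp = F)
    (h' : y.supp = F) (H : ∀ p : P, (p : Fin k → ℤ) ∈ F → (x.1 p : ℝ) = y.1 p) : x = y := by
  refine Subtype.ext (funext fun p => ?_)
  by_cases hp : (p : Fin k → ℤ) ∈ F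
  · exact NNReal.coe_injective (H p hp)
  · rw [eq_zero_iff_notMem_supp.2 (h ▸ hp), eq_zero_iff_notMem_supp.2 (h' ▸ hp)]

/-- Logarithmic coordinates of a point. -/
theorem exists_log (x : Model P) : ∃ ℓ : (Fin k → ℤ) →+ ℝ, ∀ p : P, (p : Fin k → ℤ) ∈ x.supp →
    (x.1 p : ℝ) = Real.exp (ℓ p) := by
  have hF := x.isFace_supp
  let v : x.supp →+ ℝ :=
    { toFun := fun p => Real.log (x.1 ⟨p, hF.le p.2⟩)
      map_zero' := by
        have : x.1 ⟨((0 : x.supp) : Fin k → ℤ), hF.le (0 : x.supp).2⟩ = 1 := x.apply_zero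
        rw [this]; simp
      map_add' := by
        rintro ⟨p, hp⟩ ⟨q, hq⟩
        have : x.1 ⟨p + q, hF.le (x.supp.add_mem hp hq)⟩ = _ :=
          x.apply_add ⟨p, hF.le hp⟩ ⟨q, hF.le hq⟩
        change Real.log (x.1 ⟨p + q, _⟩) = _
        rw [this, NNReal.coe_mul, Real.log_mul]
        · exact NNReal.coe_ne_zero.2 ((mem_supp _).1 hp)
        · exact NNReal.coe_ne_zero.2 ((mem_supp _).1 hq) }
  obtain ⟨ℓ, hℓ⟩ := exists_extend x.supp v
  refine ⟨ℓ, fun p hp => ?_⟩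
  rw [hℓ ⟨p, hp⟩]
  exact (Real.exp_log (NNReal.coe_pos.2 (pos_iff_mem_supp.2 hp))).symm

theorem eq_point (hF : IsFace F P) {x : Model P} (h : x.supp = F) {ℓ : (Fin k → ℤ) →+ ℝ}
    (hℓ : ∀ p : P, (p : Fin k → ℤ) ∈ F → (x.1 p : ℝ) = Real.exp (ℓ p)) : x = point hF ℓ :=
  ext_of_supp h (supp_point hF ℓ) fun p hp => by rw [hℓ p hp, point_apply hF ℓ hp]

theorem shift_apply (x : Model P) (v : x.supp →+ ℝ) (t : ℝ) {p : P}
    (hp : (p : Fin k → ℤ) ∈ x.supp) :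
    ((x.shift v t).1 p : ℝ) = x.1 p * Real.exp (t * v ⟨p, hp⟩) := by
  unfold shift
  simp only [dif_pos hp, NNReal.coe_mul, Real.coe_toNNReal _ (Real.exp_pos _).le]

theorem shift_apply_of_notMem (x : Model P) (v : x.supp →+ ℝ) (t : ℝ) {p : P}
    (hp : (p : Fin k → ℤ) ∉ x.supp) : (x.shift v t).1 p = 0 := by
  unfold shift
  simp only [dif_neg hp]

theorem supp_shift (x : Model P) (v : x.supp →+ ℝ) (t : ℝ) : (x.shift v t).supp = x.supp := by
  ext p
  constructor
  · rintro ⟨hp, h⟩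
    by_contra hpF
    exact h (shift_apply_of_notMem x v t (p := ⟨p, hp⟩) hpF)
  · intro h
    refine ⟨x.isFace_supp.le h, fun h0 => ?_⟩
    have := shift_apply x v t (p := ⟨p, x.isFace_supp.le h⟩) h
    rw [h0] at this
    have h1 : (0 : ℝ) < x.1 ⟨p, x.isFace_supp.le h⟩ := NNReal.coe_pos.2 (pos_iff_mem_supp.2 h)
    exact (mul_pos h1 (Real.exp_pos _)).ne this

theorem shift_zero (x : Model P) (v : x.supp →+ ℝ) : x.shift v 0 = x :=
  ext_of_supp (supp_shift x v 0) rfl fun p hp => by rw [shift_apply x v 0 hp]; simp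

theorem tendsto_iff {ι : Type*} {l : Filter ι} {c : ι → Model P} {x : Model P} :
    Filter.Tendsto c l (𝓝 x) ↔ ∀ p, Filter.Tendsto (fun i => ((c i).1 p : ℝ)) l (𝓝 (x.1 p)) := by
  rw [tendsto_subtype_rng, tendsto_pi_nhds]
  exact forall_congr' fun p => NNReal.tendsto_coe.symm

theorem continuous_eval (p : P) : Continuous fun x : Model P => x.1 p :=
  (continuous_apply p).comp continuous_subtype_val

theorem continuous_shift (x : Model P) (v : x.supp →+ ℝ) : Continuous (x.shift v) := by
  rw [continuous_iff_continuousAt]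
  intro t
  refine tendsto_iff.2 fun p => ?_
  by_cases hp : (p : Fin k → ℤ) ∈ x.supp
  · simp only [shift_apply x v _ hp]
    exact (Continuous.tendsto (by fun_prop) t)
  · simp only [shift_apply_of_notMem x v _ hp]
    exact tendsto_const_nhds

theorem tendsto_shift (x : Model P) (v : x.supp →+ ℝ) :
    Filter.Tendsto (x.shift v) (𝓝 0) (𝓝 x) := by
  have := (continuous_shift x v).tendsto 0
  rwa [shift_zero] at this

/-- Points of larger support converging to `x`. -/
theorem tendsto_point {x : Model P} (hF : IsFace F P) (hxF : x.supp ≤ F) {ℓ v : (Fin k → ℤ) →+ ℝ}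
    (hℓ : ∀ p : P, (p : Fin k → ℤ) ∈ x.supp → (x.1 p : ℝ) = Real.exp (ℓ p))
    (hv0 : ∀ p ∈ x.supp, v p = 0) (hv : ∀ p ∈ F, p ∉ x.supp → 0 < v p) :
    Filter.Tendsto (fun t : ℝ => point hF (ℓ - t • v)) Filter.atTop (𝓝 x) := by
  refine tendsto_iff.2 fun p => ?_
  by_cases hpF : (p : Fin k → ℤ) ∈ F
  · simp only [point_apply hF _ hpF]
    have e : ∀ t : ℝ, (ℓ - t • v) (p : Fin k → ℤ) = ℓ p - t * v p := fun t => rfl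
    simp only [e]
    by_cases hp : (p : Fin k → ℤ) ∈ x.supp
    · rw [hv0 p hp, hℓ p hp]
      simp
    · rw [eq_zero_iff_notMem_supp.2 hp]
      refine Real.tendsto_exp_atBot.comp ?_
      exact Filter.tendsto_atBot_add_const_left _ _
        (Filter.tendsto_neg_atTop_atBot.comp (Filter.tendsto_id.atTop_mul_const (hv p hpF hp)))
  · have hp : (p : Fin k → ℤ) ∉ x.supp := fun h => hpF (hxF h)
    rw [eq_zero_iff_notMem_supp.2 hp]
    simp only [point_apply_of_notMem hF _ hpF]
    exact tendsto_const_nhds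

theorem continuous_point {X : Type*} [TopologicalSpace X] (hF : IsFace F P)
    {ℓ : X → (Fin k → ℤ) →+ ℝ} (hℓ : ∀ p, Continuous fun t => ℓ t p) :
    Continuous fun t => point hF (ℓ t) := by
  rw [continuous_iff_continuousAt]
  intro t
  refine tendsto_iff.2 fun p => ?_
  by_cases hp : (p : Fin k → ℤ) ∈ F
  · simp only [point_apply hF _ hp]
    exact (Real.continuous_exp.comp (hℓ p)).tendsto t
  · simp only [point_apply_of_notMem hF _ hp]
    exact tendsto_const_nhds

/-- Every point has arbitrarily small neighbourhoods which meet every stratum in a connected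
set. -/
theorem exists_nhds_isPreconnected (x : Model P) {O : Set (Model P)} (hO : O ∈ 𝓝 x) :
    ∃ V, IsOpen V ∧ x ∈ V ∧ V ⊆ O ∧
      ∀ F : AddSubmonoid (Fin k → ℤ), IsPreconnected (V ∩ {y | y.supp = F}) := by
  rw [nhds_subtype_eq_comap, Filter.mem_comap] at hO
  obtain ⟨O', hO', hsub⟩ := hO
  rw [nhds_pi, Filter.mem_pi] at hO'
  obtain ⟨I, hI, J, hJ, hIJ⟩ := hO'
  have hJ' : ∀ p, ∃ K : Set ℝ≥0, K ⊆ J p ∧ IsOpen K ∧ x.1 p ∈ K ∧ K.OrdConnected := by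
    intro p
    obtain ⟨s, hs, hsJ⟩ := ((LocallyConvexSpace.convex_basis (𝕜 := ℝ) ((x.1 p : ℝ))).mem_iff).1
      (Filter.mem_of_superset
        (continuous_real_toNNReal.continuousAt.preimage_mem_nhds
          (by rw [Real.toNNReal_coe]; exact hJ p)) (Set.Subset.refl _))
    refine ⟨(fun r : ℝ≥0 => (r : ℝ)) ⁻¹' interior s, fun r hr => ?_,
      isOpen_interior.preimage NNReal.continuous_coe, mem_interior_iff_mem_nhds.2 hs.1, ?_⟩
    · simpa using hsJ (interior_subset hr)
    · exact hs.2.interior.ordConnected.preimage_mono (fun _ _ h => h)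
  choose K hKJ hKo hxK hKc using hJ'
  refine ⟨{y | ∀ p ∈ I, y.1 p ∈ K p}, ?_, fun p _ => hxK p,
    fun y hy => hsub (hIJ fun p hp => hKJ p (hy p hp)), fun F => ?_⟩
  · have : {y : Model P | ∀ p ∈ I, y.1 p ∈ K p} = ⋂ p ∈ I, (fun y : Model P => y.1 p) ⁻¹' K p := by
      ext; simp
    rw [this]
    exact hI.isOpen_biInter fun p _ => (hKo p).preimage (continuous_eval p)
  refine isPreconnected_of_forall_pair ?_
  rintro y ⟨hyV, hyF⟩ z ⟨hzV, hzF⟩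
  have hF : IsFace F P := hyF ▸ y.isFace_supp
  obtain ⟨ℓ, hℓ⟩ := y.exists_log
  obtain ⟨m, hm⟩ := z.exists_log
  rw [hyF] at hℓ
  rw [hzF] at hm
  -- Interpolation is linear in the logarithms, so each coordinate moves monotonically between its
  -- values at `y` and `z` and stays in the order-connected set `K p`.
  let c : ℝ → Model P := fun t => point hF (ℓ + t • (m - ℓ))
  have hc : Continuous c := continuous_point hF fun p => by
    change Continuous fun t : ℝ => ℓ p + t * ((m - ℓ) p)
    fun_prop
  refine ⟨c '' Set.Icc 0 1, ?_, ⟨0, by simp, ?_⟩, ⟨1, by simp, ?_⟩,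
    isPreconnected_Icc.image c hc.continuousOn⟩
  · rintro _ ⟨t, ht, rfl⟩
    refine ⟨fun p hp => ?_, supp_point hF _⟩
    by_cases hpF : (p : Fin k → ℤ) ∈ F
    · have e : ((c t).1 p : ℝ) = Real.exp (ℓ p + t * (m p - ℓ p)) := point_apply hF _ hpF
      have hy := hℓ p hpF
      have hz := hm p hpF
      rcases le_total (ℓ p) (m p) with h | h
      · refine (hKc p).out (hyV p hp) (hzV p hp) ⟨?_, ?_⟩ <;> rw [← NNReal.coe_le_coe, e]
        · rw [hy, Real.exp_le_exp]; nlinarith [ht.1]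
        · rw [hz, Real.exp_le_exp]; nlinarith [ht.2]
      · refine (hKc p).out (hzV p hp) (hyV p hp) ⟨?_, ?_⟩ <;> rw [← NNReal.coe_le_coe, e]
        · rw [hz, Real.exp_le_exp]; nlinarith [ht.2]
        · rw [hy, Real.exp_le_exp]; nlinarith [ht.1]
    · have e : (c t).1 p = 0 := point_apply_of_notMem hF _ hpF
      have e' : y.1 p = 0 := eq_zero_iff_notMem_supp.2 (hyF ▸ hpF)
      rw [e, ← e']
      exact hyV p hp
  · simp only [c, zero_smul, add_zero]
    exact (eq_point hF hyF hℓ).symm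
  · simp only [c, one_smul, add_sub_cancel]
    exact (eq_point hF hzF hm).symm

end Model

/-! ### Germs of smooth functions in a chart -/

theorem exists_generators {k : ℕ} {P : AddSubmonoid (Fin k → ℤ)} (h : P.FG) :
    ∃ (N : ℕ) (e : Fin N → P), ∀ p : P, ∃ m : Fin N → ℕ, p = ∑ i, m i • e i := by
  obtain ⟨l, hl⟩ := exists_list_closure_eq h
  have hlP : ∀ i : Fin l.length, l.get i ∈ P := fun i =>
    hl ▸ AddSubmonoid.subset_closure (List.get_mem l i)
  refine ⟨l.length, fun i => ⟨l.get i, hlP i⟩, ?_⟩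
  rintro ⟨p, hp⟩
  have key : ∀ p ∈ AddSubmonoid.closure {x | x ∈ l}, ∃ m : Fin l.length → ℕ,
      p = ∑ i, m i • l.get i := by
    intro p hp
    induction hp using AddSubmonoid.closure_induction with
    | mem x hx =>
      obtain ⟨i, rfl⟩ := List.get_of_mem hx
      refine ⟨Pi.single i 1, ?_⟩
      rw [Finset.sum_eq_single i]
      · simp
      · intro j _ hj; simp [Pi.single_eq_of_ne hj]
      · simp
    | zero => exact ⟨0, by simp⟩
    | add x y _ _ hx hy =>
      obtain ⟨m, rfl⟩ := hx
      obtain ⟨m', rfl⟩ := hy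
      exact ⟨m + m', by rw [← Finset.sum_add_distrib]; simp [add_mul]⟩
  obtain ⟨m, hm⟩ := key p (hl ▸ hp)
  refine ⟨m, Subtype.ext ?_⟩
  rw [AddSubmonoid.coe_finsetSum]
  exact hm

theorem Model.apply_sum {k : ℕ} {P : AddSubmonoid (Fin k → ℤ)} (x : Model P) {N : ℕ}
    (e : Fin N → P) (m : Fin N → ℕ) : x.1 (∑ i, m i • e i) = ∏ i, x.1 (e i) ^ m i := by
  have : ∀ s : Finset (Fin N), x.1 (∑ i ∈ s, m i • e i) = ∏ i ∈ s, x.1 (e i) ^ m i := by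
    intro s
    induction s using Finset.cons_induction with
    | empty => exact x.apply_zero
    | cons i s hi ih => rw [Finset.sum_cons, Finset.prod_cons, x.apply_add, ih, x.coe_nsmul]
  exact this _

namespace GChart

variable {X : Type u} {Y : Type v}

/-- The coordinate function `λ_p` of a chart, with real values. -/
def lam (a : GChart X) (p : a.P) (z : X) : ℝ := (a.coord z).1 p

theorem lam_nonneg (a : GChart X) (p : a.P) (z : X) : 0 ≤ a.lam p z := NNReal.coe_nonneg _

theorem lam_add (a : GChart X) (p q : a.P) (z : X) :
    a.lam (p + q) z = a.lam p z * a.lam q z := by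
  unfold lam
  rw [Model.apply_add, NNReal.coe_mul]

theorem lam_zero (a : GChart X) (z : X) : a.lam 0 z = 1 := by
  unfold lam
  rw [Model.apply_zero, NNReal.coe_one]

theorem lam_nsmul (a : GChart X) (n : ℕ) (p : a.P) (z : X) : a.lam (n • p) z = a.lam p z ^ n := by
  unfold lam
  rw [Model.coe_nsmul, NNReal.coe_pow]

theorem lam_pos_iff {a : GChart X} {p : a.P} {z : X} :
    0 < a.lam p z ↔ (p : Fin a.k → ℤ) ∈ (a.coord z).supp := by
  unfold lam
  rw [NNReal.coe_pos, Model.pos_iff_mem_supp]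

theorem lam_eq_zero_iff {a : GChart X} {p : a.P} {z : X} :
    a.lam p z = 0 ↔ (p : Fin a.k → ℤ) ∉ (a.coord z).supp := by
  unfold lam
  rw [NNReal.coe_eq_zero, Model.eq_zero_iff_notMem_supp]

variable [TopologicalSpace X] [TopologicalSpace Y]

/-- `h` is, near `x`, a smooth function of finitely many coordinate functions. -/
def RealAt (a : GChart X) (x : X) (h : X → ℝ) : Prop :=
  ∃ (n : ℕ) (r : Fin n → a.P) (O : Set (Fin n → ℝ)) (g : (Fin n → ℝ) → ℝ),
    IsOpen O ∧ ContDiffOn ℝ ∞ g O ∧ (fun i => a.lam (r i) x) ∈ O ∧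
      ∀ᶠ z in 𝓝 x, h z = g fun i => a.lam (r i) z

/-- `f` is, near `x`, of the form `λ_p · h` with `h` smooth and positive, or zero. -/
def NonnegAt (a : GChart X) (x : X) (f : X → ℝ≥0) : Prop :=
  (∃ (p : a.P) (h : X → ℝ), a.RealAt x h ∧ 0 < h x ∧ ∀ᶠ z in 𝓝 x, (f z : ℝ) = a.lam p z * h z) ∨
    ∀ᶠ z in 𝓝 x, f z = 0

theorem RealAt.congr {a : GChart X} {x : X} {h h' : X → ℝ} (hh : a.RealAt x h)
    (e : ∀ᶠ z in 𝓝 x, h' z = h z) : a.RealAt x h' := by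
  obtain ⟨n, r, O, g, hO, hg, hx, H⟩ := hh
  exact ⟨n, r, O, g, hO, hg, hx, by filter_upwards [e, H] with z h1 h2; rw [h1, h2]⟩

namespace IsChart

variable {a : GChart X} (ha : a.IsChart) {x : X} (hx : x ∈ a.dom)
include ha

theorem dom_mem_nhds (hx : x ∈ a.dom) : a.dom ∈ 𝓝 x := ha.isOpen_dom.mem_nhds hx

theorem continuousAt_coord (hx : x ∈ a.dom) : ContinuousAt a.coord x :=
  ha.continuousOn.continuousAt (ha.dom_mem_nhds hx)

theorem continuousAt_lam (hx : x ∈ a.dom) (p : a.P) : ContinuousAt (a.lam p) x :=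
  (NNReal.continuous_coe.comp (Model.continuous_eval p)).continuousAt.comp
    (ha.continuousAt_coord hx)

theorem image_mem_nhds (hx : x ∈ a.dom) {V : Set X} (hV : V ∈ 𝓝 x) :
    a.coord '' V ∈ 𝓝 (a.coord x) := by
  obtain ⟨O, hO, hOo, hxO⟩ := mem_nhds_iff.1 (Filter.inter_mem hV (ha.dom_mem_nhds hx))
  exact Filter.mem_of_superset
    ((ha.isOpen_image O hOo fun z hz => (hO hz).2).mem_nhds ⟨x, hxO, rfl⟩)
    (Set.image_mono fun z hz => (hO hz).1)

/-- Replaces functions on subsets of the model space by germs at points of `X`. In the converse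
direction the neighbourhood is shrunk until `g` is positive on it, since positivity at `x` alone is
part of `NonnegAt`. -/
theorem smoothNonnegOn_iff {D : Set X} (hD : IsOpen D) (hDa : D ⊆ a.dom) {f : X → ℝ≥0} :
    a.SmoothNonnegOn D f ↔ ∀ x ∈ D, a.NonnegAt x f := by
  constructor
  · rintro ⟨G, hG, H⟩ x hx
    obtain ⟨V, hV, hxV, hVG⟩ := hG (a.coord x) ⟨x, hx, rfl⟩
    have hev : ∀ᶠ z in 𝓝 x, z ∈ D ∧ a.coord z ∈ V :=
      (Filter.eventually_mem_set.2 (hD.mem_nhds hx)).and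
        ((ha.continuousAt_coord (hDa hx)).eventually (hV.mem_nhds hxV))
    rcases hVG with ⟨p, h, ⟨n, r, O, g, hO, hg, hhg⟩, hVG⟩ | hVG
    · refine Or.inl ⟨p, h ∘ a.coord, ⟨n, r, O, g, hO, hg, (hhg _ ⟨⟨x, hx, rfl⟩, hxV⟩).1, ?_⟩,
        (hVG _ ⟨⟨x, hx, rfl⟩, hxV⟩).1, ?_⟩
      · filter_upwards [hev] with z hz
        exact (hhg _ ⟨⟨z, hz.1, rfl⟩, hz.2⟩).2
      · filter_upwards [hev] with z hz
        rw [H z hz.1, (hVG _ ⟨⟨z, hz.1, rfl⟩, hz.2⟩).2]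
        rfl
    · right
      filter_upwards [hev] with z hz
      rw [H z hz.1, hVG _ ⟨⟨z, hz.1, rfl⟩, hz.2⟩]
  · intro H
    by_cases hne : Nonempty X
    swap
    · exact ⟨fun _ => 0, fun x hx => by obtain ⟨z, -⟩ := hx; exact (hne ⟨z⟩).elim,
        fun x => (hne ⟨x⟩).elim⟩
    have hinv : ∀ z ∈ a.dom, Function.invFunOn a.coord a.dom (a.coord z) = z := fun z hz =>
      ha.injOn.leftInvOn_invFunOn hz
    refine ⟨fun y => f (Function.invFunOn a.coord a.dom y), ?_, fun z hz => by
      beta_reduce; rw [hinv z (hDa hz)]⟩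
    rintro _ ⟨x, hx, rfl⟩
    rcases H x hx with ⟨p, h, ⟨n, r, O, g, hO, hg, hxO, hhg⟩, h0, H⟩ | H
    · have hev : ∀ᶠ z in 𝓝 x, z ∈ D ∧ (f z : ℝ) = a.lam p z * h z ∧
          h z = (g fun i => a.lam (r i) z) ∧ (fun i => a.lam (r i) z) ∈ O ∧
          0 < g (fun i => a.lam (r i) z) := by
        have hc : ContinuousAt (fun z => fun i => a.lam (r i) z) x :=
          continuousAt_pi.2 fun i => ha.continuousAt_lam (hDa hx) (r i)
        have hgc : ContinuousAt (fun z => g fun i => a.lam (r i) z) x :=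
          ContinuousAt.comp (f := fun z => fun i => a.lam (r i) z)
            (hg.continuousOn.continuousAt (hO.mem_nhds hxO)) hc
        refine (Filter.eventually_mem_set.2 (hD.mem_nhds hx)).and
          (H.and (hhg.and ((hc.eventually (hO.mem_nhds hxO)).and ?_)))
        exact hgc.eventually (lt_mem_nhds (by beta_reduce; rw [← hhg.self_of_nhds]; exact h0))
      obtain ⟨V, hV, hVo, hxV⟩ := eventually_nhds_iff.1 hev
      refine ⟨a.coord '' V, ha.isOpen_image V hVo fun z hz => hDa (hV z hz).1, ⟨x, hxV, rfl⟩,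
        Or.inl ⟨p, fun y => g fun i => (y.1 (r i) : ℝ), ⟨n, r, O, g, hO, hg, ?_⟩, ?_⟩⟩
      · rintro _ ⟨-, z, hz, rfl⟩
        exact ⟨(hV z hz).2.2.2.1, rfl⟩
      · rintro _ ⟨-, z, hz, rfl⟩
        refine ⟨(hV z hz).2.2.2.2, ?_⟩
        beta_reduce
        rw [hinv z (hDa (hV z hz).1), (hV z hz).2.1, (hV z hz).2.2.1]
        rfl
    · obtain ⟨V, hV, hVo, hxV⟩ := eventually_nhds_iff.1 (H.and (hD.mem_nhds hx))
      refine ⟨a.coord '' V, ha.isOpen_image V hVo fun z hz => hDa (hV z hz).2, ⟨x, hxV, rfl⟩,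
        Or.inr ?_⟩
      rintro _ ⟨-, z, hz, rfl⟩
      beta_reduce
      rw [hinv z (hDa (hV z hz).2), (hV z hz).1]

end IsChart

section Calculus

variable {a : GChart X} {x : X}

/-- Every `λ_r` is a monomial in the `λ_e`, so all smooth germs can be written in one fixed system
of coordinates with values in `ℝᴺ`. Several germs can then be combined, and they can be
differentiated as functions on `ℝᴺ`. -/
theorem RealAt.exists_eq_generators {h : X → ℝ} (hh : a.RealAt x h) {N : ℕ} {e : Fin N → a.P}
    (he : ∀ p : a.P, ∃ m : Fin N → ℕ, p = ∑ i, m i • e i) :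
    ∃ (O : Set (Fin N → ℝ)) (g : (Fin N → ℝ) → ℝ), IsOpen O ∧ ContDiffOn ℝ ∞ g O ∧
      (fun i => a.lam (e i) x) ∈ O ∧ ∀ᶠ z in 𝓝 x, h z = g fun i => a.lam (e i) z := by
  obtain ⟨n, r, O, g, hO, hg, hx, H⟩ := hh
  choose m hm using fun j => he (r j)
  let T : (Fin N → ℝ) → (Fin n → ℝ) := fun y j => ∏ i, y i ^ m j i
  have hT : ContDiff ℝ ∞ T := contDiff_pi.2 fun j =>
    contDiff_prod fun i _ => (contDiff_apply ℝ ℝ i).pow _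
  have hTe : ∀ z, T (fun i => a.lam (e i) z) = fun j => a.lam (r j) z := by
    intro z
    funext j
    unfold lam
    simp only [T]
    conv_rhs => rw [hm j, Model.apply_sum]
    push_cast
    rfl
  refine ⟨T ⁻¹' O, g ∘ T, hO.preimage hT.continuous, hg.comp hT.contDiffOn fun _ h => h, ?_, ?_⟩
  · rw [Set.mem_preimage, hTe]; exact hx
  · filter_upwards [H] with z hz
    rw [hz, Function.comp_apply, hTe]

theorem realAt_lam (a : GChart X) (x : X) (p : a.P) : a.RealAt x (a.lam p) :=
  ⟨1, fun _ => p, Set.univ, fun y => y 0, isOpen_univ, (contDiff_apply ℝ ℝ 0).contDiffOn,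
    trivial, Filter.Eventually.of_forall fun _ => rfl⟩

theorem realAt_const (a : GChart X) (x : X) (c : ℝ) : a.RealAt x fun _ => c :=
  ⟨0, Fin.elim0, Set.univ, fun _ => c, isOpen_univ, contDiffOn_const, trivial,
    Filter.Eventually.of_forall fun _ => rfl⟩

theorem RealAt.continuousAt {h : X → ℝ} (hh : a.RealAt x h) (ha : a.IsChart) (hx : x ∈ a.dom) :
    ContinuousAt h x := by
  obtain ⟨n, r, O, g, hO, hg, hxO, H⟩ := hh
  have hc : ContinuousAt (fun z => fun i => a.lam (r i) z) x :=
    continuousAt_pi.2 fun i => ha.continuousAt_lam hx (r i)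
  have hgc : ContinuousAt (fun z => g fun i => a.lam (r i) z) x :=
    ContinuousAt.comp (f := fun z => fun i => a.lam (r i) z)
      (hg.continuousOn.continuousAt (hO.mem_nhds hxO)) hc
  exact hgc.congr (H.mono fun z hz => hz.symm)

theorem RealAt.comp (ha : a.IsChart) {m : ℕ} {h : Fin m → X → ℝ}
    (hh : ∀ j, a.RealAt x (h j)) {O : Set (Fin m → ℝ)} (hO : IsOpen O) {Ψ : (Fin m → ℝ) → ℝ}
    (hΨ : ContDiffOn ℝ ∞ Ψ O) (hxO : (fun j => h j x) ∈ O) :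
    a.RealAt x fun z => Ψ fun j => h j z := by
  obtain ⟨N, e, he⟩ := exists_generators ha.weaklyToric.fg
  choose O' g hO' hg hxO' H using fun j => (hh j).exists_eq_generators he
  let T : (Fin N → ℝ) → (Fin m → ℝ) := fun y j => g j y
  have hU : IsOpen (⋂ j, O' j) := isOpen_iInter_of_finite hO'
  have hT : ContDiffOn ℝ ∞ T (⋂ j, O' j) :=
    contDiffOn_pi.2 fun j => (hg j).mono (Set.iInter_subset _ j)
  refine ⟨N, e, (⋂ j, O' j) ∩ T ⁻¹' O, Ψ ∘ T, hT.continuousOn.isOpen_inter_preimage hU hO,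
    hΨ.comp (hT.mono Set.inter_subset_left) fun y hy => hy.2,
    ⟨Set.mem_iInter.2 hxO', ?_⟩, ?_⟩
  · have : T (fun i => a.lam (e i) x) = fun j => h j x := by
      funext j
      exact (H j).self_of_nhds.symm
    rw [Set.mem_preimage, this]
    exact hxO
  · filter_upwards [Filter.eventually_all.2 H] with z hz
    simp only [hz]
    rfl

theorem RealAt.comp_one (ha : a.IsChart) {h : X → ℝ} (hh : a.RealAt x h)
    {O : Set ℝ} (hO : IsOpen O) {Ψ : ℝ → ℝ} (hΨ : ContDiffOn ℝ ∞ Ψ O) (hxO : h x ∈ O) :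
    a.RealAt x fun z => Ψ (h z) := by
  have hc : ContDiff ℝ ∞ fun y : Fin 1 → ℝ => y 0 := contDiff_apply ℝ ℝ 0
  exact RealAt.comp ha (m := 1) (h := fun _ => h) (fun _ => hh)
    (O := (fun y : Fin 1 → ℝ => y 0) ⁻¹' O) (hO.preimage hc.continuous)
    (Ψ := fun y => Ψ (y 0)) (hΨ.comp hc.contDiffOn fun _ h => h) hxO

theorem RealAt.mul (ha : a.IsChart) {h h' : X → ℝ} (hh : a.RealAt x h)
    (hh' : a.RealAt x h') : a.RealAt x fun z => h z * h' z := by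
  have := RealAt.comp ha (m := 2) (h := ![h, h']) (x := x)
    (fun j => by fin_cases j; exacts [hh, hh']) isOpen_univ (Ψ := fun y => y 0 * y 1)
    ((contDiff_apply ℝ ℝ 0).mul (contDiff_apply ℝ ℝ 1)).contDiffOn trivial
  exact this

theorem RealAt.inv (ha : a.IsChart) {h : X → ℝ} (hh : a.RealAt x h) (h0 : h x ≠ 0) :
    a.RealAt x fun z => (h z)⁻¹ :=
  hh.comp_one ha isOpen_compl_singleton (contDiffOn_inv ℝ) h0

theorem RealAt.log (ha : a.IsChart) {h : X → ℝ} (hh : a.RealAt x h) (h0 : h x ≠ 0) :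
    a.RealAt x fun z => Real.log (h z) :=
  hh.comp_one ha isOpen_compl_singleton Real.contDiffOn_log h0

theorem NonnegAt.realAt (ha : a.IsChart) {f : X → ℝ≥0} (hf : a.NonnegAt x f) :
    a.RealAt x fun z => (f z : ℝ) := by
  rcases hf with ⟨p, h, hh, h0, H⟩ | H
  · exact ((realAt_lam a x p).mul ha hh).congr H
  · exact (realAt_const a x 0).congr (H.mono fun z hz => by rw [hz, NNReal.coe_zero])

/-- A positive smooth function is smooth as a function to `[0, ∞)`. -/
theorem NonnegAt.of_realAt {f : X → ℝ≥0} (hf : a.RealAt x fun z => (f z : ℝ)) (h0 : 0 < f x) :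
    a.NonnegAt x f :=
  Or.inl ⟨0, _, hf, NNReal.coe_pos.2 h0, Filter.Eventually.of_forall fun z => by
    rw [lam_zero, one_mul]⟩

end Calculus

/-- `f` is smooth at `x`, read in the charts `a` and `b`. -/
structure MapAt (a : GChart X) (b : GChart Y) (f : X → Y) (x : X) : Prop where
  continuousAt : ContinuousAt f x
  nonnegAt : ∀ q : b.P, a.NonnegAt x fun z => (b.coord (f z)).1 q

namespace MapAt

variable {a : GChart X} {b : GChart Y} {f : X → Y} {x : X}

theorem realAt_comp (hf : MapAt a b f x) (ha : a.IsChart) {h : Y → ℝ}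
    (hh : b.RealAt (f x) h) : a.RealAt x fun z => h (f z) := by
  obtain ⟨n, r, O, g, hO, hg, hxO, H⟩ := hh
  refine (RealAt.comp ha (h := fun i z => b.lam (r i) (f z))
    (fun i => (hf.nonnegAt (r i)).realAt ha) hO hg hxO).congr ?_
  exact hf.continuousAt.eventually H

theorem nonnegAt_comp (hf : MapAt a b f x) (ha : a.IsChart) {c : Y → ℝ≥0}
    (hc : b.NonnegAt (f x) c) : a.NonnegAt x fun z => c (f z) := by
  rcases hc with ⟨q, h, hh, h0, H⟩ | H
  · have hh' := hf.realAt_comp ha hh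
    rcases hf.nonnegAt q with ⟨p, h', hp, h0', H'⟩ | H'
    · refine Or.inl ⟨p, _, hp.mul ha hh', mul_pos h0' h0, ?_⟩
      filter_upwards [hf.continuousAt.eventually H, H'] with z h1 h2
      rw [h1, lam, h2, mul_assoc]
    · right
      filter_upwards [hf.continuousAt.eventually H, H'] with z h1 h2
      rw [lam, h2, NNReal.coe_zero, zero_mul] at h1
      exact NNReal.coe_eq_zero.1 h1
  · exact Or.inr (hf.continuousAt.eventually H)

theorem comp {Z : Type w} [TopologicalSpace Z] {c : GChart Z} {g : Y → Z}
    (hg : MapAt b c g (f x)) (hf : MapAt a b f x) (ha : a.IsChart) : MapAt a c (g ∘ f) x :=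
  ⟨hg.continuousAt.comp hf.continuousAt, fun q => hf.nonnegAt_comp ha (hg.nonnegAt q)⟩

end MapAt

end GChart

/-! ### Functionals and exponents of germs -/

/-- It suffices to compare on generators: where `u` vanishes so does `v`, and elsewhere `u ≥ 1`. The
bound makes any functional vanishing on `F` nonnegative, or positive off `F`, after adding a
multiple of `u`. -/
theorem IsFace.exists_bound {k : ℕ} {P F : AddSubmonoid (Fin k → ℤ)} (hP : P.FG)
    {u : (Fin k → ℤ) →+ ℤ} (hu0 : ∀ p ∈ P, 0 ≤ u p) (hu : ∀ p ∈ P, u p = 0 ↔ p ∈ F)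
    (v : P →+ ℝ) (hv : ∀ p : P, (p : Fin k → ℤ) ∈ F → v p = 0) :
    ∃ C : ℕ, ∀ p : P, |v p| ≤ C * u p := by
  obtain ⟨N, e, he⟩ := exists_generators hP
  obtain ⟨C, hC⟩ := exists_nat_ge (∑ i, |v (e i)|)
  refine ⟨C, fun p => ?_⟩
  obtain ⟨m, rfl⟩ := he p
  have hgen : ∀ i, |v (e i)| ≤ C * u (e i) := by
    intro i
    have h0 := hu0 (e i) (e i).2
    by_cases hi : u (e i) = 0
    · rw [hv _ ((hu _ (e i).2).1 hi), hi]; simp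
    · have h1 : (1 : ℝ) ≤ u (e i) := by exact_mod_cast (by omega : 1 ≤ u (e i))
      calc |v (e i)| ≤ ∑ i, |v (e i)| :=
            Finset.single_le_sum (f := fun i => |v (e i)|) (fun _ _ => abs_nonneg _)
              (Finset.mem_univ i)
        _ ≤ C := hC
        _ ≤ C * u (e i) := le_mul_of_one_le_right (Nat.cast_nonneg C) h1
  have e1 : u ((∑ i, m i • e i : P) : Fin k → ℤ) = ∑ i, m i • u (e i) := by
    rw [AddSubmonoid.coe_finsetSum, map_sum]
    exact Finset.sum_congr rfl fun i _ => by rw [AddSubmonoidClass.coe_nsmul, map_nsmul]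
  rw [e1, map_sum]
  push_cast
  rw [Finset.mul_sum]
  refine (Finset.abs_sum_le_sum_abs _ _).trans (Finset.sum_le_sum fun i _ => ?_)
  rw [map_nsmul, nsmul_eq_mul, nsmul_eq_mul, abs_mul, Nat.abs_cast]
  push_cast
  calc (m i : ℝ) * |v (e i)| ≤ m i * (C * u (e i)) :=
        mul_le_mul_of_nonneg_left (hgen i) (Nat.cast_nonneg _)
    _ = C * (m i * u (e i)) := by ring

namespace GChart

variable {X : Type u} [TopologicalSpace X] {a : GChart X} {x : X}

theorem IsChart.eventually_inv [Nonempty X] (ha : a.IsChart) (hx : x ∈ a.dom) :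
    Filter.Tendsto (Function.invFunOn a.coord a.dom) (𝓝 (a.coord x)) (𝓝 x) ∧
      ∀ᶠ y in 𝓝 (a.coord x), Function.invFunOn a.coord a.dom y ∈ a.dom ∧
        a.coord (Function.invFunOn a.coord a.dom y) = y := by
  have hinv : ∀ z ∈ a.dom, Function.invFunOn a.coord a.dom (a.coord z) = z := fun z hz =>
    ha.injOn.leftInvOn_invFunOn hz
  constructor
  · intro V hV
    have := ha.image_mem_nhds hx (Filter.inter_mem hV (ha.dom_mem_nhds hx))
    refine Filter.mem_map.2 (Filter.mem_of_superset this ?_)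
    rintro _ ⟨z, hz, rfl⟩
    rw [Set.mem_preimage, hinv z hz.2]
    exact hz.1
  · refine Filter.mem_of_superset (ha.image_mem_nhds hx (ha.dom_mem_nhds hx)) ?_
    rintro _ ⟨z, hz, rfl⟩
    change _ ∈ _ ∧ _
    rw [hinv z hz]
    exact ⟨hz, rfl⟩

/-- Points of larger support converging to `x`. -/
theorem IsChart.exists_curve (ha : a.IsChart) (hx : x ∈ a.dom) {F : AddSubmonoid (Fin a.k → ℤ)}
    (hF : IsFace F a.P) (hxF : (a.coord x).supp ≤ F) {v : (Fin a.k → ℤ) →+ ℝ}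
    (hv0 : ∀ p ∈ (a.coord x).supp, v p = 0) (hv : ∀ p ∈ F, p ∉ (a.coord x).supp → 0 < v p) :
    ∃ (c : ℝ → X) (ℓ : (Fin a.k → ℤ) →+ ℝ), Filter.Tendsto c Filter.atTop (𝓝 x) ∧
      ∀ᶠ t in Filter.atTop, c t ∈ a.dom ∧ (a.coord (c t)).supp = F ∧
        ∀ p : a.P, (p : Fin a.k → ℤ) ∈ F → a.lam p (c t) = Real.exp (ℓ p - t * v p) := by
  have : Nonempty X := ⟨x⟩
  obtain ⟨ℓ, hℓ⟩ := (a.coord x).exists_log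
  have h1 := Model.tendsto_point hF hxF hℓ hv0 hv
  obtain ⟨h2, h3⟩ := ha.eventually_inv hx
  refine ⟨_, ℓ, h2.comp h1, ?_⟩
  filter_upwards [h1.eventually h3] with t ht
  refine ⟨ht.1, ?_, fun p hp => ?_⟩
  · rw [Function.comp_apply, ht.2, Model.supp_point]
  · rw [lam, Function.comp_apply, ht.2, Model.point_apply hF _ hp]
    rfl

theorem IsChart.fg_of_isFace (ha : a.IsChart) {F : AddSubmonoid (Fin a.k → ℤ)}
    (hF : IsFace F a.P) : F.FG := hF.fg ha.weaklyToric.fg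

theorem IsChart.frequently_supp_eq (ha : a.IsChart) (hx : x ∈ a.dom)
    {F : AddSubmonoid (Fin a.k → ℤ)} (hF : IsFace F a.P) (hxF : (a.coord x).supp ≤ F) :
    ∃ᶠ y in 𝓝 x, y ∈ a.dom ∧ (a.coord y).supp = F := by
  have hface := (a.coord x).isFace_supp.of_le hF hxF
  obtain ⟨u, hu0, hu⟩ := hface.exists_functional (ha.fg_of_isFace hF)
  obtain ⟨c, ℓ, hc, h⟩ := ha.exists_curve hx hF hxF (v := (Int.castAddHom ℝ).comp u)
    (fun p hp => by simpa using (hu p (hxF hp)).2 hp)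
    (fun p hp hpx => by
      have : u p ≠ 0 := fun h0 => hpx ((hu p hp).1 h0)
      have := hu0 p hp
      simp only [AddMonoidHom.comp_apply, Int.coe_castAddHom, Int.cast_pos]
      omega)
  exact hc.frequently (h.mono fun t ht => ⟨ht.1, ht.2.1⟩).frequently

theorem IsChart.frequently_supp_eq_top (ha : a.IsChart) (hx : x ∈ a.dom) :
    ∃ᶠ y in 𝓝 x, y ∈ a.dom ∧ (a.coord y).supp = a.P :=
  ha.frequently_supp_eq hx (IsFace.refl _) (a.coord x).isFace_supp.le

/-- The support is finitely generated, and the finitely many positive functions `λ_p` attached to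
its generators stay positive nearby. -/
theorem IsChart.eventually_supp_le (ha : a.IsChart) (hx : x ∈ a.dom) :
    ∀ᶠ y in 𝓝 x, (a.coord x).supp ≤ (a.coord y).supp := by
  obtain ⟨l, hl⟩ := exists_list_closure_eq (ha.fg_of_isFace (a.coord x).isFace_supp)
  have hlx : ∀ i : Fin l.length, l.get i ∈ (a.coord x).supp := fun i =>
    hl ▸ AddSubmonoid.subset_closure (List.get_mem l i)
  have key : ∀ᶠ y in 𝓝 x, ∀ i : Fin l.length, l.get i ∈ (a.coord y).supp := by
    rw [Filter.eventually_all]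
    intro i
    have h0 : 0 < a.lam ⟨l.get i, (a.coord x).isFace_supp.le (hlx i)⟩ x := lam_pos_iff.2 (hlx i)
    filter_upwards [(ha.continuousAt_lam hx _).eventually (lt_mem_nhds h0)] with y hy
    exact lam_pos_iff.1 hy
  filter_upwards [key] with y hy
  rw [← hl, AddSubmonoid.closure_le]
  intro p hp
  obtain ⟨i, rfl⟩ := List.get_of_mem hp
  exact hy i

/-- On the stratum given by `F`, a germ `λ_p · h` with `h` positive determines `p` up to elements
of the support of `x`. -/
theorem IsChart.eq_of_lam_mul_eq (ha : a.IsChart) (hx : x ∈ a.dom)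
    {F : AddSubmonoid (Fin a.k → ℤ)} (hF : IsFace F a.P) (hxF : (a.coord x).supp ≤ F)
    {p p' : a.P} (hp : (p : Fin a.k → ℤ) ∈ F) (hp' : (p' : Fin a.k → ℤ) ∈ F) {h h' : X → ℝ}
    (hc : ContinuousAt h x) (h0 : 0 < h x) (hc' : ContinuousAt h' x) (h0' : 0 < h' x)
    (H : ∀ᶠ y in 𝓝 x, y ∈ a.dom → (a.coord y).supp = F → a.lam p y * h y = a.lam p' y * h' y)
    (v : (Fin a.k → ℤ) →+ ℝ) (hv : ∀ f ∈ (a.coord x).supp, v f = 0) : v p = v p' := by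
  -- If `v` is positive off the support, the curve `t ↦ exp (ℓ - t v)` in the stratum of `F`
  -- converges to `x`. Taking logarithms of the two sides along it and dividing by `t`, all terms
  -- except `v p` and `v p'` tend to zero.
  have key : ∀ v : (Fin a.k → ℤ) →+ ℝ, (∀ f ∈ (a.coord x).supp, v f = 0) →
      (∀ p ∈ F, p ∉ (a.coord x).supp → 0 < v p) → v p = v p' := by
    intro v hv0 hv
    obtain ⟨c, ℓ, hct, hcl⟩ := ha.exists_curve hx hF hxF hv0 hv
    have hlim : Filter.Tendsto (fun t => ℓ p - ℓ p' + Real.log (h (c t)) - Real.log (h' (c t)))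
        Filter.atTop (𝓝 (ℓ p - ℓ p' + Real.log (h x) - Real.log (h' x))) :=
      (((hc.tendsto.comp hct).log h0.ne').const_add _).sub ((hc'.tendsto.comp hct).log h0'.ne')
    have heq : ∀ᶠ t in Filter.atTop,
        (ℓ p - ℓ p' + Real.log (h (c t)) - Real.log (h' (c t))) * t⁻¹ = v p - v p' := by
      filter_upwards [hcl, hct.eventually H, hct.eventually (hc.eventually (lt_mem_nhds h0)),
        hct.eventually (hc'.eventually (lt_mem_nhds h0')), Filter.eventually_gt_atTop 0] with
        t h1 h2 h3 h4 h5
      have h6 := h2 h1.1 h1.2.1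
      rw [h1.2.2 p hp, h1.2.2 p' hp'] at h6
      have h7 := congrArg Real.log h6
      rw [Real.log_mul (Real.exp_pos _).ne' h3.ne', Real.log_mul (Real.exp_pos _).ne' h4.ne',
        Real.log_exp, Real.log_exp] at h7
      field_simp
      linarith
    have h2 : Filter.Tendsto (fun t : ℝ =>
        (ℓ p - ℓ p' + Real.log (h (c t)) - Real.log (h' (c t))) * t⁻¹) Filter.atTop (𝓝 0) := by
      simpa using hlim.mul tendsto_inv_atTop_zero
    have h3 := h2.congr' heq
    have := tendsto_nhds_unique h3 tendsto_const_nhds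
    linarith
  have hface := (a.coord x).isFace_supp.of_le hF hxF
  have hfg := ha.fg_of_isFace hF
  obtain ⟨u, hu0, hu⟩ := hface.exists_functional hfg
  obtain ⟨C, hC⟩ := IsFace.exists_bound hfg hu0 hu (v.comp F.subtype) fun p hp => hv p hp
  have hpos : ∀ p ∈ F, p ∉ (a.coord x).supp → (0 : ℝ) < u p := by
    intro p hp hpx
    have : u p ≠ 0 := fun h0 => hpx ((hu p hp).1 h0)
    have := hu0 p hp
    rw [Int.cast_pos]
    omega
  have h1 := key ((Int.castAddHom ℝ).comp u) (fun f hf => by simpa using (hu f (hxF hf)).2 hf)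
    fun p hp hpx => hpos p hp hpx
  -- A general `v` is the difference of `v + (C + 1) u` and `(C + 1) u`; both are positive off the
  -- support by the choice of `C`.
  have h2 := key (v + (C + 1) • (Int.castAddHom ℝ).comp u)
    (fun f hf => by simp [hv f hf, (hu f (hxF hf)).2 hf])
    (fun p hp hpx => by
      have e1 : |v p| ≤ C * u p := hC ⟨p, hp⟩
      have e2 := hpos p hp hpx
      have e3 := neg_abs_le (v p)
      simp only [AddMonoidHom.add_apply, AddMonoidHom.nsmul_apply, AddMonoidHom.comp_apply,
        Int.coe_castAddHom, nsmul_eq_mul, Nat.cast_add, Nat.cast_one]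
      nlinarith)
  simp only [AddMonoidHom.add_apply, AddMonoidHom.nsmul_apply] at h2
  rw [h1] at h2
  linarith

/-- The germ of `c` at `x` has exponent `p`: it is `λ_p` times a positive continuous function. -/
def HasExp (a : GChart X) (x : X) (c : X → ℝ≥0) (p : a.P) : Prop :=
  ∃ h : X → ℝ, ContinuousAt h x ∧ 0 < h x ∧ ∀ᶠ z in 𝓝 x, (c z : ℝ) = a.lam p z * h z

namespace HasExp

variable {c c' : X → ℝ≥0} {p p' : a.P}

theorem congr (hc : a.HasExp x c p) (e : ∀ᶠ z in 𝓝 x, c' z = c z) : a.HasExp x c' p := by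
  obtain ⟨h, h1, h2, h3⟩ := hc
  exact ⟨h, h1, h2, by filter_upwards [e, h3] with z hz1 hz2; rw [hz1, hz2]⟩

theorem mul (hc : a.HasExp x c p) (hc' : a.HasExp x c' p') :
    a.HasExp x (fun z => c z * c' z) (p + p') := by
  obtain ⟨h, h1, h2, h3⟩ := hc
  obtain ⟨h', h1', h2', h3'⟩ := hc'
  refine ⟨fun z => h z * h' z, h1.mul h1', mul_pos h2 h2', ?_⟩
  filter_upwards [h3, h3'] with z hz hz'
  rw [NNReal.coe_mul, hz, hz', lam_add]
  ring

theorem refl (a : GChart X) (x : X) (p : a.P) : a.HasExp x (fun z => (a.coord z).1 p) p :=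
  ⟨fun _ => 1, continuousAt_const, one_pos, Filter.Eventually.of_forall fun _ => (mul_one _).symm⟩

theorem mem_supp_iff (hc : a.HasExp x c p) :
    (p : Fin a.k → ℤ) ∈ (a.coord x).supp ↔ 0 < c x := by
  obtain ⟨h, h1, h2, h3⟩ := hc
  rw [← lam_pos_iff, ← NNReal.coe_pos, h3.self_of_nhds, mul_pos_iff_of_pos_right h2]

theorem eventually_pos_iff (hc : a.HasExp x c p) :
    ∀ᶠ z in 𝓝 x, 0 < c z ↔ (p : Fin a.k → ℤ) ∈ (a.coord z).supp := by
  obtain ⟨h, h1, h2, h3⟩ := hc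
  filter_upwards [h3, h1.eventually (lt_mem_nhds h2)] with z hz hz'
  rw [← lam_pos_iff, ← NNReal.coe_pos, hz, mul_pos_iff_of_pos_right hz']

theorem unique (ha : a.IsChart) (hx : x ∈ a.dom) (hc : a.HasExp x c p) (hc' : a.HasExp x c p')
    (v : a.P →+ ℝ) (hv : ∀ q : a.P, (q : Fin a.k → ℤ) ∈ (a.coord x).supp → v q = 0) :
    v p = v p' := by
  obtain ⟨h, h1, h2, h3⟩ := hc
  obtain ⟨h', h1', h2', h3'⟩ := hc'
  obtain ⟨w, hw⟩ := exists_extend a.P v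
  have hF := (a.coord x).isFace_supp
  rw [← hw, ← hw]
  refine ha.eq_of_lam_mul_eq hx (IsFace.refl _) hF.le p.2 p'.2 h1 h2 h1' h2' ?_ w
    fun f hf => (hw ⟨f, hF.le hf⟩).trans (hv _ hf)
  filter_upwards [h3, h3'] with z e e' _ _
  rw [← e, ← e']

theorem of_nonnegAt (ha : a.IsChart) (hx : x ∈ a.dom) (hc : a.NonnegAt x c)
    (h0 : ∃ᶠ z in 𝓝 x, 0 < c z) : ∃ p, a.HasExp x c p := by
  rcases hc with ⟨p, h, hh, hpos, H⟩ | H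
  · exact ⟨p, h, hh.continuousAt ha hx, hpos, H⟩
  · obtain ⟨z, hz, hz'⟩ := (h0.and_eventually H).exists
    exact absurd hz' hz.ne'

/-- Exponents compose. -/
theorem comp {Y : Type v} [TopologicalSpace Y] {b : GChart Y} {f : X → Y} {d : Y → ℝ≥0} {q : b.P}
    (hd : b.HasExp (f x) d q) (hf : ContinuousAt f x)
    (hq : a.HasExp x (fun z => (b.coord (f z)).1 q) p) : a.HasExp x (fun z => d (f z)) p := by
  obtain ⟨h, h1, h2, h3⟩ := hd
  obtain ⟨h', h1', h2', h3'⟩ := hq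
  refine ⟨fun z => h' z * h (f z), h1'.mul (h1.comp hf), mul_pos h2' h2, ?_⟩
  filter_upwards [hf.eventually h3, h3'] with z hz hz'
  rw [hz, lam, hz', mul_assoc]

end HasExp

end GChart

/-! ### Spaces with compatible charts, possibly of different dimensions -/

namespace GSpace

/-- The part of the axioms of a manifold with g-corners which the corners `C(X)` share. -/
structure IsMixed (X : GSpace.{u}) : Prop where
  isChart : ∀ c ∈ X.atlas, c.IsChart
  cover : ∀ x : X, ∃ c ∈ X.atlas, x ∈ c.dom
  compatible : ∀ c ∈ X.atlas, ∀ d ∈ X.atlas, c.Compatible d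

theorem _root_.GCorners.Manifold.isMixed (X : Manifold.{u}) : X.toGSpace.IsMixed :=
  ⟨X.isChart, X.cover, X.compatible⟩

namespace IsMixed

variable {X : GSpace.{u}} (hX : X.IsMixed)
include hX

theorem nonnegAt_of_compatible {a b : GChart X} (ha : a ∈ X.atlas) (hb : b ∈ X.atlas) {x : X}
    (hxa : x ∈ a.dom) (hxb : x ∈ b.dom) (q : b.P) :
    a.NonnegAt x fun z => (b.coord z).1 q :=
  ((hX.isChart a ha).smoothNonnegOn_iff
    ((hX.isChart a ha).isOpen_dom.inter (hX.isChart b hb).isOpen_dom)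
    Set.inter_subset_left).1 ((hX.compatible a ha b hb).1 q) x ⟨hxa, hxb⟩

theorem mapAt_id {a b : GChart X} (ha : a ∈ X.atlas) (hb : b ∈ X.atlas) {x : X}
    (hxa : x ∈ a.dom) (hxb : x ∈ b.dom) : GChart.MapAt a b id x :=
  ⟨continuousAt_id, fun q => hX.nonnegAt_of_compatible ha hb hxa hxb q⟩

theorem exists_exp {a b : GChart X} (ha : a ∈ X.atlas) (hb : b ∈ X.atlas) {x : X}
    (hxa : x ∈ a.dom) (hxb : x ∈ b.dom) (q : b.P) :
    ∃ p, a.HasExp x (fun z => (b.coord z).1 q) p := by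
  refine GChart.HasExp.of_nonnegAt (hX.isChart a ha) hxa
    (hX.nonnegAt_of_compatible ha hb hxa hxb q) ?_
  refine ((hX.isChart b hb).frequently_supp_eq_top hxb).mono fun y hy => ?_
  rw [Model.pos_iff_mem_supp, hy.2]
  exact q.2

/-- The depth is the dimension of the space of functionals that vanish on the support. Composing
with the exponents `φ` of the change of charts maps one such space linearly to the other, and this
is injective because the exponents `ψ` of the inverse change of charts undo `φ` as far as such
functionals can see. -/
theorem coord_depth_le {a b : GChart X} (ha : a ∈ X.atlas) (hb : b ∈ X.atlas) {x : X}
    (hxa : x ∈ a.dom) (hxb : x ∈ b.dom) : (a.coord x).depth ≤ (b.coord x).depth := by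
  have hac := hX.isChart a ha
  have hbc := hX.isChart b hb
  choose φ hφ using hX.exists_exp ha hb hxa hxb
  choose ψ hψ using hX.exists_exp hb ha hxb hxa
  let T : homVanishing a.P (a.coord x).supp →ₗ[ℝ] homVanishing b.P (b.coord x).supp :=
    { toFun := fun v => ⟨AddMonoidHom.mk' (fun q => v.1 (φ q)) fun q q' => by
          rw [← map_add]
          refine GChart.HasExp.unique hac hxa (hφ (q + q')) ?_ v.1 v.2
          exact ((hφ q).mul (hφ q')).congr (Filter.Eventually.of_forall fun z =>
            (b.coord z).apply_add q q'), fun q hq => v.2 _ (by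
              rw [(hφ q).mem_supp_iff, Model.pos_iff_mem_supp]; exact hq)⟩
      map_add' := fun _ _ => rfl
      map_smul' := fun _ _ => rfl }
  have hT : Function.Injective T := by
    intro v w hvw
    refine Subtype.ext (AddMonoidHom.ext fun p => ?_)
    have h1 : v.1 (φ (ψ p)) = w.1 (φ (ψ p)) := DFunLike.congr_fun (congrArg Subtype.val hvw) (ψ p)
    have h2 := (hψ p).comp (f := id) continuousAt_id (hφ (ψ p))
    rw [GChart.HasExp.unique hac hxa (GChart.HasExp.refl a x p) h2 v.1 v.2,
      GChart.HasExp.unique hac hxa (GChart.HasExp.refl a x p) h2 w.1 w.2, h1]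
  have := (finrank_hom b.P).1
  have h1 := LinearMap.finrank_le_finrank_of_injective hT
  have h2 := finrank_homVanishing (a.coord x).isFace_supp.le
  have h3 := finrank_homVanishing (b.coord x).isFace_supp.le
  unfold Model.depth
  omega

theorem depth_eq {a : GChart X} (ha : a ∈ X.atlas) {x : X} (hxa : x ∈ a.dom) :
    X.depth x = (a.coord x).depth := by
  have : {d | ∃ c ∈ X.atlas, x ∈ c.dom ∧ d = (c.coord x).depth} = {(a.coord x).depth} := by
    ext d
    constructor
    · rintro ⟨c, hc, hxc, rfl⟩
      exact le_antisymm (hX.coord_depth_le hc ha hxc hxa) (hX.coord_depth_le ha hc hxa hxc)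
    · rintro rfl
      exact ⟨a, ha, hxa, rfl⟩
  rw [depth, this, csInf_singleton]

theorem mem_stratum_zero_iff {a : GChart X} (ha : a ∈ X.atlas) {x : X} (hxa : x ∈ a.dom) :
    x ∈ X.stratum 0 ↔ (a.coord x).supp = a.P := by
  change X.depth x = 0 ↔ _
  rw [hX.depth_eq ha hxa, Model.depth]
  constructor
  · intro h
    exact (a.coord x).isFace_supp.eq_of_rank_le (hX.isChart a ha).weaklyToric.fg (by omega)
  · intro h
    rw [h, Nat.sub_self]

theorem interiorOn_iff {V : Set X} (hV : IsOpen V) {c : X → ℝ≥0} :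
    X.InteriorOn V c ↔ (∀ a ∈ X.atlas, ∀ x ∈ V, x ∈ a.dom → a.NonnegAt x c) ∧
      ∀ z ∈ V ∩ X.stratum 0, 0 < c z := by
  refine and_congr_left fun _ => forall₂_congr fun a ha => ?_
  rw [(hX.isChart a ha).smoothNonnegOn_iff (hV.inter (hX.isChart a ha).isOpen_dom)
    Set.inter_subset_right]
  exact ⟨fun h x hxV hxa => h x ⟨hxV, hxa⟩, fun h x hx => h x hx.1 hx.2⟩

theorem interiorOn_coord {a : GChart X} (ha : a ∈ X.atlas) (p : a.P) :
    X.InteriorOn a.dom fun z => (a.coord z).1 p := by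
  rw [hX.interiorOn_iff (hX.isChart a ha).isOpen_dom]
  refine ⟨fun b hb x hxa hxb => hX.nonnegAt_of_compatible hb ha hxb hxa p, fun z hz => ?_⟩
  rw [Model.pos_iff_mem_supp, (hX.mem_stratum_zero_iff ha hz.1).1 hz.2]
  exact p.2

theorem frequently_stratum_zero (x : X) : ∃ᶠ y in 𝓝 x, y ∈ X.stratum 0 := by
  obtain ⟨a, ha, hxa⟩ := hX.cover x
  exact ((hX.isChart a ha).frequently_supp_eq_top hxa).mono fun y hy =>
    (hX.mem_stratum_zero_iff ha hy.1).2 hy.2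

theorem exists_hasExp_of_mem_interiorGerms {a : GChart X} (ha : a ∈ X.atlas) {x : X}
    (hxa : x ∈ a.dom) (b : X.interiorGerms x) :
    ∃ (c : X → ℝ≥0) (p : a.P), b.1 = (c : Filter.Germ (𝓝 x) ℝ≥0) ∧ a.NonnegAt x c ∧
      a.HasExp x c p := by
  obtain ⟨V, c, hV, hxV, hc, e⟩ := b.2
  have hc' := (hX.interiorOn_iff hV).1 hc
  have h1 := hc'.1 a ha x hxV hxa
  obtain ⟨p, hp⟩ := GChart.HasExp.of_nonnegAt (hX.isChart a ha) hxa h1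
    (((hX.frequently_stratum_zero x).and_eventually (hV.mem_nhds hxV)).mono fun y hy =>
      hc'.2 y ⟨hy.2, hy.1⟩)
  exact ⟨c, p, e, h1, hp⟩

theorem eq_of_hasExp_germ {a : GChart X} (ha : a ∈ X.atlas) {x : X}
    (hxa : x ∈ a.dom) {c c' : X → ℝ≥0} (e : (c : Filter.Germ (𝓝 x) ℝ≥0) = c') {p p' : a.P}
    (hc : a.HasExp x c p) (hc' : a.HasExp x c' p') (v : a.P →+ ℕ)
    (hv : ∀ q : a.P, (q : Fin a.k → ℤ) ∈ (a.coord x).supp → v q = 0) : v p = v p' := by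
  have e' : ∀ᶠ z in 𝓝 x, c z = c' z := Filter.Germ.coe_eq.1 e
  have := GChart.HasExp.unique (hX.isChart a ha) hxa hc (hc'.congr e')
    ((Nat.castAddMonoidHom ℝ).comp v) fun q hq => by simp [hv q hq]
  simpa using this

end IsMixed

end GSpace

/-! ### Smooth and interior maps between mixed spaces -/

section Maps

variable {X : GSpace.{u}} {Y : GSpace.{v}} {f : X → Y} (hX : X.IsMixed) (hY : Y.IsMixed)
include hX hY

theorem IsSmooth.mapAt (hf : IsSmooth f) {a : GChart X} (ha : a ∈ X.atlas) {b : GChart Y}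
    (hb : b ∈ Y.atlas) {x : X} (hxa : x ∈ a.dom) (hxb : f x ∈ b.dom) : GChart.MapAt a b f x :=
  ⟨hf.1.continuousAt, fun q =>
    ((hX.isChart a ha).smoothNonnegOn_iff
      ((hX.isChart a ha).isOpen_dom.inter ((hY.isChart b hb).isOpen_dom.preimage hf.1))
      Set.inter_subset_left).1 (hf.2 a ha b hb q) x ⟨hxa, hxb⟩⟩

/-- One pair of charts at each point is enough, since changes of charts are smooth on both sides. -/
theorem isSmooth_of_mapAt (hf : ∀ x, ∃ a ∈ X.atlas, x ∈ a.dom ∧ ∃ b ∈ Y.atlas, f x ∈ b.dom ∧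
    GChart.MapAt a b f x) : IsSmooth f := by
  have hc : Continuous f := by
    rw [continuous_iff_continuousAt]
    intro x
    obtain ⟨a, -, -, b, -, -, h⟩ := hf x
    exact h.continuousAt
  refine ⟨hc, fun a ha b hb q => ?_⟩
  rw [(hX.isChart a ha).smoothNonnegOn_iff
      ((hX.isChart a ha).isOpen_dom.inter ((hY.isChart b hb).isOpen_dom.preimage hc))
      Set.inter_subset_left]
  rintro x ⟨hxa, hxb⟩
  obtain ⟨a', ha', hxa', b', hb', hxb', h⟩ := hf x
  have h1 := GChart.MapAt.comp (f := id) (x := x) h (hX.mapAt_id ha ha' hxa hxa') (hX.isChart a ha)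
  have h2 := GChart.MapAt.comp (g := id) (hY.mapAt_id hb' hb hxb' hxb) h1 (hX.isChart a ha)
  exact h2.nonnegAt q

theorem IsInterior.exists_exp (hf : IsInterior f) {a : GChart X} (ha : a ∈ X.atlas) {b : GChart Y}
    (hb : b ∈ Y.atlas) {x : X} (hxa : x ∈ a.dom) (hxb : f x ∈ b.dom) (q : b.P) :
    ∃ p, a.HasExp x (fun z => (b.coord (f z)).1 q) p := by
  have h := hf.1.mapAt hX hY ha hb hxa hxb
  refine GChart.HasExp.of_nonnegAt (hX.isChart a ha) hxa (h.nonnegAt q) ?_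
  have hV : ∀ᶠ z in 𝓝 x, f z ∈ b.dom :=
    h.continuousAt.eventually ((hY.isChart b hb).dom_mem_nhds hxb)
  refine ((hX.frequently_stratum_zero x).and_eventually hV).mono fun y hy => ?_
  rw [Model.pos_iff_mem_supp, (hY.mem_stratum_zero_iff hb hy.2).1 (hf.2 y hy.1)]
  exact q.2

theorem IsInterior.pullsBack (hf : IsInterior f) (x : X) : PullsBack f x := by
  refine ⟨hf.1.1.continuousAt, ?_⟩
  rintro _ ⟨V, c, hV, hxV, hc, rfl⟩
  rw [hY.interiorOn_iff hV] at hc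
  have hV' := hV.preimage hf.1.1
  refine ⟨f ⁻¹' V, fun z => c (f z), hV', hxV, ?_, rfl⟩
  rw [hX.interiorOn_iff hV']
  refine ⟨fun a ha z hz hza => ?_, fun z hz => hc.2 _ ⟨hz.1, hf.2 z hz.2⟩⟩
  obtain ⟨b, hb, hzb⟩ := hY.cover (f z)
  exact (hf.1.mapAt hX hY ha hb hza hzb).nonnegAt_comp (hX.isChart a ha) (hc.1 b hb _ hz hzb)

theorem mTildeMap_apply (hf : IsInterior f) {x : X} (α : X.MTilde x) {c : Y → ℝ≥0}
    (hc : (c : Filter.Germ (𝓝 (f x)) ℝ≥0) ∈ Y.interiorGerms (f x)) :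
    ∃ hc' : ((fun z => c (f z) : X → ℝ≥0) : Filter.Germ (𝓝 x) ℝ≥0) ∈ X.interiorGerms x,
      (mTildeMap f x α).1 (Additive.ofMul ⟨c, hc⟩) = α.1 (Additive.ofMul ⟨_, hc'⟩) := by
  have h := hf.pullsBack hX hY x
  refine ⟨h.2 _ hc, ?_⟩
  rw [mTildeMap, dif_pos h]
  rfl

end Maps

/-! ### Elements of `M̃_x X` given by functionals -/

/-- A map to `ℕ` preserving addition preserves zero. -/
def natHom {M : Type*} [AddZeroClass M] (f : M → ℕ) (hf : ∀ x y, f (x + y) = f x + f y) :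
    M →+ ℕ where
  toFun := f
  map_zero' := by have := hf 0 0; rw [add_zero] at this; omega
  map_add' := hf

theorem GChart.RealAt.eventually {X : Type u} [TopologicalSpace X] {a : GChart X} {x : X}
    {h : X → ℝ} (hh : a.RealAt x h) (ha : a.IsChart) (hx : x ∈ a.dom) :
    ∀ᶠ z in 𝓝 x, a.RealAt z h := by
  obtain ⟨n, r, O, g, hO, hg, hxO, H⟩ := hh
  have hc : ContinuousAt (fun z => fun i => a.lam (r i) z) x :=
    continuousAt_pi.2 fun i => ha.continuousAt_lam hx (r i)
  filter_upwards [hc.eventually (hO.mem_nhds hxO), H.eventually_nhds] with z h1 h2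
  exact ⟨n, r, O, g, hO, hg, h1, h2⟩

namespace GSpace.IsMixed

variable {X : GSpace.{u}} (hX : X.IsMixed)
include hX

/-- A germ is sent to the value of `v` on its exponent. Exponents are unique and additive only
modulo the group of the support, but `v` vanishes there. -/
theorem exists_mTilde {a : GChart X} (ha : a ∈ X.atlas) {x : X}
    (hxa : x ∈ a.dom) (v : a.P →+ ℕ)
    (hv : ∀ q : a.P, (q : Fin a.k → ℤ) ∈ (a.coord x).supp → v q = 0) :
    ∃ α : X.MTilde x, ∀ (c : X → ℝ≥0) (hc : (c : Filter.Germ (𝓝 x) ℝ≥0) ∈ X.interiorGerms x)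
      (p : a.P), a.HasExp x c p → α.1 (Additive.ofMul ⟨c, hc⟩) = v p := by
  choose c p h1 h2 h3 using hX.exists_hasExp_of_mem_interiorGerms ha hxa
  let α : Additive (X.interiorGerms x) →+ ℕ := natHom
    (fun b : Additive (X.interiorGerms x) => v (p b.toMul)) (by
    intro b b'
    rw [← map_add]
    refine hX.eq_of_hasExp_germ ha hxa ?_ (h3 _) ((h3 _).mul (h3 _)) v hv
    rw [← h1]
    change (b.toMul * b'.toMul).1 = ((c b.toMul : Filter.Germ (𝓝 x) ℝ≥0) * c b'.toMul)
    rw [← h1, ← h1]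
    rfl)
  refine ⟨⟨α, fun b hb => hv _ ?_⟩, fun d hd q hq =>
    hX.eq_of_hasExp_germ ha hxa (h1 ⟨d, hd⟩).symm (h3 ⟨d, hd⟩) hq v hv⟩
  rw [(h3 _).mem_supp_iff]
  rw [h1] at hb
  exact hb

theorem mTilde_ext {a : GChart X} (ha : a ∈ X.atlas) {x : X} (hxa : x ∈ a.dom) {α β : X.MTilde x}
    (h : ∀ (c : X → ℝ≥0) (hc : (c : Filter.Germ (𝓝 x) ℝ≥0) ∈ X.interiorGerms x) (p : a.P),
      a.HasExp x c p → α.1 (Additive.ofMul ⟨c, hc⟩) = β.1 (Additive.ofMul ⟨c, hc⟩)) : α = β := by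
  refine Subtype.ext (AddMonoidHom.ext fun b => ?_)
  obtain ⟨c, p, h1, -, h3⟩ := hX.exists_hasExp_of_mem_interiorGerms ha hxa b.toMul
  have hc : (c : Filter.Germ (𝓝 x) ℝ≥0) ∈ X.interiorGerms x := h1 ▸ b.toMul.2
  have : b = Additive.ofMul ⟨c, hc⟩ := congrArg Additive.ofMul (Subtype.ext h1)
  rw [this]
  exact h c hc p h3

theorem coord_mem_interiorGerms {a : GChart X} (ha : a ∈ X.atlas) {x : X}
    (hxa : x ∈ a.dom) (p : a.P) :
    ((fun z => (a.coord z).1 p : X → ℝ≥0) : Filter.Germ (𝓝 x) ℝ≥0) ∈ X.interiorGerms x :=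
  ⟨a.dom, _, (hX.isChart a ha).isOpen_dom, hxa, hX.interiorOn_coord ha p, rfl⟩

theorem mem_interiorGerms_of_realAt {a : GChart X} (ha : a ∈ X.atlas) {x : X}
    (hxa : x ∈ a.dom) {h : X → ℝ≥0} (hh : a.RealAt x fun z => (h z : ℝ)) (h0 : 0 < h x) :
    (h : Filter.Germ (𝓝 x) ℝ≥0) ∈ X.interiorGerms x := by
  have hac := hX.isChart a ha
  have hpos : ∀ᶠ z in 𝓝 x, (0 : ℝ) < h z :=
    (hh.continuousAt hac hxa).eventually (lt_mem_nhds (NNReal.coe_pos.2 h0))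
  obtain ⟨V, hV, hVo, hxV⟩ := eventually_nhds_iff.1 ((hh.eventually hac hxa).and
    (hpos.and (Filter.eventually_mem_set.2 (hac.dom_mem_nhds hxa))))
  refine ⟨V, h, hVo, hxV, (hX.interiorOn_iff hVo).2 ⟨fun b hb z hz hzb => ?_, fun z hz =>
    NNReal.coe_pos.1 (hV z hz.1).2.1⟩, rfl⟩
  obtain ⟨h1, h2, h3⟩ := hV z hz
  exact GChart.NonnegAt.of_realAt ((hX.mapAt_id hb ha hzb h3).realAt_comp (hX.isChart b hb) h1)
    (NNReal.coe_pos.1 h2)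

/-- The functional on `P` given by an element of `M̃_x X`. -/
theorem exists_functional_of_mTilde {a : GChart X} (ha : a ∈ X.atlas) {x : X}
    (hxa : x ∈ a.dom) (α : X.MTilde x) :
    ∃ v : a.P →+ ℕ, (∀ q : a.P, (q : Fin a.k → ℤ) ∈ (a.coord x).supp → v q = 0) ∧
      ∀ (c : X → ℝ≥0) (hc : (c : Filter.Germ (𝓝 x) ℝ≥0) ∈ X.interiorGerms x)
      (p : a.P), a.HasExp x c p → α.1 (Additive.ofMul ⟨c, hc⟩) = v p := by
  have hv : ∀ q : a.P, (q : Fin a.k → ℤ) ∈ (a.coord x).supp →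
      α.1 (Additive.ofMul ⟨_, hX.coord_mem_interiorGerms ha hxa q⟩) = 0 := fun q hq =>
    α.2 _ (Model.pos_iff_mem_supp.2 hq)
  let v : a.P →+ ℕ :=
    natHom (fun p => α.1 (Additive.ofMul ⟨_, hX.coord_mem_interiorGerms ha hxa p⟩)) fun p q => by
      rw [← map_add, ← ofMul_mul]
      congr 2
      refine Subtype.ext (congrArg Filter.Germ.ofFun (funext fun z => ?_))
      exact (a.coord z).apply_add p q
  refine ⟨v, hv, fun c hc p hp => ?_⟩
  have hac := hX.isChart a ha
  obtain ⟨c', p', e, hc', hp'⟩ := hX.exists_hasExp_of_mem_interiorGerms ha hxa ⟨c, hc⟩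
  have e' : (c : Filter.Germ (𝓝 x) ℝ≥0) = c' := e
  rcases hc' with ⟨p₁, h, hh, h0, H⟩ | H
  · have hp₁ : a.HasExp x c' p₁ := ⟨h, hh.continuousAt hac hxa, h0, H⟩
    rw [hX.eq_of_hasExp_germ ha hxa e' hp hp₁ v hv]
    have hpos := (hh.continuousAt hac hxa).eventually (lt_mem_nhds h0)
    have hh' : a.RealAt x fun z => ((h z).toNNReal : ℝ) := hh.congr (hpos.mono fun z hz =>
      Real.coe_toNNReal _ hz.le)
    have hmem := hX.mem_interiorGerms_of_realAt ha hxa hh' (Real.toNNReal_pos.2 h0)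
    -- The germ is `λ_{p₁}` times an interior germ positive at `x`, and `α` is zero on the latter.
    have e₂ : (⟨c, hc⟩ : X.interiorGerms x) = ⟨_, hX.coord_mem_interiorGerms ha hxa p₁⟩ *
        ⟨_, hmem⟩ := by
      refine Subtype.ext (e'.trans (Filter.Germ.coe_eq.2 ?_))
      filter_upwards [H, hpos] with z hz hz'
      refine NNReal.coe_injective ?_
      change _ = (((a.coord z).1 p₁ * (h z).toNNReal : ℝ≥0) : ℝ)
      rw [hz, NNReal.coe_mul, Real.coe_toNNReal _ hz'.le]
      rfl
    rw [e₂, ofMul_mul, map_add, α.2 ⟨_, hmem⟩ (Real.toNNReal_pos.2 h0), add_zero]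
    rfl
  · obtain ⟨h, -, h0, H'⟩ := hp'
    have hfr := ((hac.frequently_supp_eq_top hxa).and_eventually
      ((GChart.HasExp.eventually_pos_iff hp).and (H.and (Filter.Germ.coe_eq.1 e')))).exists
    obtain ⟨z, ⟨-, hz⟩, hz1, hz2, hz3⟩ := hfr
    rw [hz3, hz2, hz] at hz1
    exact absurd (hz1.2 p.2) (lt_irrefl _)

end GSpace.IsMixed

/-! ### Torsion-free quotients -/

theorem IsTorsionFreeMonoid.exists_add_eq {M : Type*} [AddCommMonoid M]
    (hM : IsTorsionFreeMonoid M) {x y : M} {n : ℕ} (hn : n ≠ 0) (h : n • x = n • y) :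
    ∃ c, c + x = c + y := by
  have h1 : n • Algebra.GrothendieckAddGroup.of x = n • Algebra.GrothendieckAddGroup.of y := by
    rw [← map_nsmul, ← map_nsmul, h]
  have h2 := hM.nsmul_right_injective hn h1
  obtain ⟨c, hc⟩ := (AddLocalization.addMonoidOf (⊤ : AddSubmonoid M)).eq_iff_exists.1 h2
  exact ⟨c, hc⟩

theorem isTorsionFreeMonoid_of_forall {M : Type*} [AddCommMonoid M]
    (hM : ∀ (x y : M) (n : ℕ), n ≠ 0 → n • x = n • y → ∃ c, c + x = c + y) :
    IsTorsionFreeMonoid M := by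
  refine ⟨fun n hn s t hst => ?_⟩
  obtain ⟨a, b, hab⟩ := exists_add_of_eq_of s
  obtain ⟨a', b', hab'⟩ := exists_add_of_eq_of t
  have hst' : n • s = n • t := hst
  have h1 : Algebra.GrothendieckAddGroup.of (n • (a + b')) =
      Algebra.GrothendieckAddGroup.of (n • (a' + b)) := by
    simp only [map_nsmul, map_add, ← hab, ← hab', nsmul_add, hst']
    abel
  obtain ⟨c, hc⟩ := (AddLocalization.addMonoidOf (⊤ : AddSubmonoid M)).eq_iff_exists.1 h1
  have hc' : (c : M) + n • (a + b') = c + n • (a' + b) := hc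
  obtain ⟨m, rfl⟩ := Nat.exists_eq_succ_of_ne_zero hn
  -- Equality holds only after adding `c`. Putting `c` into both elements makes their multiples by
  -- `m + 1` literally equal, since `c` then occurs `m + 1 ≥ 1` times.
  obtain ⟨d, hd⟩ := hM (c + (a + b')) (c + (a' + b)) (m + 1) hn (by
    rw [nsmul_add (c : M), nsmul_add (c : M), succ_nsmul (c : M), add_assoc, add_assoc, hc'])
  have h2 : Algebra.GrothendieckAddGroup.of (a + b') = Algebra.GrothendieckAddGroup.of (a' + b) := by
    have := congrArg Algebra.GrothendieckAddGroup.of hd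
    rw [map_add, map_add, map_add _ d, map_add _ (c : M)] at this
    exact add_left_cancel (add_left_cancel this)
  rw [map_add, map_add, ← hab, ← hab'] at h2
  have h3 : s + (Algebra.GrothendieckAddGroup.of b + Algebra.GrothendieckAddGroup.of b') =
      t + (Algebra.GrothendieckAddGroup.of b + Algebra.GrothendieckAddGroup.of b') := by
    rw [← add_assoc, h2]
    abel
  exact add_right_cancel h3

/-! ### Interior immersions generate the groups of exponents -/

section Generate

variable {X : GSpace.{u}} {Y : GSpace.{v}} {f : X → Y}

/-- Duality of lattices: a homomorphism whose dual is injective with torsion-free cokernel is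
surjective. Were the generated subgroup proper, some functional `v` on `a.P` would be divisible by
some `l ≥ 2` on it but not on all of `a.P`. Then `w = (v ∘ φ) / l` is an integral functional whose
multiple by `l` comes from `X`. By torsion-freeness `w` itself comes from `X`, and by injectivity
`v` is divisible by `l`, a contradiction. As `M̃` contains only `ℕ`-valued functionals, all of this
is done with differences. -/
theorem IsInteriorImmersion.mem_closure (hX : X.IsMixed) (hY : Y.IsMixed)
    (hf : IsInteriorImmersion f) {a : GChart X} (ha : a ∈ X.atlas) {b : GChart Y}
    (hb : b ∈ Y.atlas) {x : X} (hxa : x ∈ a.dom) (hxb : f x ∈ b.dom) {φ : b.P → a.P}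
    (hφ : ∀ q, a.HasExp x (fun z => (b.coord (f z)).1 q) (φ q)) {p : Fin a.k → ℤ}
    (hp : p ∈ a.P) : p ∈ AddSubgroup.closure
      (((a.coord x).supp : Set (Fin a.k → ℤ)) ∪ Set.range fun q => (φ q : Fin a.k → ℤ)) := by
  by_contra hcon
  have hac := hX.isChart a ha
  have hbc := hY.isChart b hb
  obtain ⟨l, v, hl, hv0, hvH, p₀, hp₀⟩ := (a.coord x).isFace_supp.exists_hom_dvd hac.weaklyToric _
    (fun f hf => AddSubgroup.subset_closure (Or.inl hf)) ⟨p, hp, hcon⟩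
  -- exponents are additive, as far as functionals vanishing on the support can tell
  have hadd : ∀ (w : a.P →+ ℝ),
      (∀ q : a.P, (q : Fin a.k → ℤ) ∈ (a.coord x).supp → w q = 0) →
      ∀ q q', w (φ (q + q')) = w (φ q) + w (φ q') := by
    intro w hw q q'
    rw [← map_add]
    refine GChart.HasExp.unique hac hxa (hφ (q + q')) ?_ w hw
    exact ((hφ q).mul (hφ q')).congr (Filter.Eventually.of_forall fun z =>
      (b.coord (f z)).apply_add q q')
  have hφ0 : ∀ q : b.P, (q : Fin b.k → ℤ) ∈ (b.coord (f x)).supp →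
      (φ q : Fin a.k → ℤ) ∈ (a.coord x).supp := fun q hq => by
    rw [(hφ q).mem_supp_iff, Model.pos_iff_mem_supp]; exact hq
  -- write functionals as differences of natural number valued ones
  have hsplit : ∀ {k : ℕ} {P F : AddSubmonoid (Fin k → ℤ)}, IsFace F P → P.FG → ∀ v : P →+ ℤ,
      (∀ q : P, (q : Fin k → ℤ) ∈ F → v q = 0) → ∃ v₁ v₂ : P →+ ℕ,
      (∀ q : P, (q : Fin k → ℤ) ∈ F → v₁ q = 0) ∧ (∀ q : P, (q : Fin k → ℤ) ∈ F → v₂ q = 0) ∧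
      ∀ q, v q = v₁ q - v₂ q := by
    intro k P F hF hP v hv
    obtain ⟨u, hu0, hu⟩ := hF.exists_functional hP
    obtain ⟨C, hC⟩ := IsFace.exists_bound hP hu0 hu ((Int.castAddHom ℝ).comp v)
      fun p hp => by simp [hv p hp]
    have hC' : ∀ p : P, |v p| ≤ C * u p := fun p => by
      have := hC p
      simp only [AddMonoidHom.comp_apply, Int.coe_castAddHom] at this
      exact_mod_cast this
    let w : P →+ ℤ := C • (u.comp P.subtype)
    have hw : ∀ p : P, w p = C * u p := fun p => by simp [w]
    have toNat : ∀ (w : P →+ ℤ), (∀ p, 0 ≤ w p) → ∃ w' : P →+ ℕ, ∀ p, (w' p : ℤ) = w p := by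
      intro w hw
      refine ⟨natHom (fun p => (w p).toNat) fun p q => ?_, fun p =>
        Int.toNat_of_nonneg (hw p)⟩
      rw [map_add, Int.toNat_add (hw p) (hw q)]
    obtain ⟨w₁, h1⟩ := toNat (v + w) fun p => by
      have := hC' p
      have := neg_abs_le (v p)
      rw [AddMonoidHom.add_apply, hw]
      linarith
    obtain ⟨w₂, h2⟩ := toNat w fun p => by
      rw [hw]; exact mul_nonneg (by omega) (hu0 p p.2)
    have hwF : ∀ q : P, (q : Fin k → ℤ) ∈ F → w q = 0 := fun q hq => by
      rw [hw, (hu q q.2).2 hq, mul_zero]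
    refine ⟨w₁, w₂, fun q hq => ?_, fun q hq => ?_, fun q => ?_⟩
    · have := h1 q
      rw [AddMonoidHom.add_apply, hv q hq, hwF q hq] at this
      omega
    · have := h2 q
      rw [hwF q hq] at this
      omega
    · rw [h1, h2, AddMonoidHom.add_apply]
      ring
  have hdvd : ∀ q, (l : ℤ) ∣ v (φ q) := fun q =>
    hvH _ (AddSubgroup.subset_closure (Or.inr ⟨q, rfl⟩))
  -- the functional `w = (v ∘ φ) / l`
  have hvadd : ∀ q q', v (φ (q + q')) = v (φ q) + v (φ q') := by
    intro q q'
    have := hadd ((Int.castAddHom ℝ).comp v) (fun q hq => by simp [hv0 q hq]) q q'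
    simp only [AddMonoidHom.comp_apply, Int.coe_castAddHom] at this
    exact_mod_cast this
  let w : b.P →+ ℤ := AddMonoidHom.mk' (fun q => v (φ q) / l) fun q q' => by
    rw [hvadd, Int.add_ediv_of_dvd_left (hdvd q)]
  have hw : ∀ q, v (φ q) = l * w q := fun q => (Int.mul_ediv_cancel' (hdvd q)).symm
  have hw0 : ∀ q : b.P, (q : Fin b.k → ℤ) ∈ (b.coord (f x)).supp → w q = 0 := fun q hq => by
    change v (φ q) / l = 0
    rw [hv0 _ (hφ0 q hq), Int.zero_ediv]
  obtain ⟨v₁, v₂, hv₁, hv₂, hv₁₂⟩ := hsplit (a.coord x).isFace_supp hac.weaklyToric.fg v hv0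
  obtain ⟨w₁, w₂, hw₁, hw₂, hw₁₂⟩ := hsplit (b.coord (f x)).isFace_supp hbc.weaklyToric.fg w hw0
  obtain ⟨α₁, hα₁⟩ := hX.exists_mTilde ha hxa v₁ hv₁
  obtain ⟨α₂, hα₂⟩ := hX.exists_mTilde ha hxa v₂ hv₂
  obtain ⟨β₁, hβ₁⟩ := hY.exists_mTilde hb hxb w₁ hw₁
  obtain ⟨β₂, hβ₂⟩ := hY.exists_mTilde hb hxb w₂ hw₂
  have hfα : ∀ (α : X.MTilde x) (v : a.P →+ ℕ), (∀ (c : X → ℝ≥0) (hc : (c : Filter.Germ (𝓝 x) ℝ≥0) ∈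
      X.interiorGerms x) (p : a.P), a.HasExp x c p → α.1 (Additive.ofMul ⟨c, hc⟩) = v p) →
      ∀ (c : Y → ℝ≥0) (hc : (c : Filter.Germ (𝓝 (f x)) ℝ≥0) ∈ Y.interiorGerms (f x)) (q : b.P),
      b.HasExp (f x) c q → (mTildeMap f x α).1 (Additive.ofMul ⟨c, hc⟩) = v (φ q) := by
    intro α v hα c hc q hq
    obtain ⟨hc', e⟩ := mTildeMap_apply hX hY hf.isInterior α hc
    rw [e]
    exact hα _ _ _ (hq.comp hf.isInterior.1.1.continuousAt (hφ q))
  let N := AddMonoidHom.mrange (mTildeMap f x)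
  have hl0 : l ≠ 0 := by omega
  -- The equation `l w = v ∘ φ`, with negative parts moved across, becomes an identity modulo the
  -- image of `M̃`.
  have hsmul : l • ((β₁ : Y.MTilde (f x)) : (quotientCon N).Quotient) =
      l • ((β₂ : Y.MTilde (f x)) : (quotientCon N).Quotient) := by
    change ((l • β₁ : Y.MTilde (f x)) : (quotientCon N).Quotient) =
      ((l • β₂ : Y.MTilde (f x)) : (quotientCon N).Quotient)
    rw [AddCon.eq]
    refine ⟨mTildeMap f x α₂, ⟨α₂, rfl⟩, mTildeMap f x α₁, ⟨α₁, rfl⟩, ?_⟩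
    refine hY.mTilde_ext hb hxb fun c hc q hq => ?_
    change l • β₁.1 _ + (mTildeMap f x α₂).1 _ = l • β₂.1 _ + (mTildeMap f x α₁).1 _
    rw [hfα α₂ v₂ hα₂ c hc q hq, hfα α₁ v₁ hα₁ c hc q hq, hβ₁ c hc q hq, hβ₂ c hc q hq]
    have h1 := hw q
    rw [hv₁₂, hw₁₂] at h1
    zify
    simp only [smul_eq_mul, Nat.cast_mul]
    linarith
  obtain ⟨γ, hγ⟩ := (hf.torsionFree x).exists_add_eq hl0 hsmul
  obtain ⟨γ, rfl⟩ := AddCon.mk'_surjective γ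
  change ((γ + β₁ : Y.MTilde (f x)) : (quotientCon N).Quotient) =
    ((γ + β₂ : Y.MTilde (f x)) : (quotientCon N).Quotient) at hγ
  rw [AddCon.eq] at hγ
  obtain ⟨_, ⟨δ, rfl⟩, _, ⟨δ', rfl⟩, hγ⟩ := hγ
  obtain ⟨d, hd0, hd⟩ := hX.exists_functional_of_mTilde ha hxa δ
  obtain ⟨d', hd0', hd'⟩ := hX.exists_functional_of_mTilde ha hxa δ'
  have hE := hf.mTildeMap_injective x
  have hval : ∀ q, w q = d' (φ q) - d (φ q) := by
    intro q
    have hcq := hY.coord_mem_interiorGerms hb hxb q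
    have hq := GChart.HasExp.refl b (f x) q
    have h1 := DFunLike.congr_fun (congrArg Subtype.val hγ) (Additive.ofMul ⟨_, hcq⟩)
    change γ.1 _ + β₁.1 _ + (mTildeMap f x δ).1 _ = γ.1 _ + β₂.1 _ + (mTildeMap f x δ').1 _ at h1
    rw [hfα δ d hd _ hcq q hq, hfα δ' d' hd' _ hcq q hq, hβ₁ _ hcq q hq, hβ₂ _ hcq q hq] at h1
    rw [hw₁₂]
    omega
  -- Injectivity turns `v ∘ φ = l (d' - d) ∘ φ` into `v = l (d' - d)`, contradicting the choice of
  -- `p₀`.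
  have hinj : α₁ + l • δ = α₂ + l • δ' := by
    apply hE
    refine hY.mTilde_ext hb hxb fun c hc q hq => ?_
    rw [map_add, map_add, map_nsmul, map_nsmul]
    change (mTildeMap f x α₁).1 _ + l • (mTildeMap f x δ).1 _ =
      (mTildeMap f x α₂).1 _ + l • (mTildeMap f x δ').1 _
    rw [hfα α₁ v₁ hα₁ c hc q hq, hfα α₂ v₂ hα₂ c hc q hq, hfα δ d hd c hc q hq,
      hfα δ' d' hd' c hc q hq]
    have h1 := hw q
    rw [hv₁₂, hval] at h1
    zify
    simp only [smul_eq_mul, Nat.cast_mul]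
    linarith
  apply hp₀
  have hcp := hX.coord_mem_interiorGerms ha hxa p₀
  have hp := GChart.HasExp.refl a x p₀
  have h1 := DFunLike.congr_fun (congrArg Subtype.val hinj) (Additive.ofMul ⟨_, hcp⟩)
  change α₁.1 _ + l • δ.1 _ = α₂.1 _ + l • δ'.1 _ at h1
  rw [hα₁ _ hcp _ hp, hα₂ _ hcp _ hp, hd _ hcp _ hp, hd' _ hcp _ hp] at h1
  refine ⟨d' p₀ - d p₀, ?_⟩
  rw [hv₁₂]
  zify at h1
  simp only [smul_eq_mul, Nat.cast_mul] at h1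
  linarith

end Generate

/-! ### Derivatives along curves in strata -/

namespace GChart

variable {X : Type u} [TopologicalSpace X] {a : GChart X} {x : X}

theorem hasDerivAt_comp_curve {N : ℕ} {e : Fin N → a.P} {O : Set (Fin N → ℝ)}
    {g : (Fin N → ℝ) → ℝ} (hO : IsOpen O) (hg : ContDiffOn ℝ ∞ g O)
    (hxO : (fun i => a.lam (e i) x) ∈ O) {h : X → ℝ}
    (H : ∀ᶠ z in 𝓝 x, h z = g fun i => a.lam (e i) z) {γ : ℝ → X} (hγ0 : γ 0 = x)
    (hγ : Filter.Tendsto γ (𝓝 0) (𝓝 x)) {δ : a.P → ℝ}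
    (hδ : ∀ p, HasDerivAt (fun t => a.lam p (γ t)) (δ p) 0) :
    HasDerivAt (fun t => h (γ t)) (fderiv ℝ g (fun i => a.lam (e i) x) fun i => δ (e i)) 0 := by
  have hd : DifferentiableAt ℝ g (fun i => a.lam (e i) x) :=
    (hg.contDiffAt (hO.mem_nhds hxO)).differentiableAt (by simp)
  have h1 : HasDerivAt (fun t => fun i => a.lam (e i) (γ t)) (fun i => δ (e i)) 0 :=
    hasDerivAt_pi.2 fun i => hδ (e i)
  have hd' : HasFDerivAt g (fderiv ℝ g fun i => a.lam (e i) x) (fun i => a.lam (e i) (γ 0)) := by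
    rw [hγ0]; exact hd.hasFDerivAt
  refine (hd'.comp_hasDerivAt (0 : ℝ) h1).congr_of_eventuallyEq ?_
  filter_upwards [hγ.eventually H] with t ht
  exact ht

/-- The chain rule, with a linear form `L` that does not depend on the curve: only the first-order
behaviour of the coordinates along the curve enters. -/
theorem RealAt.exists_hasDerivAt {h : X → ℝ} (hh : a.RealAt x h) :
    ∃ (n : ℕ) (r : Fin n → a.P) (L : (Fin n → ℝ) →L[ℝ] ℝ), ∀ (γ : ℝ → X) (δ : a.P → ℝ),
      γ 0 = x → Filter.Tendsto γ (𝓝 0) (𝓝 x) →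
      (∀ p, HasDerivAt (fun t => a.lam p (γ t)) (δ p) 0) →
      HasDerivAt (fun t => h (γ t)) (L fun i => δ (r i)) 0 := by
  obtain ⟨n, r, O, g, hO, hg, hxO, H⟩ := hh
  exact ⟨n, r, _, fun γ δ h0 h1 h2 => hasDerivAt_comp_curve hO hg hxO H h0 h1 h2⟩

section Curve

variable [Nonempty X]

/-- The line through `x` in direction `v` inside the stratum of `x`. -/
noncomputable def line (a : GChart X) (x : X) (v : (a.coord x).supp →+ ℝ) (t : ℝ) : X :=
  Function.invFunOn a.coord a.dom ((a.coord x).shift v t)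

theorem line_zero (ha : a.IsChart) (hx : x ∈ a.dom) (v : (a.coord x).supp →+ ℝ) :
    a.line x v 0 = x := by
  rw [line, Model.shift_zero]
  exact ha.injOn.leftInvOn_invFunOn hx

theorem tendsto_line (ha : a.IsChart) (hx : x ∈ a.dom) (v : (a.coord x).supp →+ ℝ) :
    Filter.Tendsto (a.line x v) (𝓝 0) (𝓝 x) :=
  (ha.eventually_inv hx).1.comp ((a.coord x).tendsto_shift v)

theorem coord_line (ha : a.IsChart) (hx : x ∈ a.dom) (v : (a.coord x).supp →+ ℝ) :
    ∀ᶠ t in 𝓝 0, a.coord (a.line x v t) = (a.coord x).shift v t :=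
  (((a.coord x).tendsto_shift v).eventually (ha.eventually_inv hx).2).mono fun _ ht => ht.2

open Classical in
/-- The derivative of `λ_p` in the direction `v`. -/
noncomputable def dlam (a : GChart X) (x : X) (v : (a.coord x).supp →+ ℝ) (p : a.P) : ℝ :=
  if h : (p : Fin a.k → ℤ) ∈ (a.coord x).supp then a.lam p x * v ⟨p, h⟩ else 0

theorem hasDerivAt_lam_line (ha : a.IsChart) (hx : x ∈ a.dom) (v : (a.coord x).supp →+ ℝ)
    (p : a.P) : HasDerivAt (fun t => a.lam p (a.line x v t)) (a.dlam x v p) 0 := by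
  by_cases hp : (p : Fin a.k → ℤ) ∈ (a.coord x).supp
  · rw [dlam, dif_pos hp]
    have h1 : HasDerivAt (fun t : ℝ => a.lam p x * Real.exp (t * v ⟨p, hp⟩))
        (a.lam p x * (Real.exp (0 * v ⟨p, hp⟩) * (1 * v ⟨p, hp⟩))) 0 :=
      ((hasDerivAt_mul_const (v ⟨p, hp⟩)).exp.const_mul _).congr_deriv (by simp)
    have h2 := h1.congr_of_eventuallyEq (f₁ := fun t => a.lam p (a.line x v t)) (by
      filter_upwards [coord_line ha hx v] with t ht
      rw [lam, ht, Model.shift_apply _ _ _ hp]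
      rfl)
    simpa using h2
  · rw [dlam, dif_neg hp]
    refine (hasDerivAt_const (0 : ℝ) (0 : ℝ)).congr_of_eventuallyEq ?_
    filter_upwards [coord_line ha hx v] with t ht
    rw [lam, ht, Model.shift_apply_of_notMem _ _ _ hp, NNReal.coe_zero]

end Curve

end GChart

/-! ### Compositions: derivatives along strata, `M̃`, and interior immersions -/

section Composition

variable {X : GSpace.{u}} {Y : GSpace.{v}} {f : X → Y}

/-- The coordinate functions along the image of a line are determined to first order by the
derivative of `f` along the stratum. -/
theorem hasDerivAt_lam_map_line {x : X} [Nonempty X] {a : GChart X} {b : GChart Y}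
    (ha : a.IsChart) (hxa : x ∈ a.dom)
    (hf : GChart.MapAt a b f x) (v : (a.coord x).supp →+ ℝ) (q : b.P) :
    (∀ hq : (q : Fin b.k → ℤ) ∈ (b.coord (f x)).supp, HasDerivAt
      (fun t => Real.log (b.lam q (f (a.line x v t)))) (stratumDeriv f x a b v ⟨q, hq⟩) 0 ∧
      HasDerivAt (fun t => b.lam q (f (a.line x v t)))
        (b.lam q (f x) * stratumDeriv f x a b v ⟨q, hq⟩) 0) ∧
    ((q : Fin b.k → ℤ) ∉ (b.coord (f x)).supp →
      HasDerivAt (fun t => b.lam q (f (a.line x v t))) 0 0) := by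
  have hl0 := GChart.line_zero ha hxa v
  have hlt := GChart.tendsto_line ha hxa v
  constructor
  · intro hq
    obtain ⟨n, r, L, hL⟩ := ((hf.nonnegAt q).realAt ha).exists_hasDerivAt
    have h1 := hL _ _ hl0 hlt fun p => GChart.hasDerivAt_lam_line ha hxa v p
    have hpos : 0 < b.lam q (f x) := GChart.lam_pos_iff.2 hq
    have h2 : HasDerivAt (fun t => b.lam q (f (a.line x v t))) _ 0 := h1
    have h3 := h2.log (by rw [hl0]; exact hpos.ne')
    have h4 := h3.deriv
    have h5 : stratumDeriv f x a b v ⟨q, hq⟩ = _ := h4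
    refine ⟨h5 ▸ h3, ?_⟩
    rw [h5, hl0, mul_div_cancel₀ _ hpos.ne']
    exact h2
  · intro hq
    refine (hasDerivAt_const (0 : ℝ) (0 : ℝ)).congr_of_eventuallyEq ?_
    have h0 : b.lam q (f x) = 0 := GChart.lam_eq_zero_iff.2 hq
    rcases hf.nonnegAt q with ⟨p, h, hh, hpos, H⟩ | H
    -- Since `λ_q` vanishes at `f x`, the factor `λ_p` vanishes at `x`, hence along the whole line,
    -- which stays in the stratum of `x`.
    · have hp : (p : Fin a.k → ℤ) ∉ (a.coord x).supp := by
        rw [← GChart.lam_eq_zero_iff]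
        have := H.self_of_nhds
        have h0' : (((b.coord (f x)).1 q : ℝ≥0) : ℝ) = 0 := h0
        rw [h0'] at this
        exact (mul_eq_zero.1 this.symm).resolve_right hpos.ne'
      filter_upwards [hlt.eventually H, GChart.coord_line ha hxa v] with t h1 h2
      rw [GChart.lam, h1, GChart.lam, h2, Model.shift_apply_of_notMem _ _ _ hp, NNReal.coe_zero,
        zero_mul]
    · filter_upwards [hlt.eventually H] with t h1
      rw [GChart.lam, h1, NNReal.coe_zero]

variable {Z : GSpace.{w}} {g : Y → Z} (hX : X.IsMixed) (hY : Y.IsMixed) (hZ : Z.IsMixed)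
include hX hY hZ

/-- The derivative of `log λ_q ∘ g ∘ f` along a line is a fixed linear form in the derivatives of
the `λ_p ∘ f`. These are determined by `stratumDeriv f`: they are multiples of its components for
`p` in the support of `f x`, and zero for all other `p`. -/
theorem stratumDeriv_injective_of_comp (hf : IsSmooth f) (hg : IsSmooth g)
    {x : X} {a : GChart X} (ha : a ∈ X.atlas) (hxa : x ∈ a.dom) {b : GChart Y} (hb : b ∈ Y.atlas)
    (hxb : f x ∈ b.dom) {c : GChart Z} (hc : c ∈ Z.atlas) (hxc : g (f x) ∈ c.dom)
    (hinj : Function.Injective (stratumDeriv (g ∘ f) x a c)) :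
    Function.Injective (stratumDeriv f x a b) := by
  have : Nonempty X := ⟨x⟩
  intro v v' hvv
  apply hinj
  funext q
  have hac := hX.isChart a ha
  have hbc := hY.isChart b hb
  have hfm := hf.mapAt hX hY ha hb hxa hxb
  have hgm := hg.mapAt hY hZ hb hc hxb hxc
  have hq0 : c.lam ⟨q.1, q.2.1⟩ (g (f x)) ≠ 0 := (GChart.lam_pos_iff.2 q.2).ne'
  obtain ⟨n, r, L, hL⟩ :=
    (((hgm.nonnegAt ⟨q.1, q.2.1⟩).realAt hbc).log hbc hq0).exists_hasDerivAt
  have key : ∀ v : (a.coord x).supp →+ ℝ, ∀ δ : b.P → ℝ,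
      (∀ p, HasDerivAt (fun t => b.lam p (f (a.line x v t))) (δ p) 0) →
      stratumDeriv (g ∘ f) x a c v q = L fun i => δ (r i) := by
    intro v δ hδ
    exact (hL (fun t => f (a.line x v t)) δ (by rw [GChart.line_zero hac hxa])
      (hfm.continuousAt.tendsto.comp (GChart.tendsto_line hac hxa v)) hδ).deriv
  classical
  have hδ : ∀ v : (a.coord x).supp →+ ℝ, ∀ p : b.P,
      HasDerivAt (fun t => b.lam p (f (a.line x v t)))
        (if hq : (p : Fin b.k → ℤ) ∈ (b.coord (f x)).supp then
          b.lam p (f x) * stratumDeriv f x a b v ⟨p, hq⟩ else 0) 0 := by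
    intro v p
    obtain ⟨h1, h2⟩ := hasDerivAt_lam_map_line hac hxa hfm v p
    by_cases hp : (p : Fin b.k → ℤ) ∈ (b.coord (f x)).supp
    · rw [dif_pos hp]
      exact (h1 hp).2
    · rw [dif_neg hp]
      exact h2 hp
  rw [key v _ (hδ v), key v' _ (hδ v'), hvv]

theorem mTildeMap_comp (hf : IsInterior f) (hg : IsInterior g)
    (hgf : IsInterior (g ∘ f)) {x : X} (α : X.MTilde x) :
    mTildeMap (g ∘ f) x α = mTildeMap g (f x) (mTildeMap f x α) := by
  obtain ⟨c, hc, hxc⟩ := hZ.cover (g (f x))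
  refine hZ.mTilde_ext (x := g (f x)) hc hxc fun d hd q hq => ?_
  obtain ⟨h1, e1⟩ := mTildeMap_apply hX hZ hgf α hd
  obtain ⟨h2, e2⟩ := mTildeMap_apply hY hZ hg (mTildeMap f x α) hd
  obtain ⟨h3, e3⟩ := mTildeMap_apply hX hY hf α h2
  exact e1.trans (e2.trans e3).symm

/-- If `g ∘ f` is an interior immersion, so is `f`. -/
theorem IsInteriorImmersion.of_comp (hf : IsInterior f) (hg : IsInterior g)
    (hginj : ∀ y, Function.Injective (mTildeMap g y)) (hgf : IsInteriorImmersion (g ∘ f)) :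
    IsInteriorImmersion f where
  isInterior := hf
  deriv_injective x a ha hxa b hb hxb := by
    obtain ⟨c, hc, hxc⟩ := hZ.cover (g (f x))
    exact stratumDeriv_injective_of_comp hX hY hZ hf.1 hg.1 ha hxa hb hxb hc hxc
      (hgf.deriv_injective x a ha hxa c hc hxc)
  mTildeMap_injective x α β h := by
    apply hgf.mTildeMap_injective x
    rw [mTildeMap_comp hX hY hZ hf hg hgf.isInterior, mTildeMap_comp hX hY hZ hf hg hgf.isInterior,
      h]
  torsionFree x := by
    have hcomp := fun α => mTildeMap_comp hX hY hZ hf hg hgf.isInterior (x := x) α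
    apply isTorsionFreeMonoid_of_forall
    intro y y' n hn h
    obtain ⟨y, rfl⟩ := AddCon.mk'_surjective y
    obtain ⟨y', rfl⟩ := AddCon.mk'_surjective y'
    change ((n • y : Y.MTilde (f x)) : (quotientCon (AddMonoidHom.mrange (mTildeMap f x))).Quotient)
      = ((n • y' : Y.MTilde (f x)) : (quotientCon (AddMonoidHom.mrange (mTildeMap f x))).Quotient)
      at h
    rw [AddCon.eq] at h
    obtain ⟨_, ⟨δ, rfl⟩, _, ⟨δ', rfl⟩, h⟩ := h
    -- The torsion relation is pushed to `Z`, where the quotient for `g ∘ f` is torsion-free, and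
    -- the resulting relation is pulled back by injectivity of `M̃ g`.
    have h' := congrArg (mTildeMap g (f x)) h
    rw [map_add, map_add, ← hcomp, ← hcomp, map_nsmul, map_nsmul] at h'
    let N : AddSubmonoid (Z.MTilde (g (f x))) := AddMonoidHom.mrange (mTildeMap (g ∘ f) x)
    have h2 : n • ((mTildeMap g (f x) y : Z.MTilde (g (f x))) : (quotientCon N).Quotient) =
        n • ((mTildeMap g (f x) y' : Z.MTilde (g (f x))) : (quotientCon N).Quotient) := by
      change ((n • _ : Z.MTilde (g (f x))) : (quotientCon N).Quotient) =
        ((n • _ : Z.MTilde (g (f x))) : (quotientCon N).Quotient)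
      rw [AddCon.eq]
      exact ⟨_, ⟨δ, rfl⟩, _, ⟨δ', rfl⟩, h'⟩
    obtain ⟨c, hc⟩ := (hgf.torsionFree x).exists_add_eq hn h2
    obtain ⟨c₀, hc₀⟩ := AddCon.mk'_surjective c
    let c : Z.MTilde (g (f x)) := c₀
    rw [← hc₀] at hc
    change ((c + mTildeMap g (f x) y : Z.MTilde (g (f x))) : (quotientCon N).Quotient) =
        ((c + mTildeMap g (f x) y' : Z.MTilde (g (f x))) : (quotientCon N).Quotient) at hc
    rw [AddCon.eq] at hc
    obtain ⟨ε, ⟨δ, hε⟩, ε', ⟨δ', hε'⟩, h3⟩ := hc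
    have hε₁ : ε = mTildeMap g (f x) (mTildeMap f x δ) := hε.symm.trans (hcomp δ)
    have hε₁' : ε' = mTildeMap g (f x) (mTildeMap f x δ') := hε'.symm.trans (hcomp δ')
    rw [hε₁, hε₁', add_assoc, add_assoc, ← map_add, ← map_add] at h3
    -- The auxiliary element `c` need not come from `Y`, but it cancels because elements of `M̃`
    -- take values in `ℕ`.
    have h4 : mTildeMap g (f x) (y + mTildeMap f x δ) =
        mTildeMap g (f x) (y' + mTildeMap f x δ') := by
      refine Subtype.ext (AddMonoidHom.ext fun b => ?_)
      have := DFunLike.congr_fun (congrArg Subtype.val h3) b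
      exact add_left_cancel (a := c.1 b) this
    have h5 := hginj (f x) h4
    refine ⟨0, ?_⟩
    rw [zero_add, zero_add]
    change (y : (quotientCon (AddMonoidHom.mrange (mTildeMap f x))).Quotient) =
      (y' : (quotientCon (AddMonoidHom.mrange (mTildeMap f x))).Quotient)
    rw [AddCon.eq]
    exact ⟨_, ⟨δ, rfl⟩, _, ⟨δ', rfl⟩, h5⟩

end Composition

/-! ### Strata in charts -/

theorem Model.sum_mem_supp_iff {k : ℕ} {P : AddSubmonoid (Fin k → ℤ)} (x : Model P) {N : ℕ}
    (e : Fin N → P) (m : Fin N → ℕ) : ((∑ i, m i • e i : P) : Fin k → ℤ) ∈ x.supp ↔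
      ∀ i, m i ≠ 0 → (e i : Fin k → ℤ) ∈ x.supp := by
  rw [← Model.pos_iff_mem_supp, Model.apply_sum, pos_iff_ne_zero, Finset.prod_ne_zero_iff]
  refine forall_congr' fun i => ?_
  rw [← Model.pos_iff_mem_supp, pos_iff_ne_zero]
  constructor
  · intro h hm
    exact (pow_ne_zero_iff hm).1 (h (Finset.mem_univ i))
  · intro h _
    by_cases hm : m i = 0
    · rw [hm, pow_zero]; exact one_ne_zero
    · exact pow_ne_zero _ (h hm)

/-- A smooth map sends strata to strata near a point, preserving inclusions of faces. -/
theorem GChart.MapAt.exists_nhds_supp_le {X : Type u} {Y : Type v} [TopologicalSpace X]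
    [TopologicalSpace Y] {a : GChart X} {b : GChart Y} {f : X → Y} {x : X}
    (hf : GChart.MapAt a b f x) (ha : a.IsChart) (hb : b.IsChart) (hx : x ∈ a.dom) :
    ∃ V ∈ 𝓝 x, ∀ y ∈ V, ∀ y' ∈ V, (a.coord y).supp ≤ (a.coord y').supp →
      (b.coord (f y)).supp ≤ (b.coord (f y')).supp := by
  obtain ⟨N, e, he⟩ := exists_generators hb.weaklyToric.fg
  have key : ∀ i, ∃ V ∈ 𝓝 x, ∀ y ∈ V, ∀ y' ∈ V, (a.coord y).supp ≤ (a.coord y').supp →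
      (e i : Fin b.k → ℤ) ∈ (b.coord (f y)).supp → (e i : Fin b.k → ℤ) ∈ (b.coord (f y')).supp := by
    intro i
    rcases hf.nonnegAt (e i) with ⟨p, h, hh, h0, H⟩ | H
    · have hE : a.HasExp x (fun z => (b.coord (f z)).1 (e i)) p :=
        ⟨h, hh.continuousAt ha hx, h0, H⟩
      refine ⟨_, hE.eventually_pos_iff, fun y hy y' hy' hle hye => ?_⟩
      rw [← Model.pos_iff_mem_supp] at hye ⊢
      exact hy'.2 (hle (hy.1 hye))
    · refine ⟨_, H, fun y hy y' _ _ hye => ?_⟩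
      rw [← Model.pos_iff_mem_supp] at hye
      exact absurd hy hye.ne'
  choose V hV hVe using key
  refine ⟨⋂ i, V i, Filter.iInter_mem.2 hV, fun y hy y' hy' hle q hq => ?_⟩
  rw [Set.mem_iInter] at hy hy'
  obtain ⟨m, hm⟩ := he ⟨q, (b.coord (f y)).isFace_supp.le hq⟩
  have hq' : q = ((∑ i, m i • e i : b.P) : Fin b.k → ℤ) := congrArg Subtype.val hm
  rw [hq', Model.sum_mem_supp_iff] at hq ⊢
  exact fun i hi => hVe i y (hy i) y' (hy' i) hle (hq i hi)

theorem GChart.MapAt.exists_nhds_supp_eq {X : Type u} {Y : Type v} [TopologicalSpace X]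
    [TopologicalSpace Y] {a : GChart X} {b : GChart Y} {f : X → Y} {x : X}
    (hf : GChart.MapAt a b f x) (ha : a.IsChart) (hb : b.IsChart) (hx : x ∈ a.dom) :
    ∃ V ∈ 𝓝 x, ∀ y ∈ V, ∀ y' ∈ V, (a.coord y).supp = (a.coord y').supp →
      (b.coord (f y)).supp = (b.coord (f y')).supp := by
  obtain ⟨V, hV, h⟩ := hf.exists_nhds_supp_le ha hb hx
  exact ⟨V, hV, fun y hy y' hy' e => le_antisymm (h y hy y' hy' e.le) (h y' hy' y hy e.ge)⟩

/-! ### Local corner components as faces -/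

section LocalCorners

open TopologicalSpace

variable {X : GSpace.{u}}

theorem GChart.IsChart.exists_openNhdsOf {a : GChart X} (ha : a.IsChart) {x : X}
    (hx : x ∈ a.dom) {O : Set X} (hO : O ∈ 𝓝 x) :
    ∃ V : OpenNhdsOf x, (V : Set X) ⊆ O ∧ (V : Set X) ⊆ a.dom ∧
      ∀ F, IsPreconnected ((V : Set X) ∩ {z | (a.coord z).supp = F}) := by
  have : Nonempty X := ⟨x⟩
  obtain ⟨V', hV'o, hxV', hV', hVc⟩ := Model.exists_nhds_isPreconnected (a.coord x)
    (ha.image_mem_nhds hx (Filter.inter_mem hO (ha.dom_mem_nhds hx)))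
  have hinv : ∀ z ∈ a.dom, Function.invFunOn a.coord a.dom (a.coord z) = z := fun z hz =>
    ha.injOn.leftInvOn_invFunOn hz
  refine ⟨⟨⟨a.dom ∩ a.coord ⁻¹' V', ha.continuousOn.isOpen_inter_preimage ha.isOpen_dom hV'o⟩,
    ⟨hx, hxV'⟩⟩, ?_, fun z hz => hz.1, fun F => ?_⟩
  · rintro z ⟨hz, hzV⟩
    obtain ⟨z', ⟨hz'O, hz'⟩, e⟩ := hV' hzV
    rwa [← ha.injOn hz' hz e]
  · have : (a.dom ∩ a.coord ⁻¹' V') ∩ {z | (a.coord z).supp = F} =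
        Function.invFunOn a.coord a.dom '' (V' ∩ {y | y.supp = F}) := by
      ext z
      constructor
      · rintro ⟨⟨hz, hzV⟩, hzF⟩
        exact ⟨a.coord z, ⟨hzV, hzF⟩, hinv z hz⟩
      · rintro ⟨y, ⟨hyV, hyF⟩, rfl⟩
        obtain ⟨z, ⟨-, hz⟩, rfl⟩ := hV' hyV
        rw [hinv z hz]
        exact ⟨⟨hz, hyV⟩, hyF⟩
    change IsPreconnected ((a.dom ∩ a.coord ⁻¹' V') ∩ {z | (a.coord z).supp = F})
    rw [this]
    refine (hVc F).image _ fun y hy => ContinuousAt.continuousWithinAt ?_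
    obtain ⟨z, ⟨-, hz⟩, rfl⟩ := hV' hy.1
    rw [ContinuousAt, hinv z hz]
    exact (ha.eventually_inv hz).1

theorem GSpace.IsMixed.mem_stratum_iff (hX : X.IsMixed) {a : GChart X} (ha : a ∈ X.atlas) {x : X}
    (hx : x ∈ a.dom) {k : ℕ} : x ∈ X.stratum k ↔ rank a.P - rank (a.coord x).supp = k := by
  change X.depth x = k ↔ _
  rw [hX.depth_eq ha hx]
  rfl

/-- The face is constant on connected subsets of a stratum. -/
theorem GSpace.IsMixed.supp_eq_of_isPreconnected (hX : X.IsMixed) {a : GChart X}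
    (ha : a ∈ X.atlas) {S : Set X} (hS : IsPreconnected S) (hSa : S ⊆ a.dom) {k : ℕ}
    (hSk : S ⊆ X.stratum k) {y z : X} (hy : y ∈ S) (hz : z ∈ S) :
    (a.coord y).supp = (a.coord z).supp := by
  let : TopologicalSpace (AddSubmonoid (Fin a.k → ℤ)) := ⊥
  have : DiscreteTopology (AddSubmonoid (Fin a.k → ℤ)) := ⟨rfl⟩
  have hac := hX.isChart a ha
  -- The support is locally constant on `S`: near `w` it can only grow, as a face inside a face, and
  -- equal depth forces equal ranks.
  refine hS.constant (f := fun y => (a.coord y).supp) (fun w hw => ?_) hy hz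
  refine (continuousWithinAt_const (b := (a.coord w).supp)).congr_of_eventuallyEq ?_ rfl
  filter_upwards [nhdsWithin_le_nhds (hac.eventually_supp_le (hSa hw)), self_mem_nhdsWithin] with
    w' h1 h2
  have e1 := (hX.mem_stratum_iff ha (hSa hw)).1 (hSk hw)
  have e2 := (hX.mem_stratum_iff ha (hSa h2)).1 (hSk h2)
  have hf1 := (a.coord w).isFace_supp
  have hf2 := (a.coord w').isFace_supp
  have r1 := rank_mono hf1.le
  have r2 := rank_mono hf2.le
  exact ((hf1.of_le hf2 h1).eq_of_rank_le (hac.fg_of_isFace hf2) (by omega)).symm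

namespace LocalCorner

variable {x : X} (γ : LocalCorner X x)

theorem comp_subset (V : OpenNhdsOf x) : γ.comp V ⊆ (V : Set X) ∩ X.stratum γ.k := by
  obtain ⟨z, hz, e⟩ := γ.isComponent V
  rw [e]
  exact connectedComponentIn_subset _ _

theorem isPreconnected_comp (V : OpenNhdsOf x) : IsPreconnected (γ.comp V) := by
  obtain ⟨z, hz, e⟩ := γ.isComponent V
  rw [e]
  exact isPreconnected_connectedComponentIn

theorem subset_comp {V : OpenNhdsOf x} {S : Set X} (hS : IsPreconnected S)
    (hSV : S ⊆ (V : Set X) ∩ X.stratum γ.k) (hne : (S ∩ γ.comp V).Nonempty) : S ⊆ γ.comp V := by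
  obtain ⟨z, hz, e⟩ := γ.isComponent V
  obtain ⟨w, hwS, hw⟩ := hne
  rw [e] at hw ⊢
  rw [connectedComponentIn_eq hw]
  exact hS.subset_connectedComponentIn hwS hSV

theorem comp_mono {V V' : OpenNhdsOf x} (h : (V' : Set X) ⊆ V) : γ.comp V' ⊆ γ.comp V := by
  refine γ.subset_comp (γ.isPreconnected_comp V')
    (fun z hz => ⟨h (γ.comp_subset V' hz).1, (γ.comp_subset V' hz).2⟩) ?_
  exact closure_nonempty_iff.1 ⟨x, γ.mem_closure_inter V' V⟩

theorem comp_nonempty (V : OpenNhdsOf x) : (γ.comp V).Nonempty :=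
  closure_nonempty_iff.1 ⟨x, γ.mem_closure V⟩

variable {γ} (hX : X.IsMixed) {a : GChart X} (ha : a ∈ X.atlas) (hx : x ∈ a.dom)
  {F : AddSubmonoid (Fin a.k → ℤ)}

/-- The chart domain as a neighbourhood. -/
def domNhds (hac : a.IsChart) (hx : x ∈ a.dom) : OpenNhdsOf x := ⟨⟨a.dom, hac.isOpen_dom⟩, hx⟩

theorem correspondsTo_congr {b : GChart X} {G : AddSubmonoid (Fin b.k → ℤ)}
    (hγ : γ.CorrespondsTo a F) {O : Set X} (hO : O ∈ 𝓝 x)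
    (h : ∀ z ∈ O, z ∈ a.dom → (a.coord z).supp = F → z ∈ b.dom ∧ (b.coord z).supp = G) :
    γ.CorrespondsTo b G := by
  intro V
  obtain ⟨O', hO', hOo, hxO⟩ := mem_nhds_iff.1 hO
  let V' : OpenNhdsOf x := V ⊓ ⟨⟨O', hOo⟩, hxO⟩
  have hV' : (V' : Set X) ⊆ V := fun z hz => hz.1
  obtain ⟨z, hz, hza, hzF⟩ := hγ V'
  have hzO : z ∈ O := hO' ((γ.comp_subset V' hz).1).2
  exact ⟨z, γ.comp_mono hV' hz, h z hzO hza hzF⟩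

include hX ha

theorem CorrespondsTo.supp_eq (hγ : γ.CorrespondsTo a F) {V : OpenNhdsOf x}
    (hV : (V : Set X) ⊆ a.dom) {z : X} (hz : z ∈ γ.comp V) : (a.coord z).supp = F := by
  obtain ⟨y, hy, -, hyF⟩ := hγ V
  rw [← hyF]
  exact hX.supp_eq_of_isPreconnected ha (γ.isPreconnected_comp V)
    (fun w hw => hV (γ.comp_subset V hw).1) (fun w hw => (γ.comp_subset V hw).2) hz hy

include hx

theorem CorrespondsTo.isFace (hγ : γ.CorrespondsTo a F) : IsFace F a.P := by
  obtain ⟨y, -, -, rfl⟩ := hγ (domNhds (hX.isChart a ha) hx)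
  exact (a.coord y).isFace_supp

theorem CorrespondsTo.supp_le (hγ : γ.CorrespondsTo a F) : (a.coord x).supp ≤ F := by
  obtain ⟨V, hV, hVo, hxV⟩ := eventually_nhds_iff.1 ((hX.isChart a ha).eventually_supp_le hx)
  obtain ⟨y, hy, -, rfl⟩ := hγ ⟨⟨V, hVo⟩, hxV⟩
  exact hV y (γ.comp_subset _ hy).1

theorem CorrespondsTo.k_eq (hγ : γ.CorrespondsTo a F) : γ.k = rank a.P - rank F := by
  obtain ⟨y, hy, hya, rfl⟩ := hγ (domNhds (hX.isChart a ha) hx)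
  exact ((hX.mem_stratum_iff ha hya).1 (γ.comp_subset _ hy).2).symm

/-- In a small neighbourhood `O` the stratum of support `F` is connected, so it is exactly the
component chosen by `γ`. -/
theorem CorrespondsTo.exists_nhds_subset (hγ : γ.CorrespondsTo a F) (V : OpenNhdsOf x) :
    ∃ O : OpenNhdsOf x, (O : Set X) ⊆ V ∧ (O : Set X) ⊆ a.dom ∧
      (O : Set X) ∩ {z | (a.coord z).supp = F} = γ.comp O ∧ γ.comp O ⊆ γ.comp V := by
  obtain ⟨O, hOV, hOa, hO⟩ := (hX.isChart a ha).exists_openNhdsOf hx (V.isOpen.mem_nhds V.mem)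
  refine ⟨O, hOV, hOa, ?_, γ.comp_mono hOV⟩
  apply Set.Subset.antisymm
  · refine γ.subset_comp (hO F) ?_ ?_
    · rintro z ⟨hz, hzF⟩
      refine ⟨hz, (hX.mem_stratum_iff ha (hOa hz)).2 ?_⟩
      rw [show (a.coord z).supp = F from hzF, hγ.k_eq hX ha hx]
    · obtain ⟨y, hy, -, hyF⟩ := hγ O
      exact ⟨y, ⟨(γ.comp_subset O hy).1, hyF⟩, hy⟩
  · exact fun z hz => ⟨(γ.comp_subset O hz).1, hγ.supp_eq hX ha hOa hz⟩

theorem CorrespondsTo.unique {γ' : LocalCorner X x} (hγ : γ.CorrespondsTo a F)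
    (hγ' : γ'.CorrespondsTo a F) : γ = γ' := by
  have hk : γ.k = γ'.k := by rw [hγ.k_eq hX ha hx, hγ'.k_eq hX ha hx]
  have hcomp : γ.comp = γ'.comp := by
    funext V
    obtain ⟨O, hOV, hOa, hO, hOc⟩ := hγ.exists_nhds_subset hX ha hx V
    obtain ⟨y, hy, -, hyF⟩ := hγ' O
    have hyγ : y ∈ γ.comp V := hOc (hO ▸ ⟨(γ'.comp_subset O hy).1, hyF⟩)
    have hyγ' : y ∈ γ'.comp V := γ'.comp_mono hOV hy
    apply Set.Subset.antisymm
    · exact γ'.subset_comp (γ.isPreconnected_comp V) (hk ▸ γ.comp_subset V) ⟨y, hyγ, hyγ'⟩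
    · exact γ.subset_comp (γ'.isPreconnected_comp V) (hk ▸ γ'.comp_subset V) ⟨y, hyγ', hyγ⟩
  obtain ⟨k, c, h1, h2, h3⟩ := γ
  obtain ⟨k', c', h1', h2', h3'⟩ := γ'
  obtain rfl : k = k' := hk
  obtain rfl : c = c' := hcomp
  rfl

theorem exists_correspondsTo_face (γ : LocalCorner X x) : ∃ F, γ.CorrespondsTo a F := by
  let V₀ := domNhds (hX.isChart a ha) hx
  obtain ⟨z, hz⟩ := γ.comp_nonempty V₀
  refine ⟨(a.coord z).supp, fun V => ?_⟩
  let V' : OpenNhdsOf x := V ⊓ V₀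
  obtain ⟨y, hy⟩ := γ.comp_nonempty V'
  have h1 : y ∈ γ.comp V := γ.comp_mono (V' := V') (fun z hz => hz.1) hy
  have h2 : y ∈ γ.comp V₀ := γ.comp_mono (V' := V') (fun z hz => hz.2) hy
  exact ⟨y, h1, (γ.comp_subset V₀ h2).1, hX.supp_eq_of_isPreconnected ha
    (γ.isPreconnected_comp V₀) (fun w hw => (γ.comp_subset V₀ hw).1)
    (fun w hw => (γ.comp_subset V₀ hw).2) h2 hz⟩

/-- For `V` choose the component that contains the connected set of points of support `F` in a
smaller neighbourhood `N V`. Together with `CorrespondsTo.unique` this identifies the local corner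
components at `x` with the faces containing the support of `x`. -/
theorem exists_of_isFace (hF : IsFace F a.P) (hxF : (a.coord x).supp ≤ F) :
    ∃ γ : LocalCorner X x, γ.CorrespondsTo a F := by
  have hac := hX.isChart a ha
  choose N hNV hNa hN using fun V : OpenNhdsOf x =>
    hac.exists_openNhdsOf hx (V.isOpen.mem_nhds V.mem)
  have hfr := hac.frequently_supp_eq hx hF hxF
  have hz : ∀ V : OpenNhdsOf x, ∃ z ∈ (N V : Set X), (a.coord z).supp = F := fun V => by
    obtain ⟨z, ⟨-, hz⟩, hzN⟩ := (hfr.and_eventually ((N V).isOpen.mem_nhds (N V).mem)).exists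
    exact ⟨z, hzN, hz⟩
  choose z hzN hzF using hz
  let k := rank a.P - rank F
  have hsub : ∀ V : OpenNhdsOf x, (N V : Set X) ∩ {y | (a.coord y).supp = F} ⊆
      connectedComponentIn ((V : Set X) ∩ X.stratum k) (z V) := by
    intro V
    refine (hN V F).subset_connectedComponentIn ⟨hzN V, hzF V⟩ ?_
    rintro y ⟨hy, hyF⟩
    refine ⟨hNV V hy, (hX.mem_stratum_iff ha (hNa V hy)).2 ?_⟩
    rw [show (a.coord y).supp = F from hyF]
  refine ⟨⟨k, fun V => connectedComponentIn ((V : Set X) ∩ X.stratum k) (z V),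
    fun V => ⟨z V, ?_, rfl⟩, fun V => ?_, fun V V' => ?_⟩, fun V => ?_⟩
  · exact connectedComponentIn_subset _ _ (hsub V ⟨hzN V, hzF V⟩)
  · rw [mem_closure_iff_frequently]
    exact (hfr.and_eventually ((N V).isOpen.mem_nhds (N V).mem)).mono fun y hy =>
      hsub V ⟨hy.2, hy.1.2⟩
  · rw [mem_closure_iff_frequently]
    exact (hfr.and_eventually (Filter.inter_mem ((N V).isOpen.mem_nhds (N V).mem)
      ((N V').isOpen.mem_nhds (N V').mem))).mono fun y hy =>
      ⟨hsub V ⟨hy.2.1, hy.1.2⟩, hsub V' ⟨hy.2.2, hy.1.2⟩⟩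
  · exact ⟨z V, hsub V ⟨hzN V, hzF V⟩, hNa V (hzN V), hzF V⟩

end LocalCorner

end LocalCorners

/-! ### The corners of a mixed space -/

namespace Model

variable {k : ℕ} {P F : AddSubmonoid (Fin k → ℤ)}

open Classical in
/-- Extension by zero from a face. -/
noncomputable def extend (hF : IsFace F P) (y : Model F) : Model P :=
  ⟨fun p => if h : (p : Fin k → ℤ) ∈ F then y.1 ⟨p, h⟩ else 0, by
    beta_reduce
    rw [dif_pos (show ((0 : P) : Fin k → ℤ) ∈ F from F.zero_mem)]
    exact y.apply_zero, by
    intro p q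
    beta_reduce
    by_cases h : ((p + q : P) : Fin k → ℤ) ∈ F
    · obtain ⟨hp, hq⟩ := hF.mem_of_add_mem p p.2 q q.2 h
      rw [dif_pos h, dif_pos hp, dif_pos hq]
      exact y.apply_add ⟨p, hp⟩ ⟨q, hq⟩
    · rw [dif_neg h]
      by_cases hp : (p : Fin k → ℤ) ∈ F
      · have hq : (q : Fin k → ℤ) ∉ F := fun hq => h (F.add_mem hp hq)
        rw [dif_neg hq, mul_zero]
      · rw [dif_neg hp, zero_mul]⟩

theorem extend_apply (hF : IsFace F P) (y : Model F) {p : P} (h : (p : Fin k → ℤ) ∈ F) :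
    (extend hF y).1 p = y.1 ⟨p, h⟩ := dif_pos h

theorem extend_apply_of_notMem (hF : IsFace F P) (y : Model F) {p : P}
    (h : (p : Fin k → ℤ) ∉ F) : (extend hF y).1 p = 0 := dif_neg h

theorem continuous_extend (hF : IsFace F P) : Continuous (extend hF) := by
  rw [continuous_iff_continuousAt]
  intro y
  refine tendsto_iff.2 fun p => ?_
  by_cases hp : (p : Fin k → ℤ) ∈ F
  · simp only [extend_apply hF _ hp]
    exact (NNReal.continuous_coe.comp (continuous_eval _)).tendsto y
  · simp only [extend_apply_of_notMem hF _ hp]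
    exact tendsto_const_nhds

theorem supp_extend_le (hF : IsFace F P) (y : Model F) : (extend hF y).supp ≤ F := by
  rintro p ⟨hp, h⟩
  by_contra hpF
  exact h (extend_apply_of_notMem hF y hpF)

theorem restrict_extend (hF : IsFace F P) (y : Model F) : (extend hF y).restrict hF.le = y :=
  Subtype.ext (funext fun p => extend_apply hF y p.2)

theorem extend_restrict (hF : IsFace F P) (x : Model P) (hx : x.supp ≤ F) :
    extend hF (x.restrict hF.le) = x := by
  refine Subtype.ext (funext fun p => ?_)
  by_cases hp : (p : Fin k → ℤ) ∈ F
  · exact extend_apply hF _ hp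
  · rw [extend_apply_of_notMem hF _ hp]
    exact (eq_zero_iff_notMem_supp.2 fun h => hp (hx h)).symm

theorem continuous_restrict (h : F ≤ P) : Continuous (restrict h) := by
  rw [continuous_iff_continuousAt]
  intro y
  exact tendsto_iff.2 fun p => (NNReal.continuous_coe.comp (continuous_eval _)).tendsto y

theorem supp_restrict (hF : IsFace F P) (x : Model P) (hx : x.supp ≤ F) :
    (x.restrict hF.le).supp = x.supp := by
  ext p
  constructor
  · rintro ⟨hp, h⟩
    exact ⟨hF.le hp, h⟩
  · rintro ⟨hp, h⟩
    exact ⟨hx ⟨hp, h⟩, h⟩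

end Model

section Corners

open TopologicalSpace

variable {X : GSpace.{u}}

/-- The base point of a point of `C(X)`. -/
def cornerBase (z : corners X) : X := Sigma.fst (show CornerPoint X from z)

/-- The local corner component of a point of `C(X)`. -/
def localCorner (z : corners X) : LocalCorner X (cornerBase z) :=
  Sigma.snd (show CornerPoint X from z)

/-- The chart of `C(X)` given by a chart of `X` and a face. -/
abbrev faceChart (a : GChart X) {F : AddSubmonoid (Fin a.k → ℤ)} (hF : IsFace F a.P) :
    GChart (corners X) := cornerChart a hF

theorem isOpen_corners_inter {c : GChart (corners X)} (hc : c ∈ (corners X).atlas)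
    {O : Set (Model c.P)} (hO : IsOpen O) : IsOpen (c.dom ∩ c.coord ⁻¹' O) :=
  TopologicalSpace.isOpen_generateFrom_of_mem ⟨c, hc, O, hO, rfl⟩

theorem isOpen_corners_dom {c : GChart (corners X)} (hc : c ∈ (corners X).atlas) :
    IsOpen c.dom := by
  simpa using isOpen_corners_inter hc isOpen_univ

theorem continuousOn_corners_coord {c : GChart (corners X)} (hc : c ∈ (corners X).atlas) :
    ContinuousOn c.coord c.dom :=
  continuousOn_iff'.2 fun O hO => ⟨_, isOpen_corners_inter hc hO, by
    ext z; simp only [Set.mem_inter_iff]; tauto⟩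

theorem faceChart_mem {a : GChart X} (ha : a ∈ X.atlas)
    {F : AddSubmonoid (Fin a.k → ℤ)} (hF : IsFace F a.P) :
    faceChart a hF ∈ (corners X).atlas := ⟨a, ha, F, hF, rfl⟩

variable (hX : X.IsMixed)
include hX

/-- At one point of the component through `z` the support is `F` in one chart and `G` in the other.
Near the base point a change of charts maps equal supports to equal supports, so `F` and `G`
correspond throughout a neighbourhood. This makes the topology of `C(X)` in one face chart
controlled by the base point alone. -/
theorem eventually_mem_faceChart {a : GChart X} (ha : a ∈ X.atlas)
    {F : AddSubmonoid (Fin a.k → ℤ)} (hF : IsFace F a.P) {b : GChart X} (hb : b ∈ X.atlas)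
    {G : AddSubmonoid (Fin b.k → ℤ)} (hG : IsFace G b.P) {z : corners X}
    (hz : z ∈ (faceChart a hF).dom) (hz' : z ∈ (faceChart b hG).dom) :
    ∃ V ∈ 𝓝 (cornerBase z), ∀ z' ∈ (faceChart a hF).dom, cornerBase z' ∈ V →
      z' ∈ (faceChart b hG).dom := by
  obtain ⟨x, γ⟩ := z
  have hac := hX.isChart a ha
  have hbc := hX.isChart b hb
  obtain ⟨V, hV, hVs⟩ := (hX.mapAt_id ha hb hz.1 hz'.1).exists_nhds_supp_eq hac hbc hz.1
  obtain ⟨O, hO, hOo, hxO⟩ := mem_nhds_iff.1 (Filter.inter_mem hV (hbc.dom_mem_nhds hz'.1))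
  -- a point of the component read in both charts
  let W : OpenNhdsOf x :=
    (⟨⟨O, hOo⟩, hxO⟩ ⊓ LocalCorner.domNhds hac hz.1) ⊓ LocalCorner.domNhds hbc hz'.1
  obtain ⟨y, hy⟩ := γ.comp_nonempty W
  have hyW := (γ.comp_subset W hy).1
  have hya : (a.coord y).supp = F := hz.2.supp_eq hX ha (V := W) (fun w hw => hw.1.2) hy
  have hyb : (b.coord y).supp = G := hz'.2.supp_eq hX hb (V := W) (fun w hw => hw.2) hy
  refine ⟨O, hOo.mem_nhds hxO, ?_⟩
  rintro ⟨x', γ'⟩ ⟨hx'a, hγ'⟩ hx'O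
  refine ⟨(hO hx'O).2, LocalCorner.correspondsTo_congr hγ' (hOo.mem_nhds hx'O) ?_⟩
  intro w hw hwa hwF
  exact ⟨(hO hw).2, (hVs w (hO hw).1 y (hO hyW.1.1).1 (hwF.trans hya.symm)).trans hyb⟩

theorem supp_coord_le_of_mem {a : GChart X} (ha : a ∈ X.atlas)
    {F : AddSubmonoid (Fin a.k → ℤ)} (hF : IsFace F a.P) {z : corners X}
    (hz : z ∈ (faceChart a hF).dom) : (a.coord (cornerBase z)).supp ≤ F :=
  LocalCorner.CorrespondsTo.supp_le hX ha hz.1 hz.2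

theorem supp_faceChart {a : GChart X} (ha : a ∈ X.atlas)
    {F : AddSubmonoid (Fin a.k → ℤ)} (hF : IsFace F a.P) {z : corners X}
    (hz : z ∈ (faceChart a hF).dom) :
    ((faceChart a hF).coord z).supp = (a.coord (cornerBase z)).supp :=
  Model.supp_restrict hF _ (supp_coord_le_of_mem hX ha hF hz)

/-- On a face chart the coordinates of the base point are recovered by extension by zero, which is
continuous. -/
theorem continuousAt_fst (z : corners X) : ContinuousAt cornerBase z := by
  obtain ⟨x, γ⟩ := z
  obtain ⟨a, ha, hx⟩ := hX.cover x
  have : Nonempty X := ⟨x⟩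
  obtain ⟨F, hγ⟩ := LocalCorner.exists_correspondsTo_face hX ha hx γ
  have hF := hγ.isFace hX ha hx
  have hac := hX.isChart a ha
  let z : corners X := ⟨x, γ⟩
  have hz : z ∈ (faceChart a hF).dom := ⟨hx, hγ⟩
  have hc := faceChart_mem ha hF
  have hdom : (faceChart a hF).dom ∈ 𝓝 z := (isOpen_corners_dom hc).mem_nhds hz
  have h1 : ContinuousAt (faceChart a hF).coord z :=
    (continuousOn_corners_coord hc).continuousAt hdom
  have h2 := (Model.continuous_extend hF).continuousAt.comp h1
  have h3 : ContinuousAt (fun z : corners X => a.coord (cornerBase z)) z := by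
    refine h2.congr ?_
    filter_upwards [hdom] with z' hz'
    exact Model.extend_restrict hF _ (supp_coord_le_of_mem hX ha hF hz')
  refine ((hac.eventually_inv hx).1.comp h3).congr' ?_
  filter_upwards [hdom] with z' hz'
  exact hac.injOn.leftInvOn_invFunOn hz'.1

/-- The topology of `C(X)` near a point, in terms of that of `X`. -/
theorem exists_nhds_subset_of_isOpen {a : GChart X} (ha : a ∈ X.atlas)
    {F : AddSubmonoid (Fin a.k → ℤ)} (hF : IsFace F a.P) {z : corners X}
    (hz : z ∈ (faceChart a hF).dom) {O : Set (corners X)} (hO : O ∈ 𝓝 z) :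
    ∃ V ∈ 𝓝 (cornerBase z), ∀ z' ∈ (faceChart a hF).dom, (cornerBase z') ∈ V → z' ∈ O := by
  suffices h : Filter.comap cornerBase (𝓝 (cornerBase z)) ⊓
      Filter.principal (faceChart a hF).dom ≤ 𝓝 z by
    have := h hO
    rw [Filter.mem_inf_principal, Filter.mem_comap] at this
    obtain ⟨V, hV, hVO⟩ := this
    exact ⟨V, hV, fun z' hz' hzV => hVO hzV hz'⟩
  rw [show 𝓝 z = _ from TopologicalSpace.nhds_generateFrom]
  refine le_iInf₂ ?_
  rintro S ⟨hzS, c, ⟨b, hb, G, hG, rfl⟩, O, hO, rfl⟩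
  refine Filter.le_principal_iff.2 (Filter.mem_inf_principal.2 (Filter.mem_comap.2 ?_))
  obtain ⟨V, hV, hVs⟩ := eventually_mem_faceChart hX ha hF hb hG hz hzS.1
  have h1 : ContinuousAt (fun x => (b.coord x).restrict hG.le) (cornerBase z) :=
    (Model.continuous_restrict hG.le).continuousAt.comp
      ((hX.isChart b hb).continuousAt_coord hzS.1.1)
  refine ⟨V ∩ _, Filter.inter_mem hV (h1 (hO.mem_nhds hzS.2)), ?_⟩
  rintro z' ⟨hz'V, hz'O⟩ hz'
  exact ⟨hVs z' hz' hz'V, hz'O⟩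

theorem isChart_faceChart {a : GChart X} (ha : a ∈ X.atlas)
    {F : AddSubmonoid (Fin a.k → ℤ)} (hF : IsFace F a.P) :
    (faceChart a hF).IsChart where
  weaklyToric := hF.weaklyToric (hX.isChart a ha).weaklyToric
  isOpen_dom := isOpen_corners_dom (faceChart_mem ha hF)
  injOn := by
    rintro z hz z' hz' e
    have h1 := supp_coord_le_of_mem hX ha hF hz
    have h2 := supp_coord_le_of_mem hX ha hF hz'
    have e' : a.coord (cornerBase z) = a.coord (cornerBase z') := by
      rw [← Model.extend_restrict hF _ h1, ← Model.extend_restrict hF _ h2]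
      exact congrArg (Model.extend hF) e
    obtain ⟨x, γ⟩ := z
    obtain ⟨x', γ'⟩ := z'
    obtain rfl : x = x' := (hX.isChart a ha).injOn hz.1 hz'.1 e'
    obtain rfl : γ = γ' := hz.2.unique hX ha hz.1 hz'.2
    rfl
  continuousOn := continuousOn_corners_coord (faceChart_mem ha hF)
  isOpen_image := by
    intro O hO hOd
    rw [isOpen_iff_mem_nhds]
    rintro _ ⟨z, hz, rfl⟩
    have hac := hX.isChart a ha
    obtain ⟨V, hV, hVO⟩ := exists_nhds_subset_of_isOpen hX ha hF (hOd hz) (hO.mem_nhds hz)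
    have h1 := hac.image_mem_nhds (hOd hz).1 (Filter.inter_mem hV (hac.dom_mem_nhds (hOd hz).1))
    have h2 := Model.extend_restrict hF _ (supp_coord_le_of_mem hX ha hF (hOd hz))
    change a.coord '' (V ∩ a.dom) ∈ 𝓝 (a.coord (cornerBase z)) at h1
    rw [← h2] at h1
    refine Filter.mem_of_superset ((Model.continuous_extend hF).continuousAt h1) ?_
    rintro y ⟨x, ⟨hxV, hx⟩, e⟩
    -- Any base point whose coordinates are an extension by zero from `F` carries the local corner
    -- component of `F`, so nearby points of the model space of `F` are attained.
    obtain ⟨γ, hγ⟩ := LocalCorner.exists_of_isFace hX ha hx hF (e ▸ Model.supp_extend_le hF y)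
    refine ⟨⟨x, γ⟩, hVO _ ⟨hx, hγ⟩ hxV, ?_⟩
    change (a.coord x).restrict hF.le = y
    exact (congrArg (Model.restrict hF.le) e).trans (Model.restrict_extend hF y)

/-- The projection `C(X) → X` is smooth in charts. -/
theorem mapAt_fst {a : GChart X} (ha : a ∈ X.atlas)
    {F : AddSubmonoid (Fin a.k → ℤ)} (hF : IsFace F a.P) {z : corners X}
    (hz : z ∈ (faceChart a hF).dom) :
    GChart.MapAt (faceChart a hF) a cornerBase z := by
  refine ⟨continuousAt_fst hX z, fun p => ?_⟩
  by_cases hp : (p : Fin a.k → ℤ) ∈ F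
  · refine Or.inl ⟨(⟨(p : Fin a.k → ℤ), hp⟩ : F), _, GChart.realAt_const _ z 1, one_pos,
      Filter.Eventually.of_forall fun z' => ?_⟩
    rw [mul_one]
    rfl
  · right
    filter_upwards [(isOpen_corners_dom (faceChart_mem ha hF)).mem_nhds hz] with z' hz'
    rw [Model.eq_zero_iff_notMem_supp]
    exact fun h => hp (supp_coord_le_of_mem hX ha hF hz' h)

theorem exists_mem_faceChart (z : corners X) {a : GChart X} (ha : a ∈ X.atlas)
    (hza : (cornerBase z) ∈ a.dom) : ∃ (F : AddSubmonoid (Fin a.k → ℤ)) (hF : IsFace F a.P),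
      z ∈ (faceChart a hF).dom := by
  obtain ⟨F, hγ⟩ := LocalCorner.exists_correspondsTo_face hX ha hza (localCorner z)
  exact ⟨F, hγ.isFace hX ha hza, hza, hγ⟩

theorem isMixed_corners : (corners X).IsMixed where
  isChart := by
    rintro _ ⟨a, ha, F, hF, rfl⟩
    exact isChart_faceChart hX ha hF
  cover z := by
    obtain ⟨a, ha, hx⟩ := hX.cover (cornerBase z)
    obtain ⟨F, hF, hz⟩ := exists_mem_faceChart hX z ha hx
    exact ⟨_, faceChart_mem ha hF, hz⟩
  compatible := by
    have key : ∀ c ∈ (corners X).atlas, ∀ d ∈ (corners X).atlas, ∀ q : d.P,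
        c.SmoothNonnegOn (c.dom ∩ d.dom) fun x => (d.coord x).1 q := by
      rintro _ ⟨a, ha, F, hF, rfl⟩ _ ⟨b, hb, G, hG, rfl⟩ q
      have hac := isChart_faceChart hX ha hF
      have hbc := isChart_faceChart hX hb hG
      refine (hac.smoothNonnegOn_iff (hac.isOpen_dom.inter hbc.isOpen_dom)
        Set.inter_subset_left).2 ?_
      rintro z ⟨hza, hzb⟩
      exact (mapAt_fst hX ha hF hza).nonnegAt_comp hac
        (hX.nonnegAt_of_compatible ha hb hza.1 hzb.1 ⟨q.1, hG.le q.2⟩)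
    intro c hc d hd
    refine ⟨key c hc d hd, fun p => ?_⟩
    rw [Set.inter_comm]
    exact key d hd c hc p

theorem mem_stratum_zero_corners_iff {a : GChart X} (ha : a ∈ X.atlas)
    {F : AddSubmonoid (Fin a.k → ℤ)} (hF : IsFace F a.P) {z : corners X}
    (hz : z ∈ (faceChart a hF).dom) :
    z ∈ (corners X).stratum 0 ↔ (a.coord (cornerBase z)).supp = F := by
  rw [(isMixed_corners hX).mem_stratum_zero_iff (faceChart_mem ha hF) hz,
    supp_faceChart hX ha hF hz]
  rfl

end Corners

/-! ### The map of corners -/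

section CornerMap

open TopologicalSpace

variable {X : GSpace.{u}} {Y : GSpace.{v}} {f : X → Y} (hX : X.IsMixed) (hY : Y.IsMixed)
include hX hY

/-- Reads the choice in `pushforward` in charts. The component given by `G` is a pushforward, so one
exists; and whichever was chosen meets the image of `γ` arbitrarily near, where all supports are
`G`. -/
theorem pushforward_correspondsTo {x : X} {a : GChart X} {b : GChart Y} (ha : a ∈ X.atlas)
    (hb : b ∈ Y.atlas) (hxa : x ∈ a.dom) (hxb : f x ∈ b.dom) (hf : ContinuousAt f x)
    {γ : LocalCorner X x} {F : AddSubmonoid (Fin a.k → ℤ)} {G : AddSubmonoid (Fin b.k → ℤ)}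
    (hγ : γ.CorrespondsTo a F) {V : Set X} (hV : V ∈ 𝓝 x)
    (hVG : ∀ z ∈ V, (a.coord z).supp = F → (b.coord (f z)).supp = G) :
    (pushforward f γ).CorrespondsTo b G := by
  have hac := hX.isChart a ha
  have hbc := hY.isChart b hb
  have hU : ∀ U ∈ 𝓝 x, ∃ z ∈ U, z ∈ a.dom ∧ (a.coord z).supp = F := by
    intro U hU
    obtain ⟨O, hO, hOo, hxO⟩ := mem_nhds_iff.1 hU
    obtain ⟨z, hz, hza, hzF⟩ := hγ ⟨⟨O, hOo⟩, hxO⟩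
    exact ⟨z, hO (γ.comp_subset _ hz).1, hza, hzF⟩
  -- the face `G` determines a local corner component
  have hG : IsFace G b.P := by
    obtain ⟨z, hz, -, hzF⟩ := hU V hV
    rw [← hVG z hz hzF]
    exact (b.coord (f z)).isFace_supp
  have hGx : (b.coord (f x)).supp ≤ G := by
    obtain ⟨z, ⟨hz, hz'⟩, -, hzF⟩ := hU _ (Filter.inter_mem hV (hf.eventually
      (hbc.eventually_supp_le hxb)))
    rw [← hVG z hz hzF]
    exact hz'
  obtain ⟨δ, hδ⟩ := LocalCorner.exists_of_isFace hY hb hxb hG hGx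
  have hex : ∃ δ, IsPushforward f γ δ := by
    refine ⟨δ, fun W W' => ?_⟩
    obtain ⟨O, -, -, hO, hOW⟩ := hγ.exists_nhds_subset hX ha hxa W
    obtain ⟨O', -, -, hO', hOW'⟩ := hδ.exists_nhds_subset hY hb hxb W'
    obtain ⟨z, ⟨⟨hz, hzO⟩, hzO'⟩, -, hzF⟩ := hU _ (Filter.inter_mem (Filter.inter_mem hV
      (O.isOpen.mem_nhds O.mem)) (hf.eventually (O'.isOpen.mem_nhds O'.mem)))
    exact ⟨f z, hOW' (hO' ▸ ⟨hzO', hVG z hz hzF⟩), z, hOW (hO ▸ ⟨hzO, hzF⟩), rfl⟩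
  rw [pushforward, dif_pos hex]
  have hpush := hex.choose_spec
  intro W'
  obtain ⟨O, hO, hOo, hxO⟩ := mem_nhds_iff.1 (Filter.inter_mem hV (Filter.inter_mem
    (hac.dom_mem_nhds hxa) (hf.eventually (Filter.eventually_mem_set.2 (hbc.dom_mem_nhds hxb)))))
  let W : OpenNhdsOf x := ⟨⟨O, hOo⟩, hxO⟩
  obtain ⟨_, hw, z, hz, rfl⟩ := hpush W W'
  have hzO := hO (γ.comp_subset W hz).1
  refine ⟨f z, hw, hzO.2.2, hVG z hzO.1 ?_⟩
  exact hγ.supp_eq hX ha (V := W) (fun y hy => (hO hy).2.1) hz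

theorem IsSmooth.exists_nhds_cornerMap_mem (hf : IsSmooth f) {a : GChart X} (ha : a ∈ X.atlas)
    {b : GChart Y} (hb : b ∈ Y.atlas) {F : AddSubmonoid (Fin a.k → ℤ)} (hF : IsFace F a.P)
    {z : corners X} (hz : z ∈ (faceChart a hF).dom) (hzb : f (cornerBase z) ∈ b.dom) :
    ∃ (G : AddSubmonoid (Fin b.k → ℤ)) (hG : IsFace G b.P) (V : Set X),
      IsOpen V ∧ cornerBase z ∈ V ∧
      (∀ y ∈ V, y ∈ a.dom ∧ f y ∈ b.dom) ∧
      (∀ y ∈ V, (a.coord y).supp = F → (b.coord (f y)).supp = G) ∧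
      ∀ z' ∈ (faceChart a hF).dom, (cornerBase z') ∈ V → cornerMap f z' ∈ (faceChart b hG).dom := by
  have hac := hX.isChart a ha
  have hbc := hY.isChart b hb
  have hm := hf.mapAt hX hY ha hb hz.1 hzb
  obtain ⟨V, hV, hVs⟩ := hm.exists_nhds_supp_eq hac hbc hz.1
  obtain ⟨O, hO, hOo, hxO⟩ := mem_nhds_iff.1 (Filter.inter_mem hV (Filter.inter_mem
    (hac.dom_mem_nhds hz.1) (hm.continuousAt.eventually
      (Filter.eventually_mem_set.2 (hbc.dom_mem_nhds hzb)))))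
  obtain ⟨y, hy, -, hyF⟩ := hz.2 ⟨⟨O, hOo⟩, hxO⟩
  have hyO : y ∈ O := (z.2.comp_subset _ hy).1
  have hG : ∀ w ∈ O, (a.coord w).supp = F → (b.coord (f w)).supp = (b.coord (f y)).supp :=
    fun w hw hwF => hVs w (hO hw).1 y (hO hyO).1 (hwF.trans hyF.symm)
  refine ⟨(b.coord (f y)).supp, (b.coord (f y)).isFace_supp, O, hOo, hxO,
    fun w hw => ⟨(hO hw).2.1, (hO hw).2.2⟩, hG, fun z' hz' hzO => ⟨(hO hzO).2.2, ?_⟩⟩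
  exact pushforward_correspondsTo hX hY ha hb hz'.1 (hO hzO).2.2 hf.1.continuousAt hz'.2
    (hOo.mem_nhds hzO) hG

/-- Interior points of `C(X)` in the chart of `F` are those whose support is exactly `F`, and these
are sent to points whose support is exactly `G`. So `C(f)` is interior even when `f` maps into the
boundary. -/
theorem IsSmooth.cornerMap (hf : IsSmooth f) : IsInterior (cornerMap f) := by
  have hfst : ∀ z : corners X, ContinuousAt (fun z : corners X => f (cornerBase z)) z := fun z =>
    ContinuousAt.comp (g := f) hf.1.continuousAt (continuousAt_fst hX z)
  refine ⟨isSmooth_of_mapAt (isMixed_corners hX) (isMixed_corners hY) fun z => ?_, fun z hz => ?_⟩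
  · obtain ⟨a, ha, hza⟩ := hX.cover (cornerBase z)
    obtain ⟨b, hb, hzb⟩ := hY.cover (f (cornerBase z))
    obtain ⟨F, hF, hz⟩ := exists_mem_faceChart hX z ha hza
    obtain ⟨G, hG, V, hVo, hzV, hVab, hVG, hVC⟩ :=
      hf.exists_nhds_cornerMap_mem hX hY ha hb hF hz hzb
    have hdom := (isChart_faceChart hX ha hF).dom_mem_nhds hz
    have hev : ∀ᶠ z' in 𝓝 z, z' ∈ (faceChart a hF).dom ∧ (cornerBase z') ∈ V :=
      (Filter.eventually_mem_set.2 hdom).and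
        ((continuousAt_fst hX z).eventually (hVo.mem_nhds hzV))
    refine ⟨_, faceChart_mem ha hF, hz, _, faceChart_mem hb hG, hVC z hz hzV, ?_, ?_⟩
    · intro O hO
      obtain ⟨U, hU, hUO⟩ := exists_nhds_subset_of_isOpen hY hb hG (hVC z hz hzV) hO
      rw [Filter.mem_map]
      filter_upwards [hev, (hfst z).eventually hU] with z' hz' hz'U
      exact hUO _ (hVC z' hz'.1 hz'.2) hz'U
    · intro q
      exact (mapAt_fst hX ha hF hz).nonnegAt_comp (isChart_faceChart hX ha hF)
        ((hf.mapAt hX hY ha hb hza hzb).nonnegAt ⟨q.1, hG.le q.2⟩)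
  · obtain ⟨a, ha, hza⟩ := hX.cover (cornerBase z)
    obtain ⟨b, hb, hzb⟩ := hY.cover (f (cornerBase z))
    obtain ⟨F, hF, hzF⟩ := exists_mem_faceChart hX z ha hza
    obtain ⟨G, hG, V, hVo, hzV, hVab, hVG, hVC⟩ :=
      hf.exists_nhds_cornerMap_mem hX hY ha hb hF hzF hzb
    rw [mem_stratum_zero_corners_iff hX ha hF hzF] at hz
    rw [mem_stratum_zero_corners_iff hY hb hG (hVC z hzF hzV)]
    exact hVG (cornerBase z) hzV hz

theorem cornerMap_comp {Z : GSpace.{w}} (hZ : Z.IsMixed) {g : Y → Z} (hf : IsSmooth f)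
    (hg : IsSmooth g) (hgf : IsSmooth (g ∘ f)) :
    GCorners.cornerMap (g ∘ f) = GCorners.cornerMap g ∘ GCorners.cornerMap f := by
  funext z
  obtain ⟨a, ha, hza⟩ := hX.cover (cornerBase z)
  obtain ⟨b, hb, hzb⟩ := hY.cover (f (cornerBase z))
  obtain ⟨c, hc, hzc⟩ := hZ.cover (g (f (cornerBase z)))
  obtain ⟨F, hF, hz⟩ := exists_mem_faceChart hX z ha hza
  obtain ⟨G, hG, V, hVo, hzV, hVab, hVG, hVC⟩ :=
    hf.exists_nhds_cornerMap_mem hX hY ha hb hF hz hzb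
  obtain ⟨H, hH, U, hUo, hzU, hUbc, hUH, hUC⟩ :=
    hg.exists_nhds_cornerMap_mem hY hZ hb hc hG (hVC z hz hzV) hzc
  have h1 := hUC _ (hVC z hz hzV) hzU
  have h2 : (pushforward (g ∘ f) (localCorner z)).CorrespondsTo c H := by
    refine pushforward_correspondsTo hX hZ ha hc hza hzc hgf.1.continuousAt hz.2
      (V := V ∩ f ⁻¹' U) ((hVo.inter (hUo.preimage hf.1)).mem_nhds ⟨hzV, hzU⟩) ?_
    rintro y ⟨hyV, hyU⟩ hyF
    exact hUH (f y) hyU (hVG y hyV hyF)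
  have h3 : pushforward (g ∘ f) (localCorner z) =
      (GCorners.cornerMap g (GCorners.cornerMap f z)).2 :=
    h2.unique hZ hc hzc h1.2
  change (⟨g (f (cornerBase z)), pushforward (g ∘ f) (localCorner z)⟩ : CornerPoint Z) = _
  rw [h3]
  rfl

end CornerMap

/-! ### Lattice points -/

/-- The zero set of a nonnegative functional is a face. -/
theorem exists_isFace_of_functional {k : ℕ} {P : AddSubmonoid (Fin k → ℤ)} {v : (Fin k → ℤ) →+ ℤ}
    (hv : ∀ p ∈ P, 0 ≤ v p) : ∃ F, IsFace F P ∧ ∀ p, p ∈ F ↔ p ∈ P ∧ v p = 0 := by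
  refine ⟨P ⊓ AddMonoidHom.mker v, ⟨inf_le_left, ?_⟩, fun p => Iff.rfl⟩
  rintro p hp q hq ⟨-, h⟩
  have h' : v p + v q = 0 := by rw [← map_add]; exact h
  have h1 := hv p hp
  have h2 := hv q hq
  exact ⟨⟨hp, show v p = 0 by omega⟩, ⟨hq, show v q = 0 by omega⟩⟩

theorem exists_add_eq_of_mem_closure {k : ℕ} {E F : AddSubmonoid (Fin k → ℤ)} {p : Fin k → ℤ}
    (h : p ∈ AddSubgroup.closure ((F : Set (Fin k → ℤ)) ∪ E)) :
    ∃ e ∈ E, ∃ e' ∈ E, ∃ f ∈ F, ∃ f' ∈ F, p + e' + f' = e + f := by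
  have h' : p ∈ AddSubgroup.closure ((F ⊔ E : AddSubmonoid (Fin k → ℤ)) : Set (Fin k → ℤ)) :=
    AddSubgroup.closure_mono (Set.union_subset (show F ≤ F ⊔ E from le_sup_left)
      (show E ≤ F ⊔ E from le_sup_right)) h
  obtain ⟨s, hs, t, ht, rfl⟩ := mem_closure_iff_exists_sub.1 h'
  obtain ⟨f, hf, e, he, rfl⟩ := AddSubmonoid.mem_sup.1 hs
  obtain ⟨f', hf', e', he', rfl⟩ := AddSubmonoid.mem_sup.1 ht
  exact ⟨e, he, e', he', f, hf, f', hf', by abel⟩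

/-- If `E ⊆ P` generates all faces `F ⊇ F₀` of `P` as groups modulo `F₀`, in the sense that
`Fᵍᵖ` is generated by `F₀` and `E ∩ F`, then a multiple of any element of `P` is in `E` modulo
`F₀ᵍᵖ`. -/
theorem exists_nsmul_add_eq {k : ℕ} {P F₀ E : AddSubmonoid (Fin k → ℤ)} (hP : P.FG)
    (hF₀ : IsFace F₀ P) (hE : E ≤ P) {l : List (Fin k → ℤ)} (hl : ∀ a ∈ l, a ∈ E)
    (hlE : ∀ v : (Fin k → ℤ) →+ ℤ, (∀ f ∈ F₀, v f = 0) → (∀ a ∈ l, 0 ≤ v a) → ∀ e ∈ E, 0 ≤ v e)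
    (hA : ∀ F, IsFace F P → F₀ ≤ F → ∀ p ∈ F,
      p ∈ AddSubgroup.closure ((F₀ : Set (Fin k → ℤ)) ∪ (E ⊓ F : AddSubmonoid (Fin k → ℤ))))
    {p : Fin k → ℤ} (hp : p ∈ P) :
    ∃ n : ℕ, 1 ≤ n ∧ ∃ e ∈ E, ∃ f ∈ F₀, ∃ f' ∈ F₀, n • p + f' = e + f := by
  obtain ⟨l₀, hl₀⟩ := exists_list_closure_eq (hF₀.fg hP)
  have hmem₀ : ∀ a ∈ l₀, a ∈ F₀ := fun a ha => hl₀ ▸ AddSubmonoid.subset_closure ha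
  -- Including the generators of `F₀` with both signs works modulo `F₀ᵍᵖ`. If the claim fails, some
  -- `v` vanishes on `F₀`, is nonnegative on `E` and negative at `p`.
  rcases exists_smul_mem_closure_or_exists_neg (l ++ l₀ ++ l₀.map (-·)) p with
    ⟨n, hn, h⟩ | ⟨v, hv, hvp⟩
  · refine ⟨n, hn, ?_⟩
    suffices H : ∀ y ∈ AddSubmonoid.closure {x | x ∈ l ++ l₀ ++ l₀.map (-·)},
        ∃ e ∈ E, ∃ f ∈ F₀, ∃ f' ∈ F₀, y + f' = e + f from H _ h
    intro y hy
    induction hy using AddSubmonoid.closure_induction with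
    | mem y hy =>
      simp only [Set.mem_ofPred_eq, List.mem_append, List.mem_map] at hy
      rcases hy with (hy | hy) | ⟨y, hy, rfl⟩
      · exact ⟨y, hl y hy, 0, zero_mem _, 0, zero_mem _, rfl⟩
      · exact ⟨0, zero_mem _, y, hmem₀ y hy, 0, zero_mem _, by abel⟩
      · exact ⟨0, zero_mem _, 0, zero_mem _, y, hmem₀ y hy, by abel⟩
    | zero => exact ⟨0, zero_mem _, 0, zero_mem _, 0, zero_mem _, rfl⟩
    | add y z _ _ hy hz =>
      obtain ⟨e, he, f, hf, f', hf', h⟩ := hy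
      obtain ⟨e₁, he₁, f₁, hf₁, f₁', hf₁', h₁⟩ := hz
      refine ⟨e + e₁, add_mem he he₁, f + f₁, add_mem hf hf₁, f' + f₁', add_mem hf' hf₁', ?_⟩
      rw [add_add_add_comm, h, h₁, add_add_add_comm]
  exfalso
  have hv₀ : ∀ f ∈ F₀, v f = 0 := by
    intro f hf
    rw [← hl₀] at hf
    induction hf using AddSubmonoid.closure_induction with
    | mem f hf =>
      have h1 := hv f (by simp only [List.mem_append]; exact Or.inl (Or.inr hf))
      have h2 := hv (-f) (by
        simp only [List.mem_append, List.mem_map]; exact Or.inr ⟨f, hf, rfl⟩)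
      rw [map_neg] at h2
      omega
    | zero => exact map_zero v
    | add y z _ _ hy hz => rw [map_add, hy, hz, add_zero]
  have hvE := hlE v hv₀ fun a ha => hv a (by
    simp only [List.mem_append]; exact Or.inl (Or.inl ha))
  obtain ⟨u, hu, hu₀⟩ := hF₀.exists_functional hP
  obtain ⟨N, e, he⟩ := exists_generators hP
  have hsum : ∀ (w : (Fin k → ℤ) →+ ℤ) (m : Fin N → ℕ),
      w ((∑ i, m i • e i : P) : Fin k → ℤ) = ∑ i, (m i : ℤ) * w (e i) := by
    intro w m
    rw [AddSubmonoid.coe_finsetSum, map_sum]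
    refine Finset.sum_congr rfl fun i _ => ?_
    rw [AddSubmonoidClass.coe_nsmul, map_nsmul, nsmul_eq_mul]
  have hneg : ∃ j, v (e j) < 0 := by
    by_contra! hcon
    obtain ⟨m, hm⟩ := he ⟨p, hp⟩
    have h1 := hsum v m
    rw [← hm] at h1
    have h2 : 0 ≤ ∑ i, (m i : ℤ) * v (e i) :=
      Finset.sum_nonneg fun i _ => mul_nonneg (Int.natCast_nonneg _) (hcon i)
    have h3 : v p = ∑ i, (m i : ℤ) * v (e i) := h1
    omega
  have hpos : ∀ j, v (e j) ≠ 0 → 0 < u (e j) := fun j hj =>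
    lt_of_le_of_ne (hu _ (e j).2) fun h => hj (hv₀ _ ((hu₀ _ (e j).2).1 h.symm))
  obtain ⟨j₁, hj₁⟩ := hneg
  -- the generator of minimal slope
  obtain ⟨j, hj, hmin⟩ := Finset.exists_min_image
    (Finset.univ.filter fun j => 0 < u (e j)) (fun j => (v (e j) : ℚ) / u (e j))
    ⟨j₁, by simpa using hpos j₁ hj₁.ne⟩
  have huj : 0 < u (e j) := by simpa using hj
  have hmin' : ∀ j', 0 < u (e j') → v (e j) * u (e j') ≤ v (e j') * u (e j) := by
    intro j' hj'
    have h := hmin j' (by simpa using hj')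
    rw [div_le_div_iff₀ (by exact_mod_cast huj) (by exact_mod_cast hj')] at h
    exact_mod_cast h
  have hvj : v (e j) < 0 := by
    have h := hmin' j₁ (hpos j₁ hj₁.ne)
    by_contra! hcon
    nlinarith [mul_nonneg hcon (hpos j₁ hj₁.ne).le, mul_pos_of_neg_of_neg hj₁ (neg_neg_of_pos huj)]
  -- `v` is tilted by the supporting functional `u` of `F₀` just enough to be nonnegative on `P`.
  -- The zero set `F` of `v'` is a face containing the generator `e j` of minimal slope.
  let v' : (Fin k → ℤ) →+ ℤ := u (e j) • v + (-v (e j)) • u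
  have hv' : ∀ r, v' r = u (e j) * v r + (-v (e j)) * u r := fun r => rfl
  have hv'P : ∀ r ∈ P, 0 ≤ v' r := by
    intro r hr
    obtain ⟨m, hm⟩ := he ⟨r, hr⟩
    have h1 := hsum v' m
    rw [← hm] at h1
    have h2 : v' r = ∑ i, (m i : ℤ) * v' (e i) := h1
    rw [h2]
    refine Finset.sum_nonneg fun i _ => mul_nonneg (Int.natCast_nonneg _) ?_
    rw [hv']
    rcases (hu _ (e i).2).eq_or_lt with h0 | h0
    · rw [← h0, hv₀ _ ((hu₀ _ (e i).2).1 h0.symm)]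
      simp
    · linarith [hmin' i h0, mul_comm (v (e i)) (u (e j))]
  obtain ⟨F, hF, hFm⟩ := exists_isFace_of_functional hv'P
  have hF₀F : F₀ ≤ F := fun f hf => (hFm f).2 ⟨hF₀.le hf, by
    rw [hv', hv₀ f hf, (hu₀ f (hF₀.le hf)).2 hf, mul_zero, mul_zero, add_zero]⟩
  have hejF : (e j : Fin k → ℤ) ∈ F := (hFm _).2 ⟨(e j).2, by rw [hv']; ring⟩
  have key := hA F hF hF₀F _ hejF
  -- On `E ∩ F` both terms of `v'` are nonnegative and add up to zero, so `u = 0`. As `F₀` and `E ∩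
  -- F` generate `Fᵍᵖ`, this gives `u (e j) = 0`, contradicting `u (e j) > 0`.
  have hker : (F₀ : Set (Fin k → ℤ)) ∪ (E ⊓ F : AddSubmonoid (Fin k → ℤ)) ⊆ u.ker := by
    rintro r (hr | ⟨hrE, hrF⟩)
    · exact (hu₀ r (hF₀.le hr)).2 hr
    · have h1 := ((hFm r).1 hrF).2
      rw [hv'] at h1
      have h2 := hvE r hrE
      have h3 := hu r (hE hrE)
      have h4 : -v (e j) * u r = 0 := by
        nlinarith [mul_nonneg huj.le h2, mul_nonneg (neg_nonneg.2 hvj.le) h3]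
      exact (mul_eq_zero.1 h4).resolve_left (by omega)
  have : u (e j) = 0 := (AddSubgroup.closure_le _).2 hker key
  omega

/-! ### The inverse function theorem -/

/-- A map with invertible derivative has a smooth inverse near the point. -/
theorem exists_contDiffOn_leftInverse {E : Type*} [NormedAddCommGroup E] [NormedSpace ℝ E]
    [CompleteSpace E] {F : Type*} [NormedAddCommGroup F] [NormedSpace ℝ F] {Φ : E → F} {O : Set E}
    (hO : IsOpen O) (hΦ : ContDiffOn ℝ ∞ Φ O) {x : E} (hx : x ∈ O) (A : E ≃L[ℝ] F)
    (hA : HasFDerivAt Φ (A : E →L[ℝ] F) x) :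
    ∃ (U : Set F) (Ψ : F → E), IsOpen U ∧ Φ x ∈ U ∧ ContDiffOn ℝ ∞ Ψ U ∧
      ∀ᶠ z in 𝓝 x, Ψ (Φ z) = z := by
  have hat : ContDiffAt ℝ ∞ Φ x := hΦ.contDiffAt (hO.mem_nhds hx)
  have hne : (∞ : WithTop ℕ∞) ≠ 0 := by simp
  let e := hat.toOpenPartialHomeomorph Φ hA hne
  have he : (e : E → F) = Φ := hat.toOpenPartialHomeomorph_coe hA hne
  have hxe : x ∈ e.source := hat.mem_toOpenPartialHomeomorph_source hA hne
  -- Smoothness of the inverse on an open set needs an invertible derivative at every nearby point;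
  -- invertible operators form an open set and the derivative is continuous.
  have hev : ∀ᶠ z in 𝓝 x, z ∈ O ∧ ∃ B : E ≃L[ℝ] F, HasFDerivAt Φ (B : E →L[ℝ] F) z := by
    have h1 : ContinuousAt (fderiv ℝ Φ) x :=
      (hΦ.continuousOn_fderiv_of_isOpen hO (by simp)).continuousAt (hO.mem_nhds hx)
    have h2 : Set.range ((↑) : (E ≃L[ℝ] F) → E →L[ℝ] F) ∈ 𝓝 (fderiv ℝ Φ x) := by
      rw [hA.fderiv]
      exact A.nhds
    filter_upwards [h1.eventually h2, hO.mem_nhds hx] with z ⟨B, hB⟩ hz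
    refine ⟨hz, B, ?_⟩
    rw [hB]
    exact ((hΦ.contDiffAt (hO.mem_nhds hz)).differentiableAt (by simp)).hasFDerivAt
  obtain ⟨V, hV, hVo, hxV⟩ := mem_nhds_iff.1 hev
  refine ⟨e.target ∩ e.symm ⁻¹' V, e.symm, e.isOpen_inter_preimage_symm hVo, ?_, ?_, ?_⟩
  · rw [← he]
    exact ⟨e.map_source hxe, by rw [Set.mem_preimage, e.left_inv hxe]; exact hxV⟩
  · rintro y ⟨hy, hyV⟩
    obtain ⟨hyO, B, hB⟩ := hV hyV
    refine (e.contDiffAt_symm hy (f₀' := B) ?_ ?_).contDiffWithinAt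
    · rw [he]; exact hB
    · rw [he]; exact hΦ.contDiffAt (hO.mem_nhds hyO)
  · filter_upwards [e.open_source.mem_nhds hxe] with z hz
    rw [← he]
    exact e.left_inv hz

/-- A family of functionals without common zeros contains a basis of the dual space. -/
theorem exists_equiv_of_forall_eq_zero {N : ℕ} {S : Set ((Fin N → ℝ) →L[ℝ] ℝ)}
    (hS : ∀ t, (∀ L ∈ S, L t = 0) → t = 0) :
    ∃ (L : Fin N → (Fin N → ℝ) →L[ℝ] ℝ) (A : (Fin N → ℝ) ≃L[ℝ] (Fin N → ℝ)),
      (∀ j, L j ∈ S) ∧ (A : (Fin N → ℝ) →L[ℝ] (Fin N → ℝ)) = ContinuousLinearMap.pi L := by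
  let T : Set (Module.Dual ℝ (Fin N → ℝ)) :=
    (fun L : (Fin N → ℝ) →L[ℝ] ℝ => (L : (Fin N → ℝ) →ₗ[ℝ] ℝ)) '' S
  have hspan : Submodule.span ℝ T = ⊤ := by
    have h1 : (Submodule.span ℝ T).dualCoannihilator = ⊥ := by
      rw [eq_bot_iff]
      intro t ht
      rw [Submodule.mem_dualCoannihilator] at ht
      exact hS t fun L hL => ht L (Submodule.subset_span ⟨L, hL, rfl⟩)
    rw [← Subspace.dualCoannihilator_dualAnnihilator_eq (W := Submodule.span ℝ T), h1,
      Submodule.dualAnnihilator_bot]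
  obtain ⟨B, hBT, hTB, hB⟩ := exists_linearIndependent ℝ T
  let β : Module.Basis B ℝ (Module.Dual ℝ (Fin N → ℝ)) := Module.Basis.mk hB (by
    rw [Subtype.range_coe, hTB, hspan])
  have : Fintype B := Module.Basis.fintypeIndexOfRankLtAleph0 β (Module.rank_lt_aleph0 ℝ _)
  have hcard : Fintype.card B = N := by
    rw [← Module.finrank_eq_card_basis β, Subspace.dual_finrank_eq, Module.finrank_fin_fun]
  let ε : Fin N ≃ B := (Fintype.equivFinOfCardEq hcard).symm
  choose L hLS hL using fun j => hBT (ε j).2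
  have hinj : Function.Injective (ContinuousLinearMap.pi L : (Fin N → ℝ) →L[ℝ] (Fin N → ℝ)) := by
    rw [injective_iff_map_eq_zero]
    intro t ht
    have h0 : ∀ φ : Module.Dual ℝ (Fin N → ℝ), φ t = 0 := by
      intro φ
      have hφ : φ ∈ Submodule.span ℝ B := by rw [hTB, hspan]; trivial
      induction hφ using Submodule.span_induction with
      | mem φ hφ =>
        have h1 := congrFun ht (ε.symm ⟨φ, hφ⟩)
        have h2 := LinearMap.congr_fun (hL (ε.symm ⟨φ, hφ⟩)) t
        rw [ε.apply_symm_apply] at h2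
        exact h2.symm.trans h1
      | zero => rfl
      | add φ ψ _ _ h h' => rw [LinearMap.add_apply, h, h', add_zero]
      | smul r φ _ h => rw [LinearMap.smul_apply, h, smul_zero]
    exact hS t fun M _ => h0 M
  refine ⟨L, (LinearEquiv.ofInjectiveEndo _ hinj).toContinuousLinearEquiv, hLS, ?_⟩
  ext t j
  rfl

/-- If `ξ : W → ℝᴺ` has smooth composition with sufficiently many functions on `ℝᴺ`, then it is
smooth. -/
theorem GChart.realAt_of_forall_fderiv {W : Type u} [TopologicalSpace W] {c : GChart W}
    (hc : c.IsChart) {w : W} {N : ℕ} {ξ : W → Fin N → ℝ} (hξ : ContinuousAt ξ w)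
    (h : ∀ t : Fin N → ℝ, (∀ (O : Set (Fin N → ℝ)) (g : (Fin N → ℝ) → ℝ), IsOpen O → ξ w ∈ O →
      ContDiffOn ℝ ∞ g O → c.RealAt w (fun z => g (ξ z)) → fderiv ℝ g (ξ w) t = 0) → t = 0)
    (j : Fin N) : c.RealAt w fun z => ξ z j := by
  obtain ⟨L, A, hL, hA⟩ := exists_equiv_of_forall_eq_zero
    (S := {L | ∃ (O : Set (Fin N → ℝ)) (g : (Fin N → ℝ) → ℝ), IsOpen O ∧ ξ w ∈ O ∧
      ContDiffOn ℝ ∞ g O ∧ c.RealAt w (fun z => g (ξ z)) ∧ fderiv ℝ g (ξ w) = L})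
    fun t ht => h t fun O g hO hw hg hgc => ht _ ⟨O, g, hO, hw, hg, hgc, rfl⟩
  choose O g hO hw hg hgc hgL using hL
  -- With `Φ = (g j)` a local diffeomorphism, `ξ = Ψ ∘ (Φ ∘ ξ)` near `w`, and the components of `Φ ∘
  -- ξ` are smooth by assumption.
  obtain ⟨U, Ψ, hU, hwU, hΨ, hinv⟩ := exists_contDiffOn_leftInverse
    (Φ := fun t j => g j t) (isOpen_iInter_of_finite hO)
    (contDiffOn_pi.2 fun j => (hg j).mono (Set.iInter_subset _ j)) (Set.mem_iInter.2 hw) A (by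
      rw [hA, hasFDerivAt_pi']
      intro j
      rw [ContinuousLinearMap.proj_pi, ← hgL j]
      exact (((hg j).contDiffAt ((hO j).mem_nhds (hw j))).differentiableAt (by simp)).hasFDerivAt)
  refine (RealAt.comp hc hgc hU (contDiffOn_pi.1 hΨ j) hwU).congr ?_
  filter_upwards [hξ.eventually hinv] with z hz
  rw [hz]

/-! ### Exponents of pulled back coordinate functions -/

namespace GChart

variable {X : Type u} [TopologicalSpace X] {a : GChart X} {x : X}

theorem HasExp.pow {c : X → ℝ≥0} {p : a.P} (hc : a.HasExp x c p) (n : ℕ) :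
    a.HasExp x (fun z => c z ^ n) (n • p) := by
  obtain ⟨h, hh, h0, e⟩ := hc
  refine ⟨fun z => h z ^ n, hh.pow n, pow_pos h0 n, ?_⟩
  filter_upwards [e] with z hz
  rw [NNReal.coe_pow, hz, mul_pow, lam_nsmul]

theorem HasExp.prod_pow {ι : Type*} (s : Finset ι) {c : ι → X → ℝ≥0} {p : ι → a.P} (m : ι → ℕ)
    (hc : ∀ i ∈ s, m i ≠ 0 → a.HasExp x (c i) (p i)) :
    a.HasExp x (fun z => ∏ i ∈ s, c i z ^ m i) (∑ i ∈ s, m i • p i) := by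
  classical
  induction s using Finset.induction_on with
  | empty =>
    refine ⟨fun _ => 1, continuousAt_const, one_pos, Filter.Eventually.of_forall fun z => ?_⟩
    beta_reduce
    rw [Finset.prod_empty, Finset.sum_empty, lam_zero, NNReal.coe_one, one_mul]
  | insert i s hi ih =>
    rw [Finset.sum_insert hi]
    simp only [Finset.prod_insert hi]
    refine HasExp.mul ?_ (ih fun j hj => hc j (Finset.mem_insert_of_mem hj))
    by_cases hm : m i = 0
    · refine ⟨fun _ => 1, continuousAt_const, one_pos, Filter.Eventually.of_forall fun z => ?_⟩
      beta_reduce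
      rw [hm, pow_zero, zero_smul, lam_zero, NNReal.coe_one, one_mul]
    · exact (hc i (Finset.mem_insert_self i s) hm).pow _

theorem HasExp.frequently_pos (ha : a.IsChart) (hx : x ∈ a.dom) {c : X → ℝ≥0} {p : a.P}
    (hc : a.HasExp x c p) : ∃ᶠ z in 𝓝 x, 0 < c z :=
  ((ha.frequently_supp_eq_top hx).and_eventually hc.eventually_pos_iff).mono
    fun _ hz => hz.2.2 (hz.1.2.symm ▸ p.2)

/-- `c` is near `x` the product of `λ_p` and a smooth positive function. -/
def HasSmoothExp (a : GChart X) (x : X) (c : X → ℝ≥0) (p : a.P) : Prop :=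
  ∃ h : X → ℝ, a.RealAt x h ∧ 0 < h x ∧ ∀ᶠ z in 𝓝 x, (c z : ℝ) = a.lam p z * h z

theorem HasSmoothExp.hasExp (ha : a.IsChart) (hx : x ∈ a.dom) {c : X → ℝ≥0} {p : a.P}
    (hc : a.HasSmoothExp x c p) : a.HasExp x c p := by
  obtain ⟨h, hh, h0, e⟩ := hc
  exact ⟨h, hh.continuousAt ha hx, h0, e⟩

theorem NonnegAt.exists_hasSmoothExp {c : X → ℝ≥0} (hc : a.NonnegAt x c)
    (h0 : ∃ᶠ z in 𝓝 x, 0 < c z) : ∃ p, a.HasSmoothExp x c p := by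
  rcases hc with h | h
  · exact h
  · obtain ⟨z, hz, hz'⟩ := (h0.and_eventually h).exists
    exact absurd hz' hz.ne'

/-- Functions that agree on the interior agree. -/
theorem IsChart.eventually_eq_of_supp_eq_top (ha : a.IsChart) (hx : x ∈ a.dom) {h h' : X → ℝ}
    (hh : ∀ᶠ z in 𝓝 x, ContinuousAt h z) (hh' : ∀ᶠ z in 𝓝 x, ContinuousAt h' z)
    (H : ∀ᶠ z in 𝓝 x, (a.coord z).supp = a.P → h z = h' z) : ∀ᶠ z in 𝓝 x, h z = h' z := by
  filter_upwards [hh, hh', H.eventually_nhds, ha.dom_mem_nhds hx] with z h1 h2 h3 h4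
  by_contra hne
  obtain ⟨y, hy, hy', hy''⟩ := ((ha.frequently_supp_eq_top h4).and_eventually
    (h3.and (((h1.sub h2).eventually_ne (sub_ne_zero.2 hne))))).exists
  exact hy'' (sub_eq_zero.2 (hy' hy.2))

/-- The exponents in the chart `a` around `x` of the pullbacks along `i` of the functions
`λ_q` of the chart `b`. -/
def exponents {Y : Type v} (ha : a.IsChart) (x : X) (b : GChart Y) (i : X → Y) :
    AddSubmonoid (Fin a.k → ℤ) where
  carrier := {p | ∃ (hp : p ∈ a.P) (q : b.P),
    a.HasSmoothExp x (fun z => (b.coord (i z)).1 q) ⟨p, hp⟩}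
  zero_mem' := by
    refine ⟨zero_mem _, 0, fun _ => 1, realAt_const a x 1, one_pos,
      Filter.Eventually.of_forall fun z => ?_⟩
    beta_reduce
    rw [Model.apply_zero, NNReal.coe_one, mul_one]
    exact (a.lam_zero z).symm
  add_mem' := by
    rintro p p' ⟨hp, q, h, hh, h0, e⟩ ⟨hp', q', h', hh', h0', e'⟩
    refine ⟨add_mem hp hp', q + q', fun z => h z * h' z, hh.mul ha hh', mul_pos h0 h0', ?_⟩
    filter_upwards [e, e'] with z hz hz'
    rw [Model.apply_add, NNReal.coe_mul, hz, hz', mul_mul_mul_comm]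
    exact congrArg (· * _) (a.lam_add ⟨p, hp⟩ ⟨p', hp'⟩ z).symm

theorem exponents_le {Y : Type v} (ha : a.IsChart) (b : GChart Y) (i : X → Y) :
    exponents ha x b i ≤ a.P := fun _ hp => hp.1

end GChart

/-! ### Consequences of the immersion conditions in charts -/

section Immersion

variable {X : GSpace.{u}} {Y : GSpace.{v}} {i : X → Y} (hX : X.IsMixed) (hY : Y.IsMixed)
  (hi : IsImmersion i) {a : GChart X} (ha : a ∈ X.atlas) {b : GChart Y} (hb : b ∈ Y.atlas)
  {x : X} (hxa : x ∈ a.dom) (hxb : i x ∈ b.dom)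
include hX hY hi ha hb hxa hxb

/-- The exponents of an immersion generate all faces. -/
theorem IsImmersion.mem_closure_exponents {F : AddSubmonoid (Fin a.k → ℤ)} (hF : IsFace F a.P)
    (hxF : (a.coord x).supp ≤ F) {p : Fin a.k → ℤ} (hp : p ∈ F) :
    p ∈ AddSubgroup.closure (((a.coord x).supp : Set (Fin a.k → ℤ)) ∪
      (GChart.exponents (hX.isChart a ha) x b i ⊓ F : AddSubmonoid (Fin a.k → ℤ))) := by
  obtain ⟨γ, hγ⟩ := LocalCorner.exists_of_isFace hX ha hxa hF hxF
  let z : corners X := ⟨x, γ⟩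
  have hz : z ∈ (faceChart a hF).dom := ⟨hxa, hγ⟩
  obtain ⟨G, hG, V, hVo, hzV, hVab, hVG, hVC⟩ :=
    hi.1.exists_nhds_cornerMap_mem hX hY ha hb hF hz hxb
  have hzG := hVC z hz hzV
  have hac := isChart_faceChart hX ha hF
  have hfst := continuousAt_fst hX z
  -- Exponents on the corner have to be realized by exponents of `i` on `X`. As `C(i)` is interior,
  -- `λ_q ∘ i` is not zero near `x` even on the corner, so it has an exponent `p'` on `X`; and `p' ∈
  -- F` because `λ_{p'}` would otherwise vanish on the corner.
  have hφ : ∀ q : (faceChart b hG).P, ∃ p : (faceChart a hF).P, (faceChart a hF).HasExp z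
      (fun z' => ((faceChart b hG).coord (cornerMap i z')).1 q) p ∧
      p.1 ∈ GChart.exponents (hX.isChart a ha) x b i := by
    intro q
    obtain ⟨p₀, hp₀⟩ := hi.2.isInterior.exists_exp (isMixed_corners hX) (isMixed_corners hY)
      (faceChart_mem ha hF) (faceChart_mem hb hG) hz hzG q
    have hfreq := hp₀.frequently_pos hac hz
    have hfreq' : ∃ᶠ z' in 𝓝 z, 0 < (b.coord (i (cornerBase z'))).1 ⟨q.1, hG.le q.2⟩ := hfreq
    obtain ⟨p', hp'⟩ := ((hi.1.mapAt hX hY ha hb hxa hxb).nonnegAt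
      ⟨q.1, hG.le q.2⟩).exists_hasSmoothExp (hfst.frequently hfreq')
    obtain ⟨h, hh, h0, e⟩ := id hp'
    have he := hfst.eventually e
    have hp'F : (p' : Fin a.k → ℤ) ∈ F := by
      obtain ⟨z', h1, h2, h3⟩ := (hfreq'.and_eventually (he.and (hac.dom_mem_nhds hz))).exists
      refine supp_coord_le_of_mem hX ha hF h3 (GChart.lam_pos_iff.1 ?_)
      refine lt_of_le_of_ne (a.lam_nonneg _ _) fun h4 => ?_
      rw [← h4, zero_mul] at h2
      exact h1.ne' (NNReal.coe_eq_zero.1 h2)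
    refine ⟨⟨p'.1, hp'F⟩, ⟨fun z' => h (cornerBase z'), ?_, h0, he⟩, p'.2, _, hp'⟩
    exact ContinuousAt.comp (g := h) (hh.continuousAt (hX.isChart a ha) hxa) hfst
  choose φ hφ hφE using hφ
  refine AddSubgroup.closure_mono (Set.union_subset_union ?_ ?_)
    (hi.2.mem_closure (isMixed_corners hX) (isMixed_corners hY) (faceChart_mem ha hF)
      (faceChart_mem hb hG) hz hzG hφ (p := p) hp)
  · rw [supp_faceChart hX ha hF hz]
    exact subset_rfl
  · rintro _ ⟨q, rfl⟩
    exact ⟨hφE q, (φ q).2⟩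

/-- A multiple of any `p` is, modulo units, an exponent of the immersion. -/
theorem IsImmersion.exists_nsmul_add_eq {p : Fin a.k → ℤ} (hp : p ∈ a.P) :
    ∃ n : ℕ, 1 ≤ n ∧ ∃ e ∈ GChart.exponents (hX.isChart a ha) x b i,
      ∃ f ∈ (a.coord x).supp, ∃ f' ∈ (a.coord x).supp, n • p + f' = e + f := by
  classical
  have hac := hX.isChart a ha
  obtain ⟨M, r, hr⟩ := exists_generators (hY.isChart b hb).weaklyToric.fg
  -- The exponents of the generators of `b.P` suffice to test nonnegativity on all exponents. The
  -- value `0` serves for generators whose pullback vanishes near `x`.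
  have hψ : ∀ j, ∃ p : a.P, (p : Fin a.k → ℤ) ∈ GChart.exponents (hX.isChart a ha) x b i ∧
      ((∃ p', a.HasSmoothExp x (fun z => (b.coord (i z)).1 (r j)) p') →
        a.HasSmoothExp x (fun z => (b.coord (i z)).1 (r j)) p) := by
    intro j
    by_cases h : ∃ p', a.HasSmoothExp x (fun z => (b.coord (i z)).1 (r j)) p'
    · obtain ⟨p', hp'⟩ := h
      exact ⟨p', ⟨p'.2, r j, hp'⟩, fun _ => hp'⟩
    · exact ⟨0, zero_mem _, fun h' => absurd h' h⟩
  choose ψ hψE hψ using hψ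
  refine GCorners.exists_nsmul_add_eq hac.weaklyToric.fg (a.coord x).isFace_supp
    (GChart.exponents_le hac b i) (l := List.ofFn fun j => (ψ j : Fin a.k → ℤ)) ?_ ?_
    (fun F hF hxF p hp => hi.mem_closure_exponents hX hY ha hb hxa hxb hF hxF hp) hp
  · intro p hp
    obtain ⟨j, rfl⟩ := List.mem_ofFn.1 hp
    exact hψE j
  -- If `λ_q ∘ i` has an exponent, no generator occurring in `q` pulls back to zero, so `e` agrees
  -- with `∑ m j • ψ j` modulo the support, where `v` vanishes.
  · rintro v hv hvl e ⟨he, q, hq⟩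
    obtain ⟨m, hm⟩ := hr q
    have hfreq := (hq.hasExp hac hxa).frequently_pos hac hxa
    have hexp := GChart.HasExp.prod_pow (a := a) (x := x) Finset.univ
      (c := fun j z => (b.coord (i z)).1 (r j)) (p := ψ) m (by
        intro j _ hj
        refine (hψ j (((hi.1.mapAt hX hY ha hb hxa hxb).nonnegAt (r j)).exists_hasSmoothExp
          (hfreq.mono fun z hz => ?_))).hasExp hac hxa
        rw [hm, Model.pos_iff_mem_supp, Model.sum_mem_supp_iff] at hz
        exact Model.pos_iff_mem_supp.2 (hz j hj))
    have hexp' := hexp.congr (c' := fun z => (b.coord (i z)).1 q)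
      (Filter.Eventually.of_forall fun z => by rw [hm, Model.apply_sum])
    have huniq := (hq.hasExp hac hxa).unique hac hxa hexp'
      ((Int.castAddHom ℝ).comp (v.comp a.P.subtype)) fun q hq => by
        change ((v q : ℤ) : ℝ) = 0
        rw [hv _ hq, Int.cast_zero]
    rw [map_sum] at huniq
    have h1 : ((v e : ℤ) : ℝ) = ∑ j, (m j : ℝ) * (v (ψ j) : ℤ) := by
      refine huniq.trans (Finset.sum_congr rfl fun j _ => ?_)
      rw [map_nsmul, nsmul_eq_mul]
      rfl
    have h2 : (0 : ℝ) ≤ (v e : ℤ) := by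
      rw [h1]
      exact Finset.sum_nonneg fun j _ => mul_nonneg (Nat.cast_nonneg _)
        (by exact_mod_cast hvl _ (List.mem_ofFn.2 ⟨j, rfl⟩))
    exact_mod_cast h2

/-- A tangent vector of the stratum that is killed by an immersion is zero. -/
theorem IsImmersion.eq_zero_of_fderiv {N : ℕ} {e : Fin N → a.P} (v : (a.coord x).supp →+ ℝ)
    (H : ∀ q : b.P, ∃ (O : Set (Fin N → ℝ)) (g : (Fin N → ℝ) → ℝ), IsOpen O ∧ ContDiffOn ℝ ∞ g O ∧
      (fun j => a.lam (e j) x) ∈ O ∧ (∀ᶠ z in 𝓝 x, b.lam q (i z) = g fun j => a.lam (e j) z) ∧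
      fderiv ℝ g (fun j => a.lam (e j) x) (fun j =>
        haveI : Nonempty X := ⟨x⟩
        a.dlam x v (e j)) = 0) : v = 0 := by
  -- The derivative condition concerns `C(i)`. It is used at the local component of the interior,
  -- whose face is all of `a.P`, so that its chart has the same coordinates as `a`.
  have hF := IsFace.refl a.P
  obtain ⟨γ, hγ⟩ := LocalCorner.exists_of_isFace hX ha hxa hF (a.coord x).isFace_supp.le
  let z : corners X := ⟨x, γ⟩
  have : Nonempty X := ⟨x⟩
  have : Nonempty (corners X) := ⟨z⟩
  have hz : z ∈ (faceChart a hF).dom := ⟨hxa, hγ⟩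
  obtain ⟨G, hG, V, hVo, hzV, hVab, hVG, hVC⟩ :=
    hi.1.exists_nhds_cornerMap_mem hX hY ha hb hF hz hxb
  have hzG := hVC z hz hzV
  have hac := isChart_faceChart hX ha hF
  have hmap := hi.2.isInterior.1.mapAt (isMixed_corners hX) (isMixed_corners hY)
    (faceChart_mem ha hF) (faceChart_mem hb hG) hz hzG
  -- The derivative of `λ_q ∘ C(i)` along a line is both the given differential and `λ_q` times the
  -- component of `stratumDeriv`. Here `λ_q` is positive, so the component vanishes with the
  -- differential.
  have key : ∀ u : ((faceChart a hF).coord z).supp →+ ℝ, (∀ q : b.P,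
      ∃ (O : Set (Fin N → ℝ)) (g : (Fin N → ℝ) → ℝ), IsOpen O ∧ ContDiffOn ℝ ∞ g O ∧
      (fun j => a.lam (e j) x) ∈ O ∧ (∀ᶠ z in 𝓝 x, b.lam q (i z) = g fun j => a.lam (e j) z) ∧
      fderiv ℝ g (fun j => a.lam (e j) x) (fun j => (faceChart a hF).dlam z u (e j)) = 0) →
      stratumDeriv (cornerMap i) z (faceChart a hF) (faceChart b hG) u = 0 := by
    intro u hu
    funext q
    obtain ⟨O, g, hO, hg, hxO, hev, h0⟩ := hu ⟨q.1, hG.le q.2.1⟩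
    have hγ0 : cornerBase ((faceChart a hF).line z u 0) = x := by
      rw [GChart.line_zero hac hz]
      rfl
    have hγt : Filter.Tendsto (fun t => cornerBase ((faceChart a hF).line z u t)) (𝓝 0) (𝓝 x) :=
      (continuousAt_fst hX z).tendsto.comp (GChart.tendsto_line hac hz u)
    have h1 := GChart.hasDerivAt_comp_curve hO hg hxO hev hγ0 hγt
      (δ := fun p => (faceChart a hF).dlam z u p)
      (fun p => GChart.hasDerivAt_lam_line hac hz u p)
    rw [h0] at h1
    have h2 := ((hasDerivAt_lam_map_line hac hz hmap u ⟨q.1, q.2.1⟩).1 q.2).2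
    have h3 := HasDerivAt.unique h2 h1
    refine (mul_eq_zero.1 h3).resolve_left (GChart.lam_pos_iff.2 ?_).ne'
    exact q.2
  refine hi.2.deriv_injective z _ (faceChart_mem ha hF) hz _ (faceChart_mem hb hG) hzG
    ((key v H).trans (key 0 fun q => ?_).symm)
  obtain ⟨O, g, hO, hg, hxO, hev, -⟩ := H q
  refine ⟨O, g, hO, hg, hxO, hev, ?_⟩
  have : (fun j => (faceChart a hF).dlam z 0 (e j)) = 0 := by
    funext j
    simp [GChart.dlam]
  rw [this, map_zero]

end Immersion

/-! ### Lifting smooth maps along immersions -/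

theorem GChart.lam_mul_eq {X : Type u} {a : GChart X} {n : ℕ} {p e f f' : Fin a.k → ℤ}
    (hp : p ∈ a.P) (he : e ∈ a.P) (hf : f ∈ a.P) (hf' : f' ∈ a.P) (h : n • p + f' = e + f)
    (z : X) : a.lam ⟨p, hp⟩ z ^ n * a.lam ⟨f', hf'⟩ z = a.lam ⟨e, he⟩ z * a.lam ⟨f, hf⟩ z := by
  rw [← GChart.lam_nsmul, ← GChart.lam_add, ← GChart.lam_add]
  exact congrArg (fun p => a.lam p z) (Subtype.ext h)

section Lift

theorem GChart.RealAt.eventually_continuousAt_comp {W : Type u} [TopologicalSpace W] {X : Type v}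
    [TopologicalSpace X] {g : W → X} {x : W} {a : GChart X} (hg : Continuous g) (ha : a.IsChart)
    (hxa : g x ∈ a.dom) {h : X → ℝ} (hh : a.RealAt (g x) h) :
    ∀ᶠ z in 𝓝 x, ContinuousAt (fun z => h (g z)) z := by
  filter_upwards [hg.continuousAt.eventually (hh.eventually ha hxa),
    hg.continuousAt.eventually (ha.dom_mem_nhds hxa)] with z h1 h2
  exact ContinuousAt.comp (g := h) (h1.continuousAt ha h2) hg.continuousAt

variable {W : GSpace.{u}} {X : GSpace.{v}} {Y : GSpace.{w}} {i : X → Y} {g : W → X}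
  (hW : W.IsMixed) (hX : X.IsMixed) (hY : Y.IsMixed)
  (hi : IsImmersion i) (hf : IsSmooth (i ∘ g)) (hg : Continuous g)
  {c : GChart W} (hc : c ∈ W.atlas) {a : GChart X} (ha : a ∈ X.atlas)
  {b : GChart Y} (hb : b ∈ Y.atlas) {x : W} (hxc : x ∈ c.dom) (hxa : g x ∈ a.dom)
  (hxb : i (g x) ∈ b.dom)
include hW hX hY hi hf hg hc ha hb hxc hxa hxb

/-- Each `λ_p ∘ g` is near `x` either positive at all interior points, or zero. -/
theorem IsImmersion.eventually_lam_pos_or_eq_zero (p : a.P) :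
    (∀ᶠ z in 𝓝 x, (c.coord z).supp = c.P → 0 < a.lam p (g z)) ∨
      ∀ᶠ z in 𝓝 x, a.lam p (g z) = 0 := by
  have hac := hX.isChart a ha
  -- Up to positive factors `λ_p ^ n` is `λ_e`, and `λ_e` is `λ_q ∘ i`. So near `x` the functions
  -- `λ_p ∘ g` and `λ_q ∘ i ∘ g` have the same zeros, and the dichotomy is known for the second.
  obtain ⟨n, hn, e, ⟨he, q, h, hh, h0, hq⟩, f₁, hf₁, f₂, hf₂, hnp⟩ :=
    hi.exists_nsmul_add_eq hX hY ha hb hxa hxb p.2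
  have hev : ∀ᶠ z in 𝓝 x, 0 < a.lam ⟨f₁, hf₁.1⟩ (g z) ∧ 0 < a.lam ⟨f₂, hf₂.1⟩ (g z) ∧
      0 < h (g z) ∧ b.lam q (i (g z)) = a.lam ⟨e, he⟩ (g z) * h (g z) := by
    filter_upwards [hg.continuousAt.eventually (hac.eventually_supp_le hxa),
      hg.continuousAt.eventually ((hh.continuousAt hac hxa).eventually_const_lt h0),
      hg.continuousAt.eventually hq] with z h1 h2 h3
    exact ⟨GChart.lam_pos_iff.2 (h1 hf₁), GChart.lam_pos_iff.2 (h1 hf₂), h2, h3⟩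
  rcases (hf.mapAt hW hY hc hb hxc hxb).nonnegAt q with ⟨p', k, hk, k0, hp'⟩ | hzero
  · left
    filter_upwards [hev, hp', (hk.continuousAt (hW.isChart c hc) hxc).eventually_const_lt k0]
      with z ⟨h1, h2, h3, h4⟩ h5 h6 hz
    have h7 : 0 < b.lam q (i (g z)) := by
      have : b.lam q (i (g z)) = c.lam p' z * k z := h5
      rw [this]
      exact mul_pos (GChart.lam_pos_iff.2 (hz.symm ▸ p'.2)) h6
    have h8 := GChart.lam_mul_eq p.2 he hf₁.1 hf₂.1 hnp (g z)
    refine lt_of_le_of_ne (a.lam_nonneg _ _) fun h9 => ?_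
    rw [h4] at h7
    have h10 : 0 < a.lam ⟨e, he⟩ (g z) := pos_of_mul_pos_left h7 h3.le
    rw [Subtype.coe_eta, ← h9, zero_pow (by omega), zero_mul] at h8
    exact (mul_pos h10 h1).ne h8
  · right
    filter_upwards [hev, hzero] with z ⟨h1, h2, h3, h4⟩ h5
    have h6 : b.lam q (i (g z)) = 0 := NNReal.coe_eq_zero.2 h5
    rw [h6, eq_comm, mul_eq_zero, or_iff_left h3.ne'] at h4
    have h8 := GChart.lam_mul_eq p.2 he hf₁.1 hf₂.1 hnp (g z)
    rw [h4, zero_mul, mul_eq_zero, or_iff_left h2.ne'] at h8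
    exact eq_zero_of_pow_eq_zero h8

/-- The face of those `p` for which `λ_p ∘ g` does not vanish near `x`. -/
theorem IsImmersion.exists_liftFace : ∃ F, IsFace F a.P ∧ (a.coord (g x)).supp ≤ F ∧
    (∀ p : a.P, (p : Fin a.k → ℤ) ∈ F →
      ∀ᶠ z in 𝓝 x, (c.coord z).supp = c.P → 0 < a.lam p (g z)) ∧
    ∀ p : a.P, (p : Fin a.k → ℤ) ∉ F → ∀ᶠ z in 𝓝 x, a.lam p (g z) = 0 := by
  let F : AddSubmonoid (Fin a.k → ℤ) :=
    { carrier := {p | ∃ hp : p ∈ a.P,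
        ∀ᶠ z in 𝓝 x, (c.coord z).supp = c.P → 0 < a.lam ⟨p, hp⟩ (g z)}
      zero_mem' := ⟨zero_mem _, Filter.Eventually.of_forall fun z _ => by
        rw [show (⟨0, zero_mem _⟩ : a.P) = 0 from rfl, GChart.lam_zero]
        exact one_pos⟩
      add_mem' := by
        rintro p q ⟨hp, h⟩ ⟨hq, h'⟩
        refine ⟨add_mem hp hq, ?_⟩
        filter_upwards [h, h'] with z h1 h2 hz
        rw [show (⟨p + q, add_mem hp hq⟩ : a.P) = ⟨p, hp⟩ + ⟨q, hq⟩ from rfl, GChart.lam_add]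
        exact mul_pos (h1 hz) (h2 hz) }
  refine ⟨F, ⟨fun p hp => hp.1, ?_⟩, ?_, fun p hp => hp.2, fun p hp => ?_⟩
  · rintro p hp q hq ⟨_, h⟩
    have h' : ∀ᶠ z in 𝓝 x, (c.coord z).supp = c.P →
        0 < a.lam ⟨p, hp⟩ (g z) ∧ 0 < a.lam ⟨q, hq⟩ (g z) := by
      filter_upwards [h] with z h1 hz
      have h2 := h1 hz
      rw [show (⟨p + q, add_mem hp hq⟩ : a.P) = ⟨p, hp⟩ + ⟨q, hq⟩ from rfl, GChart.lam_add] at h2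
      exact ⟨pos_of_mul_pos_left h2 (a.lam_nonneg _ _), pos_of_mul_pos_right h2 (a.lam_nonneg _ _)⟩
    exact ⟨⟨hp, h'.mono fun z h1 hz => (h1 hz).1⟩, ⟨hq, h'.mono fun z h1 hz => (h1 hz).2⟩⟩
  · intro p hp
    refine ⟨hp.1, ?_⟩
    filter_upwards [hg.continuousAt.eventually ((hX.isChart a ha).eventually_supp_le hxa)]
      with z h1 _
    exact GChart.lam_pos_iff.2 (h1 hp)
  · exact (hi.eventually_lam_pos_or_eq_zero hW hX hY hf hg hc ha hb hxc hxa hxb p).resolve_left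
      fun h => hp ⟨p.2, h⟩

omit hi in
/-- For exponents `e` of `i` with `λ_e ∘ g` not vanishing near `x`, the function `λ_e ∘ g` is
smooth up to a positive smooth function on `X`. -/
theorem exists_lam_mul_eq_of_mem_exponents {e : Fin a.k → ℤ}
    (he : e ∈ GChart.exponents (hX.isChart a ha) (g x) b i)
    (hpos : ∀ᶠ z in 𝓝 x, (c.coord z).supp = c.P → 0 < a.lam ⟨e, he.1⟩ (g z)) :
    ∃ (h : X → ℝ) (r : c.P) (k : W → ℝ), a.RealAt (g x) h ∧ 0 < h (g x) ∧ c.RealAt x k ∧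
      0 < k x ∧ ∀ᶠ z in 𝓝 x, a.lam ⟨e, he.1⟩ (g z) * h (g z) = c.lam r z * k z := by
  have hac := hX.isChart a ha
  have hcc := hW.isChart c hc
  obtain ⟨he, q, h, hh, h0, hq⟩ := he
  have hev := hg.continuousAt.eventually hq
  obtain ⟨r, k, hk, k0, hr⟩ := ((hf.mapAt hW hY hc hb hxc hxb).nonnegAt q).exists_hasSmoothExp (by
    refine ((hcc.frequently_supp_eq_top hxc).and_eventually (hpos.and (hev.and
      (hg.continuousAt.eventually ((hh.continuousAt hac hxa).eventually_const_lt h0))))).mono ?_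
    rintro z ⟨h1, h2, h3, h4⟩
    refine NNReal.coe_pos.1 ?_
    exact (mul_pos (h2 h1.2) h4).trans_eq h3.symm)
  refine ⟨h, r, k, hh, h0, hk, k0, ?_⟩
  filter_upwards [hev, hr] with z h1 h2
  exact h1.symm.trans h2

/-- Each nonvanishing `λ_p ∘ g` is smooth up to a positive smooth function on `X`. -/
theorem IsImmersion.exists_smooth_factor {F : AddSubmonoid (Fin a.k → ℤ)} (hF : IsFace F a.P)
    (hxF : (a.coord (g x)).supp ≤ F)
    (hFpos : ∀ p : a.P, (p : Fin a.k → ℤ) ∈ F →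
      ∀ᶠ z in 𝓝 x, (c.coord z).supp = c.P → 0 < a.lam p (g z)) {p : a.P}
    (hp : (p : Fin a.k → ℤ) ∈ F) :
    ∃ (H : X → ℝ) (p' : c.P) (K : W → ℝ), a.RealAt (g x) H ∧ 0 < H (g x) ∧ c.RealAt x K ∧
      0 < K x ∧ ∀ᶠ z in 𝓝 x, a.lam p (g z) * H (g z) = c.lam p' z * K z := by
  have hac := hX.isChart a ha
  have hcc := hW.isChart c hc
  -- Two relations are used: `p = e₁ - e₂` modulo the support expresses `λ_p ∘ g` as a quotient, and
  -- `n • p = e₃` modulo the support shows that this quotient has a power without denominator.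
  obtain ⟨e₁, ⟨he₁, he₁F⟩, e₂, ⟨he₂, he₂F⟩, f₁, hf₁, f₂, hf₂, h12⟩ := exists_add_eq_of_mem_closure
    (hi.mem_closure_exponents hX hY ha hb hxa hxb hF hxF hp)
  obtain ⟨n, hn, e₃, he₃, f₃, hf₃, f₄, hf₄, h34⟩ :=
    hi.exists_nsmul_add_eq hX hY ha hb hxa hxb p.2
  have he₃F : e₃ ∈ F := (hF.mem_of_add_mem e₃ he₃.1 f₃ hf₃.1 (by
    rw [← h34]
    exact add_mem (F.nsmul_mem hp n) (hxF hf₄))).1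
  obtain ⟨h₁, r₁, k₁, hh₁, h₁0, hk₁, k₁0, H₁⟩ := exists_lam_mul_eq_of_mem_exponents hW hX hY hf
    hg hc ha hb hxc hxa hxb he₁ (hFpos _ he₁F)
  obtain ⟨h₂, r₂, k₂, hh₂, h₂0, hk₂, k₂0, H₂⟩ := exists_lam_mul_eq_of_mem_exponents hW hX hY hf
    hg hc ha hb hxc hxa hxb he₂ (hFpos _ he₂F)
  obtain ⟨h₃, r₃, k₃, hh₃, h₃0, hk₃, k₃0, H₃⟩ := exists_lam_mul_eq_of_mem_exponents hW hX hY hf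
    hg hc ha hb hxc hxa hxb he₃ (hFpos _ he₃F)
  -- the functions `λ_f`, `f ∈ F₀`, are positive near `x`
  have hpos : ∀ {f} (hf : f ∈ (a.coord (g x)).supp), 0 < a.lam ⟨f, hf.1⟩ (g x) :=
    fun hf => GChart.lam_pos_iff.2 hf
  let lf : ∀ {f}, f ∈ (a.coord (g x)).supp → X → ℝ := fun {f} hf => a.lam ⟨f, hf.1⟩
  have hlf : ∀ {f} (hf : f ∈ (a.coord (g x)).supp), a.RealAt (g x) (lf hf) :=
    fun hf => GChart.realAt_lam _ _ _
  let H : X → ℝ := fun z => (h₁ z * lf hf₂ z) * (h₂ z * lf hf₁ z)⁻¹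
  have hden : 0 < h₂ (g x) * lf hf₁ (g x) := mul_pos h₂0 (hpos hf₁)
  have hH : a.RealAt (g x) H :=
    (hh₁.mul hac (hlf hf₂)).mul hac ((hh₂.mul hac (hlf hf₁)).inv hac hden.ne')
  have hH0 : 0 < H (g x) := mul_pos (mul_pos h₁0 (hpos hf₂)) (inv_pos.2 hden)
  have evpos : ∀ {h : X → ℝ}, a.RealAt (g x) h → 0 < h (g x) → ∀ᶠ z in 𝓝 x, 0 < h (g z) :=
    fun hh h0 => hg.continuousAt.eventually ((hh.continuousAt hac hxa).eventually_const_lt h0)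
  have evpos' : ∀ {k : W → ℝ}, c.RealAt x k → 0 < k x → ∀ᶠ z in 𝓝 x, 0 < k z :=
    fun hk k0 => (hk.continuousAt hcc hxc).eventually_const_lt k0
  have hy : ∀ᶠ z in 𝓝 x,
      (a.lam p (g z) * H (g z)) * (c.lam r₂ z * k₂ z) = c.lam r₁ z * k₁ z := by
    filter_upwards [H₁, H₂, evpos hh₂ h₂0, evpos (hlf hf₁) (hpos hf₁)] with z e1 e2 e3 e4
    have e5 : a.lam p (g z) * a.lam ⟨e₂, he₂.1⟩ (g z) * lf hf₂ (g z) =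
        a.lam ⟨e₁, he₁.1⟩ (g z) * lf hf₁ (g z) := by
      rw [← GChart.lam_add, ← GChart.lam_add, ← GChart.lam_add]
      exact congrArg (fun p => a.lam p (g z)) (Subtype.ext h12)
    rw [← e1, ← e2]
    have e3' := e3.ne'
    have e4' := e4.ne'
    change a.lam p (g z) * ((h₁ (g z) * lf hf₂ (g z)) * (h₂ (g z) * lf hf₁ (g z))⁻¹) * _ = _
    field_simp
    linear_combination h₁ (g z) * e5
  -- compare exponents
  obtain ⟨s, hs, t, ht, hst⟩ : ∃ s ∈ (c.coord x).supp, ∃ t ∈ (c.coord x).supp,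
      n • (r₁ : Fin c.k → ℤ) - (n • (r₂ : Fin c.k → ℤ) + r₃) = s - t := by
    refine mem_closure_iff_exists_sub.1
      ((c.coord x).isFace_supp.mem_closure_of_forall_eq_zero hcc.weaklyToric ?_ ?_)
    · exact mem_closure_iff_exists_sub.2 ⟨_, c.P.nsmul_mem r₁.2 n, _,
        add_mem (c.P.nsmul_mem r₂.2 n) r₃.2, rfl⟩
    · intro v hv
      -- The factors contain `H ∘ g` and other functions composed with `g`, which are not yet known
      -- to be smooth; comparing exponents needs only continuity.
      have hmain := hcc.eq_of_lam_mul_eq hxc (IsFace.refl c.P) (c.coord x).isFace_supp.le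
        (p := n • r₁) (p' := n • r₂ + r₃) (SetLike.coe_mem _) (SetLike.coe_mem _)
        (h := fun z => k₁ z ^ n * (h₃ (g z) * lf hf₄ (g z)))
        (h' := fun z => k₂ z ^ n * k₃ z * (lf hf₃ (g z) * H (g z) ^ n)) ?_ ?_ ?_ ?_ ?_
        ((Int.castAddHom ℝ).comp v) (fun f hf => by
          change ((v f : ℤ) : ℝ) = 0
          rw [hv f hf, Int.cast_zero])
      · have : ((v (n • r₁ : c.P) : ℤ) : ℝ) = (v (n • r₂ + r₃ : c.P) : ℤ) := hmain
        have h' : v (n • (r₁ : Fin c.k → ℤ)) = v (n • (r₂ : Fin c.k → ℤ) + r₃) := by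
          exact_mod_cast this
        rw [map_sub, h', sub_self]
      · exact ((hk₁.continuousAt hcc hxc).pow n).mul
          ((ContinuousAt.comp (g := h₃) (hh₃.continuousAt hac hxa) hg.continuousAt).mul
            (ContinuousAt.comp (g := lf hf₄) ((hlf hf₄).continuousAt hac hxa) hg.continuousAt))
      · exact mul_pos (pow_pos k₁0 n) (mul_pos h₃0 (hpos hf₄))
      · exact (((hk₂.continuousAt hcc hxc).pow n).mul (hk₃.continuousAt hcc hxc)).mul
          ((ContinuousAt.comp (g := lf hf₃) ((hlf hf₃).continuousAt hac hxa) hg.continuousAt).mul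
            ((ContinuousAt.comp (g := H) (hH.continuousAt hac hxa) hg.continuousAt).pow n))
      · exact mul_pos (mul_pos (pow_pos k₂0 n) k₃0) (mul_pos (hpos hf₃) (pow_pos hH0 n))
      · filter_upwards [hy, H₃] with z e1 e2 _ _
        have e3 := GChart.lam_mul_eq p.2 he₃.1 hf₃.1 hf₄.1 h34 (g z)
        rw [Subtype.coe_eta] at e3
        change a.lam p (g z) ^ n * lf hf₄ (g z) = _ * lf hf₃ (g z) at e3
        rw [GChart.lam_add, GChart.lam_nsmul, GChart.lam_nsmul]
        calc c.lam r₁ z ^ n * (k₁ z ^ n * (h₃ (g z) * lf hf₄ (g z)))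
            = (c.lam r₁ z * k₁ z) ^ n * (h₃ (g z) * lf hf₄ (g z)) := by ring
          _ = (a.lam p (g z) ^ n * lf hf₄ (g z)) * H (g z) ^ n * (c.lam r₂ z * k₂ z) ^ n *
              h₃ (g z) := by rw [← e1]; ring
          _ = (a.lam ⟨e₃, he₃.1⟩ (g z) * h₃ (g z)) * lf hf₃ (g z) * H (g z) ^ n *
              (c.lam r₂ z * k₂ z) ^ n := by rw [e3]; ring
          _ = _ := by rw [e2]; ring
  -- Saturation: `n` times this element is `r₃ + s + (n - 1) • t`. Adding `t` costs only the factor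
  -- `λ_t`, which is positive at `x`.
  have hp' : (r₁ : Fin c.k → ℤ) - r₂ + t ∈ c.P := by
    refine hcc.weaklyToric.saturated _ (mem_closure_iff_exists_sub.2 ⟨r₁ + t, add_mem r₁.2 ht.1,
      r₂, r₂.2, by abel⟩) n hn ?_
    have : n • ((r₁ : Fin c.k → ℤ) - r₂ + t) = r₃ + s + (n - 1) • t := by
      obtain ⟨m, rfl⟩ : ∃ m, n = m + 1 := ⟨n - 1, by omega⟩
      rw [Nat.add_sub_cancel, smul_add, smul_sub, add_smul m 1 t, one_smul]
      linear_combination (exp := 1) hst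
    rw [this]
    exact add_mem (add_mem r₃.2 hs.1) (c.P.nsmul_mem ht.1 _)
  have ht0 : 0 < c.lam ⟨t, ht.1⟩ x := GChart.lam_pos_iff.2 ht
  have hlt : c.RealAt x (c.lam ⟨t, ht.1⟩) := GChart.realAt_lam _ _ _
  have hden' : 0 < k₂ x * c.lam ⟨t, ht.1⟩ x := mul_pos k₂0 ht0
  have hK := hk₁.mul hcc ((hk₂.mul hcc hlt).inv hcc hden'.ne')
  refine ⟨H, ⟨_, hp'⟩, _, hH, hH0, hK, mul_pos k₁0 (inv_pos.2 hden'), ?_⟩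
  -- Division by `λ_{r₂}` is possible only at interior points. These are dense and both sides are
  -- continuous, so the identity extends.
  refine hcc.eventually_eq_of_supp_eq_top hxc (((GChart.realAt_lam a (g x) p).mul hac
    hH).eventually_continuousAt_comp hg hac hxa) ?_ ?_
  · filter_upwards [((GChart.realAt_lam c x ⟨_, hp'⟩).mul hcc hK).eventually hcc hxc,
      hcc.dom_mem_nhds hxc] with z h1 h2 using h1.continuousAt hcc h2
  · filter_upwards [hy, evpos' hk₂ k₂0, evpos' hlt ht0] with z e1 e2 e3 hz
    have e4 : 0 < c.lam r₂ z := GChart.lam_pos_iff.2 (hz.symm ▸ r₂.2)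
    have e5 : c.lam ⟨_, hp'⟩ z * c.lam r₂ z = c.lam r₁ z * c.lam ⟨t, ht.1⟩ z := by
      rw [← GChart.lam_add, ← GChart.lam_add]
      exact congrArg (fun p => c.lam p z) (Subtype.ext
        (show (r₁ : Fin c.k → ℤ) - r₂ + t + r₂ = r₁ + t by abel))
    have e2' := e2.ne'
    have e3' := e3.ne'
    refine mul_right_cancel₀ (mul_pos e4 e2).ne' (e1.trans ?_)
    field_simp
    linear_combination (-k₁ z) * e5

end Lift

section LiftSmooth

variable {W : GSpace.{u}} {X : GSpace.{v}} {Y : GSpace.{w}} {i : X → Y} {g : W → X}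
  (hW : W.IsMixed) (hX : X.IsMixed) (hY : Y.IsMixed)
  (hi : IsImmersion i) (hf : IsSmooth (i ∘ g)) (hg : Continuous g)
include hW hX hY hi hf hg

/-- A continuous lift of a smooth map along an immersion is smooth in charts. -/
theorem IsImmersion.mapAt_lift {c : GChart W} (hc : c ∈ W.atlas) {a : GChart X} (ha : a ∈ X.atlas)
    {b : GChart Y} (hb : b ∈ Y.atlas) {x : W} (hxc : x ∈ c.dom) (hxa : g x ∈ a.dom)
    (hxb : i (g x) ∈ b.dom) : GChart.MapAt c a g x := by
  classical
  have hac := hX.isChart a ha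
  have hcc := hW.isChart c hc
  obtain ⟨F, hF, hxF, hFpos, hFzero⟩ :=
    hi.exists_liftFace hW hX hY hf hg hc ha hb hxc hxa hxb
  obtain ⟨N, e, he⟩ := exists_generators hac.weaklyToric.fg
  let ξ : W → Fin N → ℝ := fun z j => a.lam (e j) (g z)
  have hξ : ContinuousAt ξ x := continuousAt_pi.2 fun j =>
    ContinuousAt.comp (g := a.lam (e j)) (hac.continuousAt_lam hxa _) hg.continuousAt
  -- It suffices that a vector `t` killed by the differentials of all functions with smooth
  -- composition with `ξ` is zero.
  have hreal : ∀ j, c.RealAt x fun z => ξ z j := by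
    refine fun j => GChart.realAt_of_forall_fderiv hcc hξ (fun t ht => ?_) j
    -- the directions transverse to the stratum
    have h0 : ∀ j, (e j : Fin a.k → ℤ) ∉ (a.coord (g x)).supp → t j = 0 := by
      intro j hj
      have hξj : ξ x j = 0 := GChart.lam_eq_zero_iff.2 hj
      by_cases hjF : (e j : Fin a.k → ℤ) ∈ F
      · obtain ⟨H, p', K, hH, hH0, hK, K0, hev⟩ :=
          hi.exists_smooth_factor hW hX hY hf hg hc ha hb hxc hxa hxb hF hxF hFpos hjF
        obtain ⟨O, G, hO, hG, hxO, hGev⟩ := hH.exists_eq_generators he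
        have hGd : DifferentiableAt ℝ G (ξ x) :=
          (hG.contDiffAt (hO.mem_nhds hxO)).differentiableAt (by simp)
        -- The product `y j * G y` pulls back to `λ_{p'} K`. As the coordinate `ξ x j` is zero, its
        -- differential on `t` is `G (ξ x) * t j`, with `G (ξ x) > 0`.
        have h1 := ht O (fun y => y j * G y) hO hxO ((contDiff_apply ℝ ℝ j).contDiffOn.mul hG)
          (((GChart.realAt_lam c x p').mul hcc hK).congr (by
            filter_upwards [hev, hg.continuousAt.eventually hGev] with z h2 h3
            rw [← h2, h3]))
        rw [((hasFDerivAt_apply j (ξ x)).fun_mul hGd.hasFDerivAt).fderiv] at h1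
        have h3 : ξ x j * fderiv ℝ G (ξ x) t + G (ξ x) * t j = 0 := h1
        rw [hξj, zero_mul, zero_add] at h3
        have h4 : H (g x) = G (ξ x) := hGev.self_of_nhds
        exact (mul_eq_zero.1 h3).resolve_left (h4 ▸ hH0.ne')
      · have h1 := ht Set.univ (fun y => y j) isOpen_univ trivial
          (contDiff_apply ℝ ℝ j).contDiffOn
          ((GChart.realAt_const c x 0).congr (hFzero _ hjF))
        rw [(hasFDerivAt_apply j (ξ x)).fderiv] at h1
        exact h1
    let J : Finset (Fin N) := Finset.univ.filter fun j => (e j : Fin a.k → ℤ) ∈ (a.coord (g x)).supp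
    have hJ : ∀ j, j ∈ J ↔ (e j : Fin a.k → ℤ) ∈ (a.coord (g x)).supp := fun j => by simp [J]
    have hJpos : ∀ j ∈ J, 0 < ξ x j := fun j hj => GChart.lam_pos_iff.2 ((hJ j).1 hj)
    -- the relations between the generators of the support
    have hrel : ∀ m m' : Fin N → ℕ, ∑ j, m j • e j = ∑ j, m' j • e j →
        ((∑ j, m j • e j : a.P) : Fin a.k → ℤ) ∈ (a.coord (g x)).supp →
        ∑ j ∈ J, (m j : ℝ) * (t j / ξ x j) = ∑ j ∈ J, (m' j : ℝ) * (t j / ξ x j) := by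
      intro m m' hm hms
      have hlog : ∀ m : Fin N → ℕ,
          ((∑ j, m j • e j : a.P) : Fin a.k → ℤ) ∈ (a.coord (g x)).supp →
          ∀ᶠ z in 𝓝 x, ∑ j ∈ J, (m j : ℝ) * Real.log (ξ z j) =
            Real.log (a.lam (∑ j, m j • e j) (g z)) := by
        intro m hm
        rw [Model.sum_mem_supp_iff] at hm
        filter_upwards [hg.continuousAt.eventually (hac.eventually_supp_le hxa)] with z hz
        have h1 : a.lam (∑ j, m j • e j) (g z) = ∏ j ∈ J, ξ z j ^ m j := by
          rw [GChart.lam, Model.apply_sum, NNReal.coe_prod]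
          refine (Finset.prod_subset (Finset.subset_univ J) fun j _ hj => ?_).symm
          rw [(by_contra fun h => hj ((hJ j).2 (hm j h)) : m j = 0), pow_zero, NNReal.coe_one]
        rw [h1, Real.log_prod fun j hj => pow_ne_zero _
          (GChart.lam_pos_iff.2 (hz ((hJ j).1 hj))).ne']
        exact Finset.sum_congr rfl fun j _ => (Real.log_pow _ _).symm
      let O : Set (Fin N → ℝ) := ⋂ j ∈ J, {y | 0 < y j}
      have hO : IsOpen O := isOpen_biInter_finset fun j _ =>
        isOpen_lt continuous_const (continuous_apply j)
      have hOpos : ∀ y ∈ O, ∀ j ∈ J, 0 < y j := fun y hy j hj => by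
        simp only [O, Set.mem_iInter] at hy
        exact hy j hj
      have hxO : ξ x ∈ O := by
        simp only [O, Set.mem_iInter]
        exact hJpos
      -- A relation between generators of the support makes this logarithmic sum zero along `ξ`,
      -- though not on `ℝᴺ`. Hence the numbers `t j / ξ x j` satisfy every relation between these
      -- generators and define the additive map `v` below.
      have h1 := ht O (fun y => ∑ j ∈ J, ((m j : ℝ) - m' j) * Real.log (y j)) hO hxO
        (ContDiffOn.sum fun j hj => contDiffOn_const.mul
          ((contDiff_apply ℝ ℝ j).contDiffOn.log fun y hy => (hOpos y hy j hj).ne'))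
        ((GChart.realAt_const c x 0).congr (by
          filter_upwards [hlog m hms, hlog m' (hm ▸ hms)] with z h1 h2
          simp only [sub_mul, Finset.sum_sub_distrib]
          rw [h1, h2, hm, sub_self]))
      have h2 : HasFDerivAt (fun y : Fin N → ℝ => ∑ j ∈ J, ((m j : ℝ) - m' j) * Real.log (y j))
          (∑ j ∈ J, ((m j : ℝ) - m' j) • (ξ x j)⁻¹ •
            (ContinuousLinearMap.proj j : (Fin N → ℝ) →L[ℝ] ℝ)) (ξ x) :=
        HasFDerivAt.fun_sum fun j hj => ((hasFDerivAt_apply j (ξ x)).log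
          (hJpos j hj).ne').const_mul _
      rw [h2.fderiv, sum_apply] at h1
      rw [← sub_eq_zero, ← Finset.sum_sub_distrib, ← h1]
      refine Finset.sum_congr rfl fun j _ => ?_
      change _ = ((m j : ℝ) - m' j) * ((ξ x j)⁻¹ * t j)
      ring
    choose m hm using he
    let v : (a.coord (g x)).supp →+ ℝ :=
      { toFun := fun p => ∑ j ∈ J, (m ⟨p.1, p.2.1⟩ j : ℝ) * (t j / ξ x j)
        map_zero' := by
          rw [hrel _ (fun _ => 0)]
          · simp
          · rw [← hm]
            simp only [zero_smul, Finset.sum_const_zero]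
            rfl
          · rw [← hm]
            exact zero_mem _
        map_add' := by
          intro p q
          rw [hrel _ (m ⟨p.1, p.2.1⟩ + m ⟨q.1, q.2.1⟩)]
          · simp only [Pi.add_apply, Nat.cast_add, add_mul, Finset.sum_add_distrib]
          · simp only [Pi.add_apply, add_smul, Finset.sum_add_distrib]
            rw [← hm, ← hm, ← hm]
            rfl
          · rw [← hm]
            exact (p + q).2 }
    have hv : ∀ j (hj : (e j : Fin a.k → ℤ) ∈ (a.coord (g x)).supp),
        v ⟨e j, hj⟩ = t j / ξ x j := by
      intro j hj
      change ∑ l ∈ J, (m (e j) l : ℝ) * (t l / ξ x l) = _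
      have hs : ∑ l, (Pi.single j 1 : Fin N → ℕ) l • e l = e j := by
        rw [Finset.sum_eq_single j (fun l _ hl => by rw [Pi.single_eq_of_ne hl, zero_smul])
          (fun h => absurd (Finset.mem_univ j) h), Pi.single_eq_same, one_smul]
      rw [hrel (m (e j)) (Pi.single j 1) (by rw [← hm, hs]) (by rw [← hm]; exact hj),
        Finset.sum_eq_single j (fun l _ hl => by
          rw [Pi.single_eq_of_ne hl, Nat.cast_zero, zero_mul])
          (fun h => absurd ((hJ j).2 hj) h), Pi.single_eq_same, Nat.cast_one, one_mul]
    have : Nonempty X := ⟨g x⟩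
    have hdlam : ∀ j, a.dlam (g x) v (e j) = t j := by
      intro j
      by_cases hj : (e j : Fin a.k → ℤ) ∈ (a.coord (g x)).supp
      · rw [GChart.dlam, dif_pos hj, hv j hj]
        exact mul_div_cancel₀ _ (hJpos j ((hJ j).2 hj)).ne'
      · rw [GChart.dlam, dif_neg hj, h0 j hj]
    -- Now `t` is the image of the tangent vector `v` of the stratum. The extensions of the `λ_q ∘
    -- i` compose with `ξ` to the smooth functions `λ_q ∘ i ∘ g`, so they kill `t`, and the
    -- injectivity of the derivative applies.
    have hv0 : v = 0 := by
      refine hi.eq_zero_of_fderiv hX hY ha hb hxa hxb (e := e) v fun q => ?_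
      obtain ⟨O, G, hO, hG, hxO, hGev⟩ := (((hi.1.mapAt hX hY ha hb hxa hxb).nonnegAt
        q).realAt hac).exists_eq_generators fun p => ⟨m p, hm p⟩
      refine ⟨O, G, hO, hG, hxO, hGev, ?_⟩
      rw [funext hdlam]
      refine ht O G hO hxO hG
        ((((hf.mapAt hW hY hc hb hxc hxb).nonnegAt q).realAt hcc).congr ?_)
      filter_upwards [hg.continuousAt.eventually hGev] with z hz
      exact hz.symm
    funext j
    rw [← hdlam j, hv0]
    simp [GChart.dlam]
  refine ⟨hg.continuousAt, fun p => ?_⟩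
  by_cases hp : (p : Fin a.k → ℤ) ∈ F
  · obtain ⟨H, p', K, hH, hH0, hK, K0, hev⟩ :=
      hi.exists_smooth_factor hW hX hY hf hg hc ha hb hxc hxa hxb hF hxF hFpos hp
    obtain ⟨O, G, hO, hG, hxO, hGev⟩ := hH.exists_eq_generators he
    -- With `ξ` smooth, `H ∘ g = G ∘ ξ` is smooth, and the factorization can be divided by it.
    have hHg : c.RealAt x fun z => H (g z) :=
      (GChart.RealAt.comp hcc hreal hO hG hxO).congr (hg.continuousAt.eventually hGev)
    refine Or.inl ⟨p', _, hK.mul hcc (hHg.inv hcc hH0.ne'), mul_pos K0 (inv_pos.2 hH0), ?_⟩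
    filter_upwards [hev, (hHg.continuousAt hcc hxc).eventually_const_lt hH0] with z h1 h2
    rw [← mul_assoc, ← h1, mul_assoc, mul_inv_cancel₀ h2.ne', mul_one]
    rfl
  · exact Or.inr ((hFzero p hp).mono fun z hz => NNReal.coe_eq_zero.1 hz)

/-- A continuous lift of a smooth map along an immersion is smooth. -/
theorem IsImmersion.isSmooth_lift : IsSmooth g := by
  refine isSmooth_of_mapAt hW hX fun x => ?_
  obtain ⟨c, hc, hxc⟩ := hW.cover x
  obtain ⟨a, ha, hxa⟩ := hX.cover (g x)
  obtain ⟨b, hb, hxb⟩ := hY.cover (i (g x))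
  exact ⟨c, hc, hxc, a, ha, hxa, hi.mapAt_lift hW hX hY hf hg hc ha hb hxc hxa hxb⟩

omit hi hf hg in
/-- If `i ∘ g` is an embedding, then so is `g`. -/
theorem IsEmbedding.of_comp (hi : IsImmersion i) (hg : IsSmooth g) (h : IsEmbedding (i ∘ g)) :
    IsEmbedding g := by
  refine ⟨⟨hg, IsInteriorImmersion.of_comp (isMixed_corners hW) (isMixed_corners hX)
    (isMixed_corners hY) (hg.cornerMap hW hX) (hi.1.cornerMap hX hY) hi.2.mTildeMap_injective ?_⟩,
    Topology.IsEmbedding.of_comp hg.1 hi.1.1 h.2⟩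
  rw [← cornerMap_comp hW hX hY hg hi.1 h.1.1]
  exact h.1.2

end LiftSmooth

end GCorners

/-! ### Factoring smooth maps through embeddings -/

theorem corollary4p11 (W : GCorners.Manifold.{u}) (X : GCorners.Manifold.{v})
    (Y : GCorners.Manifold.{w})
    (i : X.toGSpace → Y.toGSpace) (f : W.toGSpace → Y.toGSpace)
    (hi : GCorners.IsEmbedding i) (hf : GCorners.IsSmooth f)
    (hfi : Set.range f ⊆ Set.range i) :
    (∃! g : W.toGSpace → X.toGSpace, GCorners.IsSmooth g ∧ f = i ∘ g) ∧
      (GCorners.IsEmbedding f →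
        ∀ g : W.toGSpace → X.toGSpace, GCorners.IsSmooth g → f = i ∘ g →
          GCorners.IsEmbedding g) := by
  constructor
  · choose g hg using fun z => hfi (Set.mem_range_self z)
    obtain rfl : f = i ∘ g := funext fun z => (hg z).symm
    refine ⟨g, ⟨?_, rfl⟩, fun g' h => funext fun z => hi.2.injective ?_⟩
    -- The pointwise lift is continuous because the topology of `X` is induced by `i`; smoothness
    -- then uses only that `i` is an immersion.
    · exact hi.1.isSmooth_lift W.isMixed X.isMixed Y.isMixed hf (hi.2.continuous_iff.2 hf.1)
    · exact (congrFun h.2 z).symm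
  · rintro hf' g hg rfl
    exact .of_comp W.isMixed X.isMixed Y.isMixed hi.1 hg hf'
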